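/- For $i=1,2$ let $G_i$ be a locally compact Hausdorff abelian group with Pontryagin dual $\widehat{G_i}$, let $\Omega_i\subseteq\widehat{G_i}$ be a Borel set of finite Haar measure, and let $\Gamma_i\subseteq G_i$. For a locally compact Hausdorff abelian group $G$ and a Borel set $\Omega\subseteq\widehat G$ of finite Haar measure, the Paley–Wiener space is $$PW_\Omega(G)=\{f\in L^2(G):\ \widehat f=0 \text{ almost everywhere on } \widehat G\setminus\Omega\},$$ where $\widehat f\in L^2(\widehat G)$ is the $L^2$ Fourier transform of $f$; each of its elements has a unique continuous representative, and is identified with it. A set $\Upsilon\subseteq G$ is a uniqueness set for a set $\mathcal X$ of functions on $G$ if $f=0$ whenever $f\in\mathcal X$ and $f(\upsilon)=0$ for all $\upsilon\in\Upsilon$. Identify $\widehat{G_1\times G_2}$ with $\widehat{G_1}\times\widehat{G_2}$. If $\Gamma_i$ is a uniqueness set for $PW_{\Omega_i}(G_i)$ for $i=1,2$, then $\Gamma_1\times\Gamma_2$ is a uniqueness set for $PW_{\Omega_1\times\Omega_2}(G_1\times G_2)$. -/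

import Mathlib

open MeasureTheory Filter Topology
open scoped ENNReal

noncomputable section

/-- A Haar measure on a locally compact group, as a regular measure on the Borel `σ`-algebra.
The `σ`-algebra is fixed to be the Borel one (not an instance argument), because on a product
group that is not second countable the Borel `σ`-algebra may be larger than the product one.
The normalisation of the Haar measures is immaterial in everything below. -/
def haarBorel (G : Type*) [Group G] [TopologicalSpace G] [IsTopologicalGroup G]
    [LocallyCompactSpace G] : @Measure G (borel G) :=
  letI : MeasurableSpace G := borel G
  haveI : BorelSpace G := ⟨rfl⟩
  Measure.haar

section LCA

variable {G : Type*} [CommGroup G] [TopologicalSpace G] [IsTopologicalGroup G]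
  [LocallyCompactSpace G]

/-- The Fourier transform `ξ ↦ ∫ f(x) conj ⟨x, ξ⟩ dx` (meaningful for integrable `f`). -/
def fourierL1 (f : G → ℂ) (ξ : PontryaginDual G) : ℂ :=
  letI : MeasurableSpace G := borel G
  ∫ x, f x * starRingEnd ℂ ((ξ x : Circle) : ℂ) ∂(haarBorel G)

/-- `f ∈ L²(G)`, for a function `f` representing its class. -/
def IsL2 {H : Type*} [CommGroup H] [TopologicalSpace H] [IsTopologicalGroup H]
    [LocallyCompactSpace H] (f : H → ℂ) : Prop :=
  letI : MeasurableSpace H := borel H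
  MemLp f 2 (haarBorel H)

/-- Convergence of a sequence of functions to `f` in the `L²` norm. -/
def TendstoL2 {H : Type*} [CommGroup H] [TopologicalSpace H] [IsTopologicalGroup H]
    [LocallyCompactSpace H] (φ : ℕ → H → ℂ) (f : H → ℂ) : Prop :=
  letI : MeasurableSpace H := borel H
  Tendsto (fun n => eLpNorm (φ n - f) 2 (haarBorel H)) atTop (𝓝 0)

/-- `f ∈ L¹(G)`. -/
def IsL1 (f : G → ℂ) : Prop :=
  letI : MeasurableSpace G := borel G
  Integrable f (haarBorel G)

/-- `F ∈ L²(Ĝ)` is the Fourier transform of `f ∈ L²(G)`: the Fourier transform on `L²` is the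
extension by continuity of the integral transform on `L¹ ∩ L²`, that is, there are
`φ n ∈ L¹ ∩ L²` with `φ n → f` in `L²(G)` whose Fourier transforms tend to `F` in `L²(Ĝ)`. -/
def IsFourierL2 (f : G → ℂ) (F : PontryaginDual G → ℂ) : Prop :=
  IsL2 f ∧ IsL2 F ∧ ∃ φ : ℕ → G → ℂ, (∀ n, IsL1 (φ n) ∧ IsL2 (φ n)) ∧
    TendstoL2 φ f ∧ TendstoL2 (fun n => fourierL1 (φ n)) F

/-- `F` vanishes almost everywhere outside `Ω`. -/
def SupportedOn (F : PontryaginDual G → ℂ) (Ω : Set (PontryaginDual G)) : Prop :=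
  letI : MeasurableSpace (PontryaginDual G) := borel (PontryaginDual G)
  ∀ᵐ ξ ∂(haarBorel (PontryaginDual G)), ξ ∉ Ω → F ξ = 0

/-- The Paley-Wiener space `PW_Ω(G)`: the functions `f ∈ L²(G)` whose Fourier transform is
supported on `Ω`. -/
def PaleyWiener (Ω : Set (PontryaginDual G)) : Set (G → ℂ) :=
  {f | ∃ F : PontryaginDual G → ℂ, IsFourierL2 f F ∧ SupportedOn F Ω}

/-- When `Ω` has finite measure, every class in `PW_Ω(G)` has exactly one continuous
representative. This is the set of these representatives; it is `PW_Ω(G)` as a space of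
functions that can be evaluated at points. -/
def PaleyWienerCont (Ω : Set (PontryaginDual G)) : Set (G → ℂ) :=
  {f | f ∈ PaleyWiener Ω ∧ Continuous f}

end LCA

/-- `Υ` is a uniqueness set for the set of functions `X`. -/
def IsUniquenessSet {G : Type*} (X : Set (G → ℂ)) (Υ : Set G) : Prop :=
  ∀ f ∈ X, (∀ υ ∈ Υ, f υ = 0) → f = 0

/-- `Ω₁ × Ω₂` as a subset of the dual of `G₁ × G₂`, under the identification of that dual with the
product of the duals which sends `χ` to the pair of its restrictions to `G₁` and to `G₂`. -/
def dualProd {G₁ G₂ : Type*} [CommGroup G₁] [TopologicalSpace G₁] [IsTopologicalGroup G₁]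
    [CommGroup G₂] [TopologicalSpace G₂] [IsTopologicalGroup G₂]
    (Ω₁ : Set (PontryaginDual G₁)) (Ω₂ : Set (PontryaginDual G₂)) :
    Set (PontryaginDual (G₁ × G₂)) :=
  {χ | PontryaginDual.map (ContinuousMonoidHom.inl G₁ G₂) χ ∈ Ω₁ ∧
    PontryaginDual.map (ContinuousMonoidHom.inr G₁ G₂) χ ∈ Ω₂}

end

open scoped CompactlySupported InnerProductSpace BoundedContinuousFunction
open WeakDual
open scoped Pointwise

set_option linter.unusedSectionVars false

/-! Everything rests on slices. Let `f` lie in the Paley–Wiener space of the product. If, for every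
`y`, the function `f(·, y)` lies in the space of `Ω₁` and, for every `x`, the function `f(x, ·)`
lies in the space of `Ω₂`, then vanishing on `Γ₁ ×ˢ Γ₂` propagates: for `y ∈ Γ₂` the slice `f(·, y)`
vanishes on `Γ₁`, hence everywhere; so every slice `f(x, ·)` vanishes on `Γ₂`, hence everywhere.

The slices are controlled on the dual side (`slices_mem_paleyWienerCont`). Since `Ω₁ × Ω₂` has
finite measure, `f` is the inverse Fourier integral of some `F` in `L¹ ∩ L²` supported there. Then
`f(·, y)` is the inverse Fourier integral of `U(ξ) = ∫ F(ξ, η) η(y) dη`, which is supported on `Ω₁`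
and is square integrable by Cauchy–Schwarz, because `Ω₂` has finite measure.

No countability is assumed, so the Borel σ-algebra of a product may be too big for Fubini and Haar
measures need not be σ-finite. Hence `U` is not defined fibrewise: restricted to the strip over
`Ω₂`, Haar measure on the product pushes forward to at most a multiple of Haar measure on the first
factor (`exists_const_map_fst_le`), and `U` comes from the Riesz representation theorem in `L²`
(`exists_memLp_integral_mul_comp`).

Passing between the `L²` definition of the space and inverse Fourier integrals takes Plancherel's
theorem and inversion, proved up to a constant `c` since the Haar measures are not normalised
against each other. Stone's theorem for the regular representation gives finite measures `ν_u` on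
the dual whose transforms are the autocorrelations of `u`. Commutativity of convolution gives `|û|²
dν_v = |v̂|² dν_u`, together with translated versions; averaging these over the dual forces `|û|² dm
= c dν_u` with one `c` for all `u`, and comparing total masses is Plancherel's theorem
(`exists_const_plancherel`). -/

/-! ### Spectral measures from Gelfand duality and Riesz–Markov -/

/-- The spectral measure of a vector, for a representation of a commutative `C⋆`-algebra. -/
theorem exists_spectral_measure {B H : Type*} [CommCStarAlgebra B] [NormedAddCommGroup H]
    [InnerProductSpace ℂ H] [CompleteSpace H] [MeasurableSpace (characterSpace ℂ B)]
    [BorelSpace (characterSpace ℂ B)] (ρ : B →⋆ₐ[ℂ] (H →L[ℂ] H)) (v : H) :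
    ∃ ν : Measure (characterSpace ℂ B), IsFiniteMeasure ν ∧ ν.Regular ∧
      ∀ a : B, ∫ χ, (χ a : ℂ) ∂ν = inner ℂ v (ρ a v) := by
  let X := characterSpace ℂ B
  let Γ := gelfandStarTransform B
  let φ : C(X, ℂ) →ₗ[ℂ] ℂ :=
    { toFun := fun h => inner ℂ v (ρ (Γ.symm h) v)
      map_add' := by intro a b; simp
      map_smul' := by intro c a; simp }
  have hpos : ∀ h : C(X, ℂ), φ (star h * h) = ((‖ρ (Γ.symm h) v‖ ^ 2 : ℝ) : ℂ) := by
    intro h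
    change inner ℂ v (ρ (Γ.symm (star h * h)) v) = _
    rw [map_mul, map_star, map_mul, map_star, ContinuousLinearMap.star_eq_adjoint,
      mul_apply_eq_comp, ContinuousLinearMap.adjoint_inner_right,
      inner_self_eq_norm_sq_to_K]
    simp
  let R : C(X, ℝ) → C(X, ℂ) := fun f => ⟨fun x => (f x : ℂ), by fun_prop⟩
  have hnonneg : ∀ f : C(X, ℝ), 0 ≤ f → ∃ r : ℝ, 0 ≤ r ∧ φ (R f) = r := by
    intro f hf
    -- A nonnegative `f` is `star g * g` for its square root `g`, so `hpos` makes `φ` nonnegative on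
    -- it.
    let g : C(X, ℝ) := ⟨fun x => Real.sqrt (f x), by fun_prop⟩
    refine ⟨_, sq_nonneg _, (?_ : _ = ((‖ρ (Γ.symm (R g)) v‖ ^ 2 : ℝ) : ℂ))⟩
    rw [← hpos]
    congr 1
    ext x
    have : 0 ≤ f x := hf x
    simp only [R, g, ContinuousMap.coe_mk, ContinuousMap.mul_apply, ContinuousMap.star_apply,
      RCLike.star_def, Complex.conj_ofReal]
    rw [← Complex.ofReal_mul, Real.mul_self_sqrt this]
  have hRadd : ∀ f g, R (f + g) = R f + R g := by intro f g; ext x; simp [R]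
  have hRsmul : ∀ (c : ℝ) f, R (c • f) = (c : ℂ) • R f := by intro f g; ext x; simp [R]
  have hreal : ∀ f : C(X, ℝ), φ (R f) = ((φ (R f)).re : ℂ) := by
    intro f
    -- A real function is a difference of two nonnegative ones, so `φ` is real on it.
    obtain ⟨r, -, hr⟩ := hnonneg (f ⊔ 0) le_sup_right
    obtain ⟨s, -, hs⟩ := hnonneg (f ⊔ 0 - f) (sub_nonneg.2 le_sup_left)
    have : R (f ⊔ 0) = R (f ⊔ 0 - f) + R f := by rw [← hRadd, sub_add_cancel]
    rw [this, map_add, hs] at hr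
    have h2 : φ (R f) = ((r - s : ℝ) : ℂ) := by push_cast; linear_combination hr
    rw [h2]; simp
  let Λ : C_c(X, ℝ) →ₚ[ℝ] ℝ :=
    { toFun := fun f => (φ (R f.toContinuousMap)).re
      map_add' := by
        intro f g
        have : (f + g).toContinuousMap = f.toContinuousMap + g.toContinuousMap := rfl
        rw [this, hRadd, map_add, Complex.add_re]
      map_smul' := by
        intro c f
        have : (c • f).toContinuousMap = c • f.toContinuousMap := rfl
        rw [this, hRsmul, map_smul]
        simp
      monotone' := by
        intro f g hfg
        obtain ⟨r, hr0, hr⟩ := hnonneg (g.toContinuousMap - f.toContinuousMap)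
          (fun x => sub_nonneg.2 (hfg x))
        have : R g.toContinuousMap =
            R (g.toContinuousMap - f.toContinuousMap) + R f.toContinuousMap := by
          rw [← hRadd, sub_add_cancel]
        simp only [this, map_add, hr, Complex.add_re, Complex.ofReal_re]
        linarith }
  refine ⟨RealRMK.rieszMeasure Λ, inferInstance, inferInstance, fun a => ?_⟩
  set ν := RealRMK.rieszMeasure Λ
  have hint : ∀ f : C(X, ℝ), ∫ x, f x ∂ν = (φ (R f)).re := fun f =>
    RealRMK.integral_rieszMeasure Λ ⟨f, HasCompactSupport.of_compactSpace _⟩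
  let h : C(X, ℂ) := Γ a
  let f : C(X, ℝ) := ⟨fun x => (h x).re, by fun_prop⟩
  let g : C(X, ℝ) := ⟨fun x => (h x).im, by fun_prop⟩
  have hdec : h = R f + Complex.I • R g := by
    ext x
    simp only [R, f, g, ContinuousMap.add_apply, ContinuousMap.smul_apply, ContinuousMap.coe_mk,
      smul_eq_mul]
    rw [mul_comm, Complex.re_add_im]
  have hi : Integrable h ν :=
    h.continuous.integrable_of_hasCompactSupport (HasCompactSupport.of_compactSpace _)
  have e1 : ∫ χ, (χ a : ℂ) ∂ν = ∫ x, h x ∂ν := rfl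
  have e2 : inner ℂ v (ρ a v) = φ h := by simp [φ, h]
  rw [e1, e2, hdec, map_add, map_smul, hreal f, hreal g, ← hint f, ← hint g, ← hdec]
  have := integral_re_add_im hi
  rw [← this]
  simp [f, g, mul_comm]

/-! ### Integrated form of a unitary representation -/

section IntegratedOperator

variable {G : Type*} [CommGroup G] [TopologicalSpace G] [IsTopologicalGroup G]
  [LocallyCompactSpace G] [MeasurableSpace G] [BorelSpace G]
  {H : Type*} [NormedAddCommGroup H] [InnerProductSpace ℂ H] [CompleteSpace H]

/-- The operator `∫ k(x) T(x) dx` attached to a unitary representation `T` and a continuous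
compactly supported function `k`. -/
noncomputable def integratedOp (μ : Measure G) [IsFiniteMeasureOnCompacts μ]
    (T : G →* unitary (H →L[ℂ] H)) (hT : ∀ v, Continuous fun x => (T x : H →L[ℂ] H) v)
    (k : C_c(G, ℂ)) : H →L[ℂ] H :=
  have hi : ∀ v : H, Integrable (fun x => k x • (T x : H →L[ℂ] H) v) μ := fun v =>
    (k.continuous.smul (hT v)).integrable_of_hasCompactSupport k.hasCompactSupport.smul_right
  LinearMap.mkContinuous
    { toFun := fun v => ∫ x, k x • (T x : H →L[ℂ] H) v ∂μ
      map_add' := fun v w => by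
        simp only [map_add, smul_add]
        exact integral_add (hi v) (hi w)
      map_smul' := fun c v => by
        simp only [map_smul, smul_comm _ c, integral_smul, RingHom.id_apply] }
    (∫ x, ‖k x‖ ∂μ) (fun v => by
      refine (norm_integral_le_integral_norm _).trans (le_of_eq ?_)
      rw [← integral_mul_const]
      congr 1
      ext x
      rw [norm_smul]
      congr 1
      exact ((Unitary.linearIsometryEquiv (T x)).norm_map v : _))

variable {μ : Measure G} [IsFiniteMeasureOnCompacts μ]
  {T : G →* unitary (H →L[ℂ] H)} {hT : ∀ v, Continuous fun x => (T x : H →L[ℂ] H) v}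

theorem norm_unitary_apply (U : unitary (H →L[ℂ] H)) (v : H) : ‖(U : H →L[ℂ] H) v‖ = ‖v‖ :=
  (Unitary.linearIsometryEquiv U).norm_map v

theorem integratedOp_apply (k : C_c(G, ℂ)) (v : H) :
    integratedOp μ T hT k v = ∫ x, k x • (T x : H →L[ℂ] H) v ∂μ := rfl

theorem integrable_smul_unitary (hT : ∀ v, Continuous fun x => (T x : H →L[ℂ] H) v)
    (k : C_c(G, ℂ)) (v : H) : Integrable (fun x => k x • (T x : H →L[ℂ] H) v) μ :=
  (k.continuous.smul (hT v)).integrable_of_hasCompactSupport k.hasCompactSupport.smul_right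

theorem commute_integratedOp (k : C_c(G, ℂ)) (c : H →L[ℂ] H)
    (hc : ∀ x, c * (T x : H →L[ℂ] H) = T x * c) :
    c * integratedOp μ T hT k = integratedOp μ T hT k * c := by
  ext v
  simp only [mul_apply_eq_comp, integratedOp_apply]
  rw [← c.integral_comp_comm (integrable_smul_unitary hT k v)]
  congr 1
  ext x
  rw [map_smul]
  congr 1
  exact DFunLike.congr_fun (hc x) v

/-- Translation `x ↦ k(y⁻¹ x)` of a compactly supported function. -/
noncomputable def translateCc (y : G) (k : C_c(G, ℂ)) : C_c(G, ℂ) :=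
  ⟨⟨fun x => k (y⁻¹ * x), by fun_prop⟩,
    k.hasCompactSupport.comp_homeomorph (Homeomorph.mulLeft y⁻¹)⟩

/-- For `y` in a compact neighbourhood `C` of `1`, all the integrands live on one compact set, the
union of `C * tsupport k` and `tsupport k`. -/
theorem continuous_integral_norm_translate_sub (k : C_c(G, ℂ)) :
    ContinuousAt (fun y => ∫ x, ‖translateCc y k x - k x‖ ∂μ) 1 := by
  obtain ⟨C, hC, hC1⟩ := exists_compact_mem_nhds (1 : G)
  have hcomp : IsCompact (C * tsupport k ∪ tsupport k) :=
    (hC.mul k.hasCompactSupport).union k.hasCompactSupport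
  refine ContinuousOn.continuousAt (s := C) ?_ hC1
  refine continuousOn_integral_of_compact_support hcomp ?_ ?_
  · have : Continuous (Function.uncurry fun y x => ‖translateCc y k x - k x‖) := by
      change Continuous fun p : G × G => ‖k (p.1⁻¹ * p.2) - k p.2‖
      fun_prop
    exact this.continuousOn
  · intro y x hy hx
    have h1 : k x = 0 := image_eq_zero_of_notMem_tsupport fun h => hx (Or.inr h)
    have h2 : k (y⁻¹ * x) = 0 := image_eq_zero_of_notMem_tsupport fun h =>
      hx (Or.inl ⟨y, hy, y⁻¹ * x, h, by simp⟩)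
    change ‖k (y⁻¹ * x) - k x‖ = 0
    simp [h1, h2]

theorem norm_integratedOp_sub_le (k l : C_c(G, ℂ)) :
    ‖integratedOp μ T hT k - integratedOp μ T hT l‖ ≤ ∫ x, ‖k x - l x‖ ∂μ := by
  refine ContinuousLinearMap.opNorm_le_bound _ (integral_nonneg fun _ => norm_nonneg _) fun v => ?_
  rw [sub_apply, integratedOp_apply, integratedOp_apply,
    ← integral_sub (integrable_smul_unitary hT k v) (integrable_smul_unitary hT l v),
    ← integral_mul_const]
  refine (norm_integral_le_integral_norm _).trans (le_of_eq ?_)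
  congr 1
  ext x
  rw [← sub_smul, norm_smul, norm_unitary_apply]

theorem mul_integratedOp [μ.IsMulLeftInvariant] (k : C_c(G, ℂ)) (y : G) :
    (T y : H →L[ℂ] H) * integratedOp μ T hT k = integratedOp μ T hT (translateCc y k) := by
  ext v
  rw [mul_apply_eq_comp, integratedOp_apply, integratedOp_apply,
    ← ContinuousLinearMap.integral_comp_comm _ (integrable_smul_unitary hT k v),
    ← integral_mul_left_eq_self _ y⁻¹]
  congr 1
  ext x
  change _ = k (y⁻¹ * x) • _
  rw [map_smul]
  congr 1
  rw [map_mul]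
  change (T y : H →L[ℂ] H) (((T y⁻¹ : H →L[ℂ] H) * (T x : H →L[ℂ] H)) v) = _
  rw [← mul_apply_eq_comp, ← mul_assoc, ← Submonoid.coe_mul, ← map_mul]
  simp

/-- This is the gain over `T` itself, which is only strongly continuous: a translation of the
operator moves onto `k`, and the `L¹` distance of kernels bounds the operator norm. Continuity at
`1` spreads by the group law. -/
theorem continuous_mul_integratedOp [μ.IsMulLeftInvariant] (k : C_c(G, ℂ)) :
    Continuous fun y => (T y : H →L[ℂ] H) * integratedOp μ T hT k := by
  have h1 : Tendsto (fun y => (T y : H →L[ℂ] H) * integratedOp μ T hT k) (𝓝 1)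
      (𝓝 (integratedOp μ T hT k)) := by
    rw [tendsto_iff_norm_sub_tendsto_zero]
    have hc := (continuous_integral_norm_translate_sub (μ := μ) k).tendsto
    have h0 : ∫ x, ‖translateCc 1 k x - k x‖ ∂μ = 0 := by
      have : ∀ x, translateCc 1 k x = k x := fun x => by
        change k (1⁻¹ * x) = k x
        simp
      simp [this]
    rw [h0] at hc
    refine squeeze_zero (fun _ => norm_nonneg _) (fun y => ?_) hc
    rw [mul_integratedOp]
    exact norm_integratedOp_sub_le _ _
  refine continuous_iff_continuousAt.2 fun y => ?_
  have h2 : Tendsto (fun z => (T y : H →L[ℂ] H) *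
      ((T (y⁻¹ * z) : H →L[ℂ] H) * integratedOp μ T hT k)) (𝓝 y)
      (𝓝 ((T y : H →L[ℂ] H) * integratedOp μ T hT k)) := by
    refine Tendsto.const_mul _ (h1.comp ?_)
    have : Tendsto (fun z => y⁻¹ * z) (𝓝 y) (𝓝 (y⁻¹ * y)) :=
      (continuous_const.mul continuous_id).continuousAt
    simpa using this
  refine h2.congr fun z => ?_
  rw [← mul_assoc, ← Submonoid.coe_mul, ← map_mul]
  simp

/-- An approximate identity: `k` is a bump of integral one supported where `T x` moves `v` by less
than `ε`, and `v` is itself the integral of `k x • v`. -/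
theorem exists_norm_integratedOp_sub_lt [T2Space G] [μ.IsOpenPosMeasure] (v : H) {ε : ℝ}
    (hε : 0 < ε) : ∃ k : C_c(G, ℂ), ‖integratedOp μ T hT k v - v‖ ≤ ε := by
  have hU : {x | ‖(T x : H →L[ℂ] H) v - v‖ < ε} ∈ 𝓝 (1 : G) := by
    refine IsOpen.mem_nhds ?_ (by simpa using hε)
    exact isOpen_lt ((hT v).sub continuous_const).norm continuous_const
  obtain ⟨f, hf1, hfc, hf01, hfU⟩ : ∃ f : C(G, ℝ), f 1 = 1 ∧ HasCompactSupport f ∧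
      (∀ x, f x ∈ Set.Icc (0 : ℝ) 1) ∧ tsupport f ⊆ {x | ‖(T x : H →L[ℂ] H) v - v‖ < ε} := by
    obtain ⟨f, h1, h2, h3⟩ := exists_continuousMap_one_of_isCompact_subset_isOpen
      (isCompact_singleton (x := (1 : G))) (isOpen_lt ((hT v).sub continuous_const).norm
        continuous_const) (Set.singleton_subset_iff.2 (mem_of_mem_nhds hU))
    exact ⟨f, h1 rfl, h2, h3.2, h3.1⟩
  have hfi : Integrable f μ := f.continuous.integrable_of_hasCompactSupport hfc
  have hpos : 0 < ∫ x, f x ∂μ :=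
    f.continuous.integral_pos_of_hasCompactSupport_nonneg_nonzero hfc (fun x => (hf01 x).1)
      (x := 1) (by simp [hf1])
  set I := ∫ x, f x ∂μ
  let k : C_c(G, ℂ) := ⟨⟨fun x => ((I⁻¹ * f x : ℝ) : ℂ), by fun_prop⟩,
    HasCompactSupport.comp_left (g := fun t : ℝ => ((I⁻¹ * t : ℝ) : ℂ)) hfc (by simp)⟩
  have hk : ∀ x, k x = ((I⁻¹ * f x : ℝ) : ℂ) := fun _ => rfl
  have hv : v = ∫ x, k x • v ∂μ := by
    rw [integral_smul_const]
    simp only [hk]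
    rw [integral_complex_ofReal, integral_const_mul, inv_mul_cancel₀ hpos.ne']
    simp
  have hki : Integrable (fun x => k x • v) μ :=
    (k.continuous.smul continuous_const).integrable_of_hasCompactSupport
      k.hasCompactSupport.smul_right
  refine ⟨k, ?_⟩
  nth_rewrite 2 [hv]
  rw [integratedOp_apply, ← integral_sub (integrable_smul_unitary hT k v) hki]
  have hle : ∀ x, ‖k x • (T x : H →L[ℂ] H) v - k x • v‖ ≤ I⁻¹ * f x * ε := by
    intro x
    rw [← smul_sub, norm_smul, hk, Complex.norm_real, Real.norm_of_nonneg
      (mul_nonneg (inv_nonneg.2 hpos.le) (hf01 x).1)]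
    by_cases hx : x ∈ tsupport f
    · exact mul_le_mul_of_nonneg_left (hfU hx).le (mul_nonneg (inv_nonneg.2 hpos.le) (hf01 x).1)
    · simp [image_eq_zero_of_notMem_tsupport hx]
  refine (norm_integral_le_of_norm_le ((hfi.const_mul _).mul_const _)
    (Eventually.of_forall hle)).trans (le_of_eq ?_)
  rw [integral_mul_const, integral_const_mul, inv_mul_cancel₀ hpos.ne', one_mul]

end IntegratedOperator

/-! ### Joint continuity of the duality pairing -/

section DualEval

variable {G : Type*} [CommGroup G] [TopologicalSpace G] [IsTopologicalGroup G]
  [LocallyCompactSpace G]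

theorem continuous_dual_eval :
    Continuous fun p : PontryaginDual G × G => ((p.1 p.2 : Circle) : ℂ) := by
  have h : Continuous fun ξ : PontryaginDual G => (ContinuousMonoidHom.toContinuousMap ξ) :=
    (ContinuousMonoidHom.isInducing_toContinuousMap G Circle).continuous
  have h2 : Continuous fun p : PontryaginDual G × G =>
      (ContinuousMonoidHom.toContinuousMap p.1) p.2 :=
    continuous_eval.comp ((h.comp continuous_fst).prodMk continuous_snd)
  exact continuous_subtype_val.comp h2

theorem continuous_dual_apply (x : G) :
    Continuous fun ξ : PontryaginDual G => ((ξ x : Circle) : ℂ) :=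
  continuous_dual_eval.comp (continuous_id.prodMk continuous_const)

theorem continuous_coe_dual (ξ : PontryaginDual G) :
    Continuous fun x : G => ((ξ x : Circle) : ℂ) :=
  continuous_dual_eval.comp (continuous_const.prodMk continuous_id)

end DualEval

/-! ### From characters of the algebra to characters of the group -/

section CharacterOfSpectrum

variable {G : Type*} [CommGroup G] [TopologicalSpace G] [IsTopologicalGroup G]
  [LocallyCompactSpace G] {B : Type*} [CommCStarAlgebra B] {ι : Type*}

/-- The characters of `B` that do not vanish on the family `l`. -/
def nonvanishingCharacters (l : ι → B) : Set (characterSpace ℂ B) := {χ | ∃ i, χ (l i) ≠ 0}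

theorem continuous_characterSpace_apply (b : B) :
    Continuous fun χ : characterSpace ℂ B => (χ b : ℂ) :=
  (gelfandTransform ℂ B b).continuous

theorem isOpen_nonvanishingCharacters (l : ι → B) : IsOpen (nonvanishingCharacters l) := by
  have : nonvanishingCharacters l = ⋃ i, {χ | χ (l i) ≠ 0} := by
    ext; simp [nonvanishingCharacters]
  rw [this]
  exact isOpen_iUnion fun i => isOpen_ne_fun (continuous_characterSpace_apply _) continuous_const

theorem norm_characterSpace_apply_le (χ : characterSpace ℂ B) (b : B) : ‖χ b‖ ≤ ‖b‖ := by
  have : Nontrivial B := ⟨1, 0, fun h => by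
    have h1 : χ 1 = 1 := map_one χ
    rw [h, map_zero] at h1
    exact zero_ne_one h1⟩
  exact AlgHom.norm_apply_le_self χ b

/-- Characters are contractive, hence equicontinuous, so weak-star continuity in the character is
enough. -/
theorem continuous_characterSpace_eval {Y : Type*} [TopologicalSpace Y]
    {f : Y → characterSpace ℂ B} {g : Y → B} (hf : Continuous f) (hg : Continuous g) :
    Continuous fun y => (f y (g y) : ℂ) := by
  refine continuous_iff_continuousAt.2 fun y => ?_
  have h1 : Tendsto (fun z => f z (g z) - f z (g y)) (𝓝 y) (𝓝 0) := by
    rw [tendsto_zero_iff_norm_tendsto_zero]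
    refine squeeze_zero (fun _ => norm_nonneg _) (fun z => ?_)
      (tendsto_iff_norm_sub_tendsto_zero.1 hg.continuousAt.tendsto)
    rw [← map_sub]
    exact norm_characterSpace_apply_le _ _
  have h2 : Tendsto (fun z => f z (g y)) (𝓝 y) (𝓝 (f y (g y))) :=
    ((continuous_characterSpace_apply (g y)).comp hf).continuousAt.tendsto
  have h3 := h1.add h2
  simp only [sub_add_cancel, zero_add] at h3
  exact h3

theorem norm_characterSpace_unitary (χ : characterSpace ℂ B) (u : unitary B) :
    ‖χ (u : B)‖ = 1 := by
  have h : χ (star (u : B) * u) = 1 := by simp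
  rw [map_mul, map_star] at h
  have h2 : ‖star (χ (u : B)) * χ (u : B)‖ = 1 := by rw [h]; simp
  rw [norm_mul, norm_star] at h2
  nlinarith [norm_nonneg (χ (u : B))]

variable {t : G →* unitary B} {l : ι → B}

/-- Near a character with `χ (l i) ≠ 0`, one has `χ (t x) = χ (t x * l i) / χ (l i)`. The quotient
is jointly continuous although `t` need not be norm continuous. -/
theorem continuous_nonvanishing_eval (ht : ∀ i, Continuous fun x => (t x : B) * l i) :
    Continuous fun p : nonvanishingCharacters l × G => (p.1.1 (t p.2 : B) : ℂ) := by
  refine continuous_iff_continuousAt.2 fun p => ?_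
  obtain ⟨i, hi⟩ := p.1.2
  have h1 : Continuous fun q : nonvanishingCharacters l × G =>
      (q.1.1 ((t q.2 : B) * l i) : ℂ) :=
    continuous_characterSpace_eval (continuous_subtype_val.comp continuous_fst)
      ((ht i).comp continuous_snd)
  have h2 : Continuous fun q : nonvanishingCharacters l × G => (q.1.1 (l i) : ℂ) :=
    continuous_characterSpace_eval (continuous_subtype_val.comp continuous_fst) continuous_const
  have h3 : ContinuousAt (fun q : nonvanishingCharacters l × G =>
      (q.1.1 ((t q.2 : B) * l i) : ℂ) / q.1.1 (l i)) p :=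
    h1.continuousAt.div h2.continuousAt hi
  refine h3.congr ?_
  filter_upwards [h2.continuousAt.eventually_ne hi] with q hq
  rw [map_mul, mul_div_cancel_right₀ _ hq]

theorem continuous_nonvanishing_eval_circle (ht : ∀ i, Continuous fun x => (t x : B) * l i) :
    Continuous fun p : nonvanishingCharacters l × G =>
      (⟨p.1.1 (t p.2 : B), mem_sphere_zero_iff_norm.2 (norm_characterSpace_unitary _ _)⟩ :
        Circle) :=
  Continuous.subtype_mk (continuous_nonvanishing_eval ht) _

/-- The character of `G` defined by a character of `B` that does not vanish on the family `l`. -/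
noncomputable def dualOfCharacter (ht : ∀ i, Continuous fun x => (t x : B) * l i)
    (χ : nonvanishingCharacters l) : PontryaginDual G :=
  ContinuousMonoidHom.mk
    { toFun := fun x => (⟨χ.1 (t x : B),
        mem_sphere_zero_iff_norm.2 (norm_characterSpace_unitary _ _)⟩ : Circle)
      map_one' := by ext; simp
      map_mul' := fun x y => by
        ext
        change χ.1 (t (x * y) : B) = χ.1 (t x : B) * χ.1 (t y : B)
        simp }
    ((continuous_nonvanishing_eval_circle ht).comp
      (continuous_const.prodMk continuous_id : Continuous fun x : G => (χ, x)))

theorem dualOfCharacter_apply (ht : ∀ i, Continuous fun x => (t x : B) * l i)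
    (χ : nonvanishingCharacters l) (x : G) :
    ((dualOfCharacter ht χ x : Circle) : ℂ) = χ.1 (t x : B) := rfl

theorem continuous_dualOfCharacter (ht : ∀ i, Continuous fun x => (t x : B) * l i) :
    Continuous (dualOfCharacter ht) := by
  refine (ContinuousMonoidHom.isInducing_toContinuousMap G Circle).continuous_iff.2 ?_
  exact ContinuousMap.continuous_of_continuous_uncurry _ (continuous_nonvanishing_eval_circle ht)

/-- The measure `m` is the image of `ν` under `dualOfCharacter`; by `hν` no mass is lost on the
characters where that map is undefined. -/
theorem exists_dual_measure_of_spectral [MeasurableSpace (characterSpace ℂ B)]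
    [BorelSpace (characterSpace ℂ B)] [MeasurableSpace (PontryaginDual G)]
    [BorelSpace (PontryaginDual G)] (ht : ∀ i, Continuous fun x => (t x : B) * l i)
    (ν : Measure (characterSpace ℂ B)) [IsFiniteMeasure ν] [ν.Regular]
    (hν : ν (nonvanishingCharacters l)ᶜ = 0) :
    ∃ m : Measure (PontryaginDual G), IsFiniteMeasure m ∧ m.Regular ∧
      ∀ x, ∫ ξ, ((ξ x : Circle) : ℂ) ∂m = ∫ χ, (χ (t x : B) : ℂ) ∂ν := by
  have hop := isOpen_nonvanishingCharacters l
  let ν' : Measure (nonvanishingCharacters l) := ν.comap Subtype.val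
  have : IsFiniteMeasure ν' := inferInstance
  have : ν'.Regular := Measure.Regular.comap' ν hop.isOpenEmbedding_subtypeVal
  have hc := continuous_dualOfCharacter ht
  have : (Measure.map (dualOfCharacter ht) ν').InnerRegularCompactLTTop :=
    Measure.InnerRegularCompactLTTop.map_of_continuous hc
  refine ⟨Measure.map (dualOfCharacter ht) ν', inferInstance, inferInstance, fun x => ?_⟩
  have hev := continuous_dual_apply x
  rw [integral_map hc.aemeasurable hev.measurable.aestronglyMeasurable]
  simp only [dualOfCharacter_apply]
  rw [integral_subtype_comap hop.measurableSet (fun χ : characterSpace ℂ B => (χ (t x : B) : ℂ)),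
    Measure.restrict_eq_self_of_ae_mem]
  rwa [ae_iff]

end CharacterOfSpectrum

/-! ### Stone's theorem -/

section Bochner

variable {G : Type*} [CommGroup G] [TopologicalSpace G] [IsTopologicalGroup G]
  [LocallyCompactSpace G] [T2Space G]
  {H : Type*} [NormedAddCommGroup H] [InnerProductSpace ℂ H] [CompleteSpace H]

/-- The bicommutant of a commutative group of unitary operators. -/
noncomputable def unitaryBicommutant (T : G →* unitary (H →L[ℂ] H)) :
    StarSubalgebra ℂ (H →L[ℂ] H) :=
  StarSubalgebra.centralizer ℂ (StarSubalgebra.centralizer ℂ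
    (Set.range fun x => (T x : H →L[ℂ] H)) : Set (H →L[ℂ] H))

theorem star_coe_map (T : G →* unitary (H →L[ℂ] H)) (x : G) :
    star (T x : H →L[ℂ] H) = T x⁻¹ := by
  rw [map_inv, ← Unitary.star_eq_inv, Unitary.coe_star]

/-- The adjoint of `T x` is `T x⁻¹`, so the family is closed under adjoints and the star-centralizer
is the plain commutant. -/
theorem mem_unitaryBicommutant_iff {T : G →* unitary (H →L[ℂ] H)} {a : H →L[ℂ] H} :
    a ∈ unitaryBicommutant T ↔
      ∀ c : H →L[ℂ] H, (∀ x, c * (T x : H →L[ℂ] H) = T x * c) → c * a = a * c := by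
  have hc : ∀ c : H →L[ℂ] H, c ∈ StarSubalgebra.centralizer ℂ
      (Set.range fun x => (T x : H →L[ℂ] H)) ↔ ∀ x, c * (T x : H →L[ℂ] H) = T x * c := by
    intro c
    rw [StarSubalgebra.mem_centralizer_iff]
    constructor
    · intro h x
      exact ((h _ ⟨x, rfl⟩).1).symm
    · rintro h _ ⟨x, rfl⟩
      refine ⟨(h x).symm, ?_⟩
      simp only [star_coe_map]
      exact (h _).symm
  rw [unitaryBicommutant, StarSubalgebra.mem_centralizer_iff]
  constructor
  · intro h c h1
    exact (h c ((hc c).2 h1)).1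
  · intro h c h1
    exact ⟨h c ((hc c).1 h1), h _ ((hc _).1 (star_mem h1))⟩

/-- As `G` is commutative, each `T x` lies in the commutant, so the bicommutant lies in the
commutant and therefore commutes with itself. -/
theorem commute_of_mem_unitaryBicommutant {T : G →* unitary (H →L[ℂ] H)} {a b : H →L[ℂ] H}
    (ha : a ∈ unitaryBicommutant T) (hb : b ∈ unitaryBicommutant T) : a * b = b * a := by
  rw [mem_unitaryBicommutant_iff] at ha hb
  refine hb a fun x => (ha _ fun y => ?_).symm
  rw [← Submonoid.coe_mul, ← Submonoid.coe_mul, ← map_mul, ← map_mul, mul_comm]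

instance isClosed_unitaryBicommutant (T : G →* unitary (H →L[ℂ] H)) :
    IsClosed (unitaryBicommutant T : Set (H →L[ℂ] H)) := by
  rw [unitaryBicommutant, StarSubalgebra.coe_centralizer]
  exact Set.isClosed_centralizer _

noncomputable instance unitaryBicommutant.commCStarAlgebra (T : G →* unitary (H →L[ℂ] H)) :
    CommCStarAlgebra (unitaryBicommutant T) :=
  { (inferInstance : CStarAlgebra (unitaryBicommutant T)) with
    mul_comm := fun a b => Subtype.ext (commute_of_mem_unitaryBicommutant a.2 b.2) }

/-- **Stone's theorem** (Naimark, Ambrose, Godement) for one vector: the matrix coefficients of a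
strongly continuous unitary representation are Fourier transforms of finite measures. -/
theorem exists_measure_integral_eq_inner [MeasurableSpace (PontryaginDual G)]
    [BorelSpace (PontryaginDual G)] (T : G →* unitary (H →L[ℂ] H))
    (hT : ∀ v, Continuous fun x => (T x : H →L[ℂ] H) v) (v : H) :
    ∃ m : Measure (PontryaginDual G), IsFiniteMeasure m ∧ m.Regular ∧
      ∀ x, ∫ ξ, ((ξ x : Circle) : ℂ) ∂m = inner ℂ v ((T x : H →L[ℂ] H) v) := by
  let : MeasurableSpace G := borel G
  have : BorelSpace G := ⟨rfl⟩
  let μ : Measure G := Measure.haar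
  -- The bicommutant is commutative, norm closed and contains every `T x`. It also contains the
  -- integrated operators, since whatever commutes with each `T x` commutes with the integrals; no
  -- norm approximation is needed.
  let B := unitaryBicommutant T
  let : MeasurableSpace (characterSpace ℂ B) := borel _
  have : BorelSpace (characterSpace ℂ B) := ⟨rfl⟩
  have hTB : ∀ x, (T x : H →L[ℂ] H) ∈ B := fun x =>
    mem_unitaryBicommutant_iff.2 fun c hc => hc x
  let t : G →* unitary B :=
    { toFun := fun x => ⟨⟨T x, hTB x⟩, by
        rw [Unitary.mem_iff]
        constructor
        · exact Subtype.ext (Unitary.coe_star_mul_self (T x))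
        · exact Subtype.ext (Unitary.coe_mul_star_self (T x))⟩
      map_one' := by ext; simp
      map_mul' := fun x y => by ext; simp }
  let l : C_c(G, ℂ) → B := fun k => ⟨integratedOp μ T hT k,
    mem_unitaryBicommutant_iff.2 fun c hc => commute_integratedOp k c hc⟩
  have ht : ∀ k, Continuous fun x => (t x : B) * l k := fun k =>
    Continuous.subtype_mk (continuous_mul_integratedOp (hT := hT) k) _
  obtain ⟨ν, hfin, hreg, hν⟩ := exists_spectral_measure B.subtype v
  obtain ⟨m, hm1, hm2, hm⟩ := exists_dual_measure_of_spectral ht ν (by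
    refine le_antisymm (ENNReal.le_of_forall_pos_le_add fun ε hε _ => ?_) zero_le
    rw [zero_add]
    -- On `Z` every `χ (l k)` is zero, so `‖χ (l k - 1)‖ = 1` there. Hence the mass of `Z` is at
    -- most the integral of `‖χ (l k - 1)‖ ^ 2`, which is the squared distance from `v` to its
    -- smoothing. The square root of `ε` makes this at most `ε`.
    obtain ⟨k, hk⟩ := exists_norm_integratedOp_sub_lt (μ := μ) (hT := hT) v
      (Real.sqrt_pos.2 (NNReal.coe_pos.2 hε))
    set Z := (nonvanishingCharacters l)ᶜ
    have hZ : MeasurableSet Z := (isOpen_nonvanishingCharacters l).measurableSet.compl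
    let b : B := star (l k - 1) * (l k - 1)
    have hb : ∀ χ : characterSpace ℂ B, (χ b : ℂ) = ((‖χ (l k - 1)‖ ^ 2 : ℝ) : ℂ) := by
      intro χ
      rw [map_mul, map_star, RCLike.star_def, Complex.conj_mul']
      simp
    have hbi : ∫ χ, ‖χ (l k - 1)‖ ^ 2 ∂ν = ‖integratedOp μ T hT k v - v‖ ^ 2 := by
      have h1 := hν b
      simp only [hb] at h1
      rw [integral_complex_ofReal] at h1
      have h2 : (inner ℂ v ((B.subtype b) v) : ℂ) =
          ((‖integratedOp μ T hT k v - v‖ ^ 2 : ℝ) : ℂ) := by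
        change inner ℂ v ((star (integratedOp μ T hT k - 1) *
          (integratedOp μ T hT k - 1)) v) = _
        rw [ContinuousLinearMap.star_eq_adjoint, mul_apply_eq_comp,
          ContinuousLinearMap.adjoint_inner_right, inner_self_eq_norm_sq_to_K]
        simp
      rw [h2] at h1
      exact_mod_cast h1
    have hci : Continuous fun χ : characterSpace ℂ B => ‖χ (l k - 1)‖ ^ 2 :=
      (continuous_characterSpace_apply _).norm.pow 2
    have hi : Integrable (fun χ : characterSpace ℂ B => ‖χ (l k - 1)‖ ^ 2) ν :=
      hci.integrable_of_hasCompactSupport (HasCompactSupport.of_compactSpace _)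
    have hZ1 : ν.real Z ≤ ∫ χ, ‖χ (l k - 1)‖ ^ 2 ∂ν := by
      rw [← integral_indicator_one hZ]
      refine integral_mono ((integrable_const 1).indicator hZ) hi fun χ => ?_
      by_cases hχ : χ ∈ Z
      · have : χ (l k) = 0 := by
          by_contra h
          exact hχ ⟨k, h⟩
        simp [hχ, map_sub, this]
      · simp only [Set.indicator_of_notMem hχ]
        positivity
    rw [hbi] at hZ1
    have hle : ν.real Z ≤ ε := by
      refine hZ1.trans ?_
      rw [← Real.sq_sqrt (show (0 : ℝ) ≤ ε from ε.2)]
      gcongr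
    rw [← ENNReal.ofReal_coe_nnreal]
    exact (ENNReal.le_ofReal_iff_toReal_le (measure_ne_top _ _) ε.2).2 hle)
  refine ⟨m, hm1, hm2, fun x => ?_⟩
  rw [hm, hν]
  rfl

end Bochner

/-! ### Density of compactly supported functions -/

section Density

/-- Continuous compactly supported functions are dense in `L^p` of a regular measure on a locally
compact space (not assumed to be normal). -/
theorem MeasureTheory.MemLp.exists_compactlySupported_eLpNorm_sub_le {X : Type*}
    [TopologicalSpace X] [R1Space X] [LocallyCompactSpace X] [MeasurableSpace X] [BorelSpace X]
    {μ : Measure X} [μ.Regular] {p : ℝ≥0∞} (hp : p ≠ ∞) {f : X → ℂ} (hf : MemLp f p μ)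
    {ε : ℝ≥0∞} (hε : ε ≠ 0) : ∃ g : C_c(X, ℂ), eLpNorm (f - (g : X → ℂ)) p μ ≤ ε := by
  suffices H : ∃ g : X → ℂ, eLpNorm (f - g) p μ ≤ ε ∧ Continuous g ∧ HasCompactSupport g by
    obtain ⟨g, h1, h2, h3⟩ := H
    exact ⟨⟨⟨g, h2⟩, h3⟩, h1⟩
  apply hf.induction_dense hp _ _ _ _ hε
  rotate_left
  · rintro f g ⟨f_cont, hf⟩ ⟨g_cont, hg⟩
    exact ⟨f_cont.add g_cont, hf.add hg⟩
  · rintro f ⟨f_cont, _⟩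
    exact f_cont.measurable.aestronglyMeasurable
  intro c t ht htμ ε hε
  obtain ⟨δ, δpos, hδ⟩ := exists_Lp_half ℂ μ p hε
  obtain ⟨η, ηpos, hη⟩ := exists_eLpNorm_indicator_le (μ := μ) hp c δpos.ne'
  have hη' : (0 : ℝ≥0∞) < η := ENNReal.coe_pos.2 ηpos
  -- Two half-errors: `t` is replaced by a compact subset `s`, then the indicator of `s` by a
  -- Urysohn function supported in an open `V` barely larger than `s`. Separating a compact set from
  -- a closed one needs no normality.
  obtain ⟨s, st, s_compact, s_closed, μs⟩ :=
    ht.exists_isCompact_isClosed_sdiff_lt htμ.ne hη'.ne'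
  have hsμ : μ s < ∞ := (measure_mono st).trans_lt htμ
  have I1 : eLpNorm ((s.indicator fun _ => c) - t.indicator fun _ => c) p μ ≤ δ := by
    rw [← eLpNorm_neg, neg_sub, ← Set.indicator_sdiff st]
    exact hη _ μs.le
  obtain ⟨V, sV, V_open, -, hV⟩ := s_closed.measurableSet.exists_isOpen_sdiff_lt hsμ.ne hη'.ne'
  obtain ⟨g, hgs, hgc, hgV, hg01⟩ :=
    exists_continuousMap_one_of_isCompact_subset_isOpen s_compact V_open sV
  have hcont : Continuous fun x => (g x : ℂ) * c := by fun_prop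
  have I2 : eLpNorm ((fun x => (g x : ℂ) * c) - s.indicator fun _ => c) p μ ≤ δ := by
    refine (eLpNorm_mono (g := (V \ s).indicator fun _ => c) fun x => ?_).trans (hη _ hV.le)
    by_cases hs : x ∈ s
    · simp [hs, show g x = 1 from hgs hs]
    · by_cases hx : x ∈ V
      · have : ‖(g x : ℂ) * c‖ ≤ ‖c‖ := by
          rw [norm_mul, Complex.norm_real, Real.norm_of_nonneg (hg01 x).1]
          exact mul_le_of_le_one_left (norm_nonneg _) (hg01 x).2
        simpa [hs, hx] using this
      · have : g x = 0 := image_eq_zero_of_notMem_tsupport fun h => hx (hgV h)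
        simp [hs, hx, this]
  refine ⟨fun x => (g x : ℂ) * c, ?_, hcont, ?_⟩
  · have h := hδ _ _ (hcont.measurable.aestronglyMeasurable.sub
      (aestronglyMeasurable_const.indicator s_closed.measurableSet))
      ((aestronglyMeasurable_const.indicator s_closed.measurableSet).sub
      (aestronglyMeasurable_const.indicator ht)) I2 I1
    rw [sub_add_sub_cancel] at h
    exact h.le
  · exact HasCompactSupport.comp_left (g := fun t : ℝ => (t : ℂ) * c) hgc (by simp)

end Density

/-! ### Fubini for bounded continuous kernels -/

section KernelTransform

variable {X Y : Type*} [TopologicalSpace X] [TopologicalSpace Y] [R1Space X] [R1Space Y]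
  [LocallyCompactSpace X] [LocallyCompactSpace Y] [MeasurableSpace X] [MeasurableSpace Y]
  [BorelSpace X] [BorelSpace Y] {μ : Measure X} {m : Measure Y} [μ.Regular] [m.Regular]
  {k : X → Y → ℂ}

theorem integrable_mul_of_norm_le_one {Z : Type*} [TopologicalSpace Z] [MeasurableSpace Z]
    [BorelSpace Z] {ν : Measure Z} {b f : Z → ℂ} (hb : Integrable b ν) (hf : Continuous f)
    (hf1 : ∀ z, ‖f z‖ ≤ 1) : Integrable (fun z => b z * f z) ν :=
  hb.mul_bdd (c := 1) hf.measurable.aestronglyMeasurable (Eventually.of_forall hf1)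

theorem norm_integral_mul_le_of_norm_le_one {Z : Type*} [MeasurableSpace Z]
    {ν : Measure Z} {b f : Z → ℂ} (hb : Integrable b ν)
    (hf1 : ∀ z, ‖f z‖ ≤ 1) : ‖∫ z, b z * f z ∂ν‖ ≤ ∫ z, ‖b z‖ ∂ν := by
  refine norm_integral_le_of_norm_le hb.norm (Eventually.of_forall fun z => ?_)
  rw [norm_mul]
  exact mul_le_of_le_one_right (norm_nonneg _) (hf1 z)

theorem exists_seq_hasCompactSupport_tendsto_integral {b : Y → ℂ} (hb : Integrable b m) :
    ∃ c : ℕ → C_c(Y, ℂ), Tendsto (fun n => ∫ y, ‖b y - c n y‖ ∂m) atTop (𝓝 0) := by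
  have h : ∀ n : ℕ, ∃ c : C_c(Y, ℂ), ∫ y, ‖b y - c y‖ ∂m ≤ 1 / ((n : ℝ) + 1) := by
    intro n
    obtain ⟨g, h2⟩ := MemLp.exists_compactlySupported_eLpNorm_sub_le
      ENNReal.one_ne_top (memLp_one_iff_integrable.2 hb) (ε := ENNReal.ofReal (1 / ((n : ℝ) + 1)))
      (by simp only [ne_eq, ENNReal.ofReal_eq_zero, not_le]; positivity)
    refine ⟨g, ?_⟩
    rw [eLpNorm_one_eq_lintegral_enorm] at h2
    have hi : Integrable (fun y => b y - g y) m := hb.sub (CompactlySupportedContinuousMap.integrable g)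
    rw [integral_norm_eq_lintegral_enorm hi.aestronglyMeasurable]
    exact ENNReal.toReal_le_of_le_ofReal (by positivity) h2
  choose c hc using h
  exact ⟨c, squeeze_zero (fun _ => integral_nonneg fun _ => norm_nonneg _) hc
    tendsto_one_div_add_atTop_nhds_zero_nat⟩

/-- For compactly supported `b` the integral is over a compact set. In general `b` is an `L¹` limit
of such functions, and the bound on `k` makes the convergence uniform in `x`. -/
theorem continuous_integral_mul_kernel (hk : Continuous (Function.uncurry k))
    (hk1 : ∀ x y, ‖k x y‖ ≤ 1) {b : Y → ℂ} (hb : Integrable b m) :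
    Continuous fun x => ∫ y, b y * k x y ∂m := by
  have hky : ∀ x, Continuous (k x) := fun x => hk.comp (Continuous.prodMk_right x)
  obtain ⟨c, hc⟩ := exists_seq_hasCompactSupport_tendsto_integral hb
  have hcont : ∀ n, Continuous fun x => ∫ y, c n y * k x y ∂m := by
    intro n
    rw [← continuousOn_univ]
    refine continuousOn_integral_of_compact_support (c n).hasCompactSupport ?_ ?_
    · refine Continuous.continuousOn ?_
      exact ((c n).continuous.comp continuous_snd).mul hk
    · intro x y _ hy
      rw [image_eq_zero_of_notMem_tsupport hy, zero_mul]
  refine TendstoUniformly.continuous (F := fun n x => ∫ y, c n y * k x y ∂m) (p := atTop) ?_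
    (Eventually.of_forall hcont).frequently
  rw [Metric.tendstoUniformly_iff]
  intro ε hε
  filter_upwards [hc.eventually_lt_const hε] with n hn x
  refine lt_of_le_of_lt ?_ hn
  rw [dist_eq_norm, ← integral_sub (integrable_mul_of_norm_le_one hb (hky x) (hk1 x))
    (integrable_mul_of_norm_le_one (CompactlySupportedContinuousMap.integrable (c n)) (hky x) (hk1 x))]
  simp only [← sub_mul]
  exact norm_integral_mul_le_of_norm_le_one (hb.sub (CompactlySupportedContinuousMap.integrable _)) (hk1 x)

theorem integrable_mul_integral_kernel (hk : Continuous (Function.uncurry k))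
    (hk1 : ∀ x y, ‖k x y‖ ≤ 1) {c : X → ℂ} {e : Y → ℂ} (hc : Integrable c μ)
    (he : Integrable e m) : Integrable (fun x => c x * ∫ y, e y * k x y ∂m) μ :=
  hc.mul_bdd (c := ∫ y, ‖e y‖ ∂m)
    (continuous_integral_mul_kernel hk hk1 he).measurable.aestronglyMeasurable
    (Eventually.of_forall fun x => norm_integral_mul_le_of_norm_le_one he (hk1 x))

theorem tendsto_integral_mul_integral_kernel_right (hk : Continuous (Function.uncurry k))
    (hk1 : ∀ x y, ‖k x y‖ ≤ 1) {c : X → ℂ} {b : Y → ℂ} (hc : Integrable c μ)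
    (hb : Integrable b m) (d : ℕ → C_c(Y, ℂ))
    (hd : Tendsto (fun n => ∫ y, ‖b y - d n y‖ ∂m) atTop (𝓝 0)) :
    Tendsto (fun n => ∫ x, c x * ∫ y, d n y * k x y ∂m ∂μ) atTop
      (𝓝 (∫ x, c x * ∫ y, b y * k x y ∂m ∂μ)) := by
  have hky : ∀ x, Continuous (k x) := fun x => hk.comp (Continuous.prodMk_right x)
  rw [tendsto_iff_norm_sub_tendsto_zero]
  refine squeeze_zero (fun _ => norm_nonneg _) (fun n => ?_)
    (g := fun n => (∫ x, ‖c x‖ ∂μ) * ∫ y, ‖b y - d n y‖ ∂m) (by simpa using hd.const_mul _)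
  rw [← integral_sub (integrable_mul_integral_kernel hk hk1 hc (CompactlySupportedContinuousMap.integrable _))
    (integrable_mul_integral_kernel hk hk1 hc hb), ← integral_mul_const]
  refine norm_integral_le_of_norm_le (hc.norm.mul_const _) (Eventually.of_forall fun x => ?_)
  rw [← mul_sub, norm_mul, norm_sub_rev,
    ← integral_sub (integrable_mul_of_norm_le_one hb (hky x) (hk1 x))
    (integrable_mul_of_norm_le_one (CompactlySupportedContinuousMap.integrable (d n)) (hky x) (hk1 x))]
  simp only [← sub_mul]
  gcongr
  exact norm_integral_mul_le_of_norm_le_one (hb.sub (CompactlySupportedContinuousMap.integrable _)) (hk1 x)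

theorem tendsto_integral_mul_integral_kernel_left (hk : Continuous (Function.uncurry k))
    (hk1 : ∀ x y, ‖k x y‖ ≤ 1) {a : X → ℂ} {e : Y → ℂ} (ha : Integrable a μ)
    (he : Integrable e m) (c : ℕ → C_c(X, ℂ))
    (hc : Tendsto (fun n => ∫ x, ‖a x - c n x‖ ∂μ) atTop (𝓝 0)) :
    Tendsto (fun n => ∫ x, c n x * ∫ y, e y * k x y ∂m ∂μ) atTop
      (𝓝 (∫ x, a x * ∫ y, e y * k x y ∂m ∂μ)) := by
  rw [tendsto_iff_norm_sub_tendsto_zero]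
  refine squeeze_zero (fun _ => norm_nonneg _) (fun n => ?_)
    (g := fun n => (∫ x, ‖a x - c n x‖ ∂μ) * ∫ y, ‖e y‖ ∂m) (by simpa using hc.mul_const _)
  rw [← integral_sub (integrable_mul_integral_kernel hk hk1 (CompactlySupportedContinuousMap.integrable _) he)
    (integrable_mul_integral_kernel hk hk1 ha he), ← integral_mul_const]
  refine norm_integral_le_of_norm_le ((ha.sub (CompactlySupportedContinuousMap.integrable (c n))).norm.mul_const _)
    (Eventually.of_forall fun x => ?_)
  rw [← sub_mul, norm_mul, norm_sub_rev]
  exact mul_le_mul_of_nonneg_left (norm_integral_mul_le_of_norm_le_one he (hk1 x))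
    (norm_nonneg _)

/-- Fubini's theorem for a bounded continuous kernel and regular measures that need not be
`σ`-finite, on spaces that need not be second countable. -/
theorem integral_mul_integral_kernel (hk : Continuous (Function.uncurry k))
    (hk1 : ∀ x y, ‖k x y‖ ≤ 1) {a : X → ℂ} {b : Y → ℂ} (ha : Integrable a μ)
    (hb : Integrable b m) :
    ∫ x, a x * ∫ y, b y * k x y ∂m ∂μ = ∫ y, b y * ∫ x, a x * k x y ∂μ ∂m := by
  have hk' : Continuous (Function.uncurry fun y x => k x y) := hk.comp continuous_swap
  -- For compactly supported weights the swap needs no σ-finiteness. The weights are then replaced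
  -- by their `L¹` limits one variable at a time.
  have hswap : ∀ (c : C_c(X, ℂ)) (d : C_c(Y, ℂ)),
      ∫ x, c x * ∫ y, d y * k x y ∂m ∂μ = ∫ y, d y * ∫ x, c x * k x y ∂μ ∂m := by
    intro c d
    have h := integral_integral_swap_of_hasCompactSupport (μ := μ) (ν := m)
      (f := fun x y => c x * (d y * k x y)) ?_ ?_
    · simp only [integral_const_mul] at h
      rw [h]
      congr 1
      ext y
      rw [← integral_const_mul]
      congr 1
      ext x
      ring
    · exact (c.continuous.comp continuous_fst).mul
        ((d.continuous.comp continuous_snd).mul hk)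
    · have hcpt : IsCompact (closure (tsupport c ×ˢ tsupport d)) :=
        (c.hasCompactSupport.isCompact.prod d.hasCompactSupport.isCompact).closure
      refine hcpt.of_isClosed_subset isClosed_closure (closure_mono ?_)
      rintro ⟨x, y⟩ hxy
      rw [Function.mem_support] at hxy
      by_contra h
      rw [Set.mem_prod, not_and_or] at h
      rcases h with h | h
      · exact hxy (by simp [image_eq_zero_of_notMem_tsupport h])
      · exact hxy (by simp [image_eq_zero_of_notMem_tsupport h])
  obtain ⟨c, hc⟩ := exists_seq_hasCompactSupport_tendsto_integral ha
  obtain ⟨d, hd⟩ := exists_seq_hasCompactSupport_tendsto_integral hb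
  have h1 : ∀ d : C_c(Y, ℂ),
      ∫ x, a x * ∫ y, d y * k x y ∂m ∂μ = ∫ y, d y * ∫ x, a x * k x y ∂μ ∂m := fun d =>
    tendsto_nhds_unique
      (tendsto_integral_mul_integral_kernel_left hk hk1 ha (CompactlySupportedContinuousMap.integrable d) c hc)
      ((tendsto_integral_mul_integral_kernel_right hk' (fun y x => hk1 x y)
        (CompactlySupportedContinuousMap.integrable d) ha c hc).congr fun n => (hswap (c n) d).symm)
  exact tendsto_nhds_unique
    (tendsto_integral_mul_integral_kernel_right hk hk1 ha hb d hd)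
    ((tendsto_integral_mul_integral_kernel_left hk' (fun y x => hk1 x y) hb ha d hd).congr
      fun n => (h1 (d n)).symm)

end KernelTransform

/-! ### Uniqueness of Fourier transforms of measures on the dual -/

section TightFunctional

variable {G : Type*} [CommGroup G] [TopologicalSpace G] [IsTopologicalGroup G]
  [LocallyCompactSpace G]

/-- Evaluation at a point, as a bounded continuous function on the dual. -/
noncomputable def dualEval (x : G) : PontryaginDual G →ᵇ ℂ :=
  BoundedContinuousFunction.ofNormedAddCommGroup (fun ξ => ((ξ x : Circle) : ℂ))
    (continuous_dual_apply x) 1 (fun _ => (Circle.norm_coe _).le)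

theorem dualEval_apply (x : G) (ξ : PontryaginDual G) : dualEval x ξ = ((ξ x : Circle) : ℂ) := rfl

/-- The evaluation map of the dual into a product of circles. -/
noncomputable def dualToProd (G : Type*) [CommGroup G] [TopologicalSpace G] [IsTopologicalGroup G]
    [LocallyCompactSpace G] : C(PontryaginDual G, G → Circle) :=
  ⟨fun ξ x => ξ x, continuous_pi fun x => by
    have := continuous_dual_apply x
    exact Continuous.subtype_mk this _⟩

theorem dualToProd_injective : Function.Injective (dualToProd G) := fun _ _ h =>
  PontryaginDual.ext fun x => congr_fun h x

/-- Restriction of functions on the product of circles to the dual. -/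
noncomputable def pullbackProd (H : C(G → Circle, ℂ)) : PontryaginDual G →ᵇ ℂ :=
  (BoundedContinuousFunction.mkOfCompact H).compContinuous (dualToProd G)

/-- Stone–Weierstrass on the compact space `G → Circle`: a monomial in the coordinates and their
conjugates restricts on the dual to evaluation at a single group element, where `L` vanishes. -/
theorem functional_pullbackProd_eq_zero (L : (PontryaginDual G →ᵇ ℂ) →L[ℂ] ℂ)
    (hL : ∀ x, L (dualEval x) = 0) (H : C(G → Circle, ℂ)) : L (pullbackProd H) = 0 := by
  let P : C(G → Circle, ℂ) →L[ℂ] ℂ := L ∘L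
    (LinearMap.mkContinuous
      { toFun := pullbackProd
        map_add' := fun _ _ => rfl
        map_smul' := fun _ _ => rfl } 1 (fun H => by
          rw [one_mul]
          refine (BoundedContinuousFunction.norm_le (norm_nonneg _)).2 fun ξ => ?_
          exact H.norm_coe_le_norm _) : C(G → Circle, ℂ) →L[ℂ] (PontryaginDual G →ᵇ ℂ))
  have hP : ∀ H, P H = L (pullbackProd H) := fun _ => rfl
  let e : G → C(G → Circle, ℂ) := fun x => ⟨fun z => ((z x : Circle) : ℂ), by fun_prop⟩
  let A := StarAlgebra.adjoin ℂ (Set.range e)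
  have hsep : A.toSubalgebra.SeparatesPoints := by
    intro z w hzw
    obtain ⟨x, hx⟩ := Function.ne_iff.1 hzw
    exact ⟨e x, ⟨e x, StarAlgebra.subset_adjoin ℂ _ ⟨x, rfl⟩, rfl⟩, fun h => hx (Subtype.ext h)⟩
  have htop := ContinuousMap.starSubalgebra_topologicalClosure_eq_top_of_separatesPoints A hsep
  have hmon : ∀ h ∈ Submonoid.closure (Set.range e ∪ star (Set.range e)),
      ∃ x, pullbackProd h = dualEval x := by
    intro h hh
    induction hh using Submonoid.closure_induction with
    | mem h hh =>
      rcases hh with ⟨x, rfl⟩ | ⟨x, hx⟩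
      · exact ⟨x, rfl⟩
      · refine ⟨x⁻¹, ?_⟩
        have : h = star (e x) := by rw [hx, star_star]
        subst this
        ext ξ
        change (starRingEnd ℂ) ((ξ x : Circle) : ℂ) = ((ξ x⁻¹ : Circle) : ℂ)
        rw [map_inv, Circle.coe_inv_eq_conj]
    | one => exact ⟨1, by ext ξ; rw [dualEval_apply, map_one]; rfl⟩
    | mul a b _ _ iha ihb =>
      obtain ⟨x, hx⟩ := iha
      obtain ⟨y, hy⟩ := ihb
      refine ⟨x * y, ?_⟩
      ext ξ
      have h1 : pullbackProd (a * b) ξ = pullbackProd a ξ * pullbackProd b ξ := rfl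
      rw [h1, hx, hy, dualEval_apply, dualEval_apply, dualEval_apply, map_mul, Circle.coe_mul]
  have hA : ∀ h ∈ A, P h = 0 := by
    intro h hh
    have h2 : h ∈ Submodule.span ℂ
        (Submonoid.closure (Set.range e ∪ star (Set.range e)) : Set C(G → Circle, ℂ)) := by
      rw [← StarAlgebra.adjoin_eq_span]
      exact hh
    have h3 : Submodule.span ℂ (Submonoid.closure (Set.range e ∪ star (Set.range e)) :
        Set C(G → Circle, ℂ)) ≤ LinearMap.ker (P : C(G → Circle, ℂ) →ₗ[ℂ] ℂ) := by
      refine Submodule.span_le.2 fun b hb => ?_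
      obtain ⟨x, hx⟩ := hmon b hb
      exact (congrArg L hx).trans (hL x)
    exact h3 h2
  have hcl : H ∈ A.topologicalClosure := by rw [htop]; trivial
  have hker : IsClosed {h | P h = 0} := isClosed_eq P.continuous continuous_const
  exact closure_minimal hA hker hcl

/-- A tight functional that vanishes on all evaluations is zero. -/
theorem tight_functional_eq_zero (L : (PontryaginDual G →ᵇ ℂ) →L[ℂ] ℂ)
    (hL : ∀ x, L (dualEval x) = 0)
    (htight : ∀ ε > 0, ∃ K : Set (PontryaginDual G), IsCompact K ∧
      ∀ g : PontryaginDual G →ᵇ ℂ, (∀ ξ ∈ K, g ξ = 0) → ‖L g‖ ≤ ε * ‖g‖) : L = 0 := by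
  ext g
  rw [zero_apply, ← norm_le_zero_iff]
  refine le_of_forall_pos_le_add fun ε hε => ?_
  rw [zero_add]
  -- On `K`, which embeds as a closed subset of the product of circles, `g` is matched by a pulled
  -- back function, obtained by Tietze extension of real and imaginary parts. That function has norm
  -- at most `2 * ‖g‖`, so the difference has norm at most `3 * ‖g‖`; the `+ 1` avoids dividing by
  -- zero.
  obtain ⟨K, hK, hKL⟩ := htight (ε / (3 * ‖g‖ + 1)) (by positivity)
  have : CompactSpace K := isCompact_iff_compactSpace.1 hK
  let i : K → (G → Circle) := fun ξ => dualToProd G ξ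
  have hi : IsClosedEmbedding i :=
    ((dualToProd G).continuous.comp continuous_subtype_val).isClosedEmbedding
      (dualToProd_injective.comp Subtype.val_injective)
  let g1 : K →ᵇ ℝ := BoundedContinuousFunction.ofNormedAddCommGroup (fun ξ => (g ξ).re)
    (by fun_prop) ‖g‖ (fun ξ => (Complex.abs_re_le_norm _).trans (g.norm_coe_le_norm _))
  let g2 : K →ᵇ ℝ := BoundedContinuousFunction.ofNormedAddCommGroup (fun ξ => (g ξ).im)
    (by fun_prop) ‖g‖ (fun ξ => (Complex.abs_im_le_norm _).trans (g.norm_coe_le_norm _))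
  have hg1 : ‖g1‖ ≤ ‖g‖ := BoundedContinuousFunction.norm_ofNormedAddCommGroup_le _
    (norm_nonneg _) _
  have hg2 : ‖g2‖ ≤ ‖g‖ := BoundedContinuousFunction.norm_ofNormedAddCommGroup_le _
    (norm_nonneg _) _
  obtain ⟨H1, hn1, he1⟩ :=
    BoundedContinuousFunction.exists_extension_norm_eq_of_isClosedEmbedding g1 hi
  obtain ⟨H2, hn2, he2⟩ :=
    BoundedContinuousFunction.exists_extension_norm_eq_of_isClosedEmbedding g2 hi
  let H : C(G → Circle, ℂ) := ⟨fun z => (H1 z : ℂ) + (H2 z : ℂ) * Complex.I, by fun_prop⟩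
  have hH : ∀ ξ ∈ K, pullbackProd H ξ = g ξ := by
    intro ξ hξ
    have h1 : H1 (dualToProd G ξ) = (g ξ).re := congr_fun he1 ⟨ξ, hξ⟩
    have h2 : H2 (dualToProd G ξ) = (g ξ).im := congr_fun he2 ⟨ξ, hξ⟩
    change (H1 (dualToProd G ξ) : ℂ) + (H2 (dualToProd G ξ) : ℂ) * Complex.I = g ξ
    rw [h1, h2, Complex.re_add_im]
  have hnorm : ‖pullbackProd H‖ ≤ 2 * ‖g‖ := by
    refine (BoundedContinuousFunction.norm_le (by positivity)).2 fun ξ => ?_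
    change ‖(H1 (dualToProd G ξ) : ℂ) + (H2 (dualToProd G ξ) : ℂ) * Complex.I‖ ≤ _
    refine (norm_add_le _ _).trans ?_
    rw [norm_mul, Complex.norm_I, mul_one, Complex.norm_real, Complex.norm_real]
    have h1 := H1.norm_coe_le_norm (dualToProd G ξ)
    have h2 := H2.norm_coe_le_norm (dualToProd G ξ)
    linarith
  have h := hKL (g - pullbackProd H) (fun ξ hξ => by simp [hH ξ hξ])
  rw [map_sub, functional_pullbackProd_eq_zero L hL, sub_zero] at h
  refine h.trans ?_
  have h3 : ‖g - pullbackProd H‖ ≤ 3 * ‖g‖ := (norm_sub_le _ _).trans (by linarith)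
  rw [div_mul_eq_mul_div, div_le_iff₀ (by positivity)]
  nlinarith

variable [MeasurableSpace (PontryaginDual G)] [BorelSpace (PontryaginDual G)]

/-- An integrable weight is within `ε` in `L¹` of a compactly supported one, so integration against
it is tight, and `tight_functional_eq_zero` applies to the difference. -/
theorem integral_boundedContinuous_mul_eq_of_dualEval {m₁ m₂ : Measure (PontryaginDual G)}
    [m₁.Regular] [m₂.Regular] {w₁ w₂ : PontryaginDual G → ℂ} (hw₁ : Integrable w₁ m₁)
    (hw₂ : Integrable w₂ m₂)
    (h : ∀ x : G, ∫ ξ, w₁ ξ * ((ξ x : Circle) : ℂ) ∂m₁ = ∫ ξ, w₂ ξ * ((ξ x : Circle) : ℂ) ∂m₂)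
    (g : PontryaginDual G →ᵇ ℂ) : ∫ ξ, w₁ ξ * g ξ ∂m₁ = ∫ ξ, w₂ ξ * g ξ ∂m₂ := by
  have hint : ∀ {m : Measure (PontryaginDual G)} {w : PontryaginDual G → ℂ}
      (_ : Integrable w m) (g : PontryaginDual G →ᵇ ℂ), Integrable (fun ξ => w ξ * g ξ) m :=
    fun {m w} hw g => hw.mul_bdd (c := ‖g‖) g.continuous.measurable.aestronglyMeasurable
      (Eventually.of_forall g.norm_coe_le_norm)
  have hbd : ∀ {m : Measure (PontryaginDual G)} {w : PontryaginDual G → ℂ}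
      (_ : Integrable w m) (g : PontryaginDual G →ᵇ ℂ),
      ‖∫ ξ, w ξ * g ξ ∂m‖ ≤ (∫ ξ, ‖w ξ‖ ∂m) * ‖g‖ := fun {m w} hw g => by
    rw [← integral_mul_const]
    refine norm_integral_le_of_norm_le (hw.norm.mul_const _) (Eventually.of_forall fun ξ => ?_)
    rw [norm_mul]
    exact mul_le_mul_of_nonneg_left (g.norm_coe_le_norm _) (norm_nonneg _)
  have htight : ∀ {m : Measure (PontryaginDual G)} [m.Regular] {w : PontryaginDual G → ℂ}
      (_ : Integrable w m), ∀ ε > 0, ∃ K : Set (PontryaginDual G), IsCompact K ∧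
      ∀ g : PontryaginDual G →ᵇ ℂ, (∀ ξ ∈ K, g ξ = 0) → ‖∫ ξ, w ξ * g ξ ∂m‖ ≤ ε * ‖g‖ := by
    intro m _ w hw ε hε
    obtain ⟨c, hc⟩ := exists_seq_hasCompactSupport_tendsto_integral hw
    obtain ⟨n, hn⟩ := (hc.eventually_lt_const hε).exists
    refine ⟨tsupport (c n), (c n).hasCompactSupport, fun g hg => ?_⟩
    have h1 : ∀ ξ, w ξ * g ξ = (w ξ - c n ξ) * g ξ := by
      intro ξ
      by_cases hξ : ξ ∈ tsupport (c n)
      · simp [hg ξ hξ]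
      · simp [image_eq_zero_of_notMem_tsupport hξ]
    simp only [h1]
    refine (hbd (w := fun ξ => w ξ - c n ξ) (hw.sub (c n).integrable) g).trans ?_
    gcongr
  let L : ∀ {m : Measure (PontryaginDual G)} {w : PontryaginDual G → ℂ} (_ : Integrable w m),
      (PontryaginDual G →ᵇ ℂ) →L[ℂ] ℂ := fun {m w} hw => LinearMap.mkContinuous
    { toFun := fun g => ∫ ξ, w ξ * g ξ ∂m
      map_add' := fun f g => by
        simp only [BoundedContinuousFunction.add_apply, mul_add]
        exact integral_add (hint hw f) (hint hw g)
      map_smul' := fun c f => by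
        simp only [BoundedContinuousFunction.smul_apply, smul_eq_mul, RingHom.id_apply,
          mul_left_comm _ c, integral_const_mul] }
    (∫ ξ, ‖w ξ‖ ∂m) (hbd hw)
  have hL := tight_functional_eq_zero (L hw₁ - L hw₂) (fun x => sub_eq_zero.2 (h x)) (by
    intro ε hε
    obtain ⟨K₁, hK₁, h₁⟩ := htight hw₁ (ε / 2) (by positivity)
    obtain ⟨K₂, hK₂, h₂⟩ := htight hw₂ (ε / 2) (by positivity)
    refine ⟨K₁ ∪ K₂, hK₁.union hK₂, fun g hg => ?_⟩
    refine (norm_sub_le _ _).trans ?_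
    have e₁ := h₁ g fun ξ hξ => hg ξ (Or.inl hξ)
    have e₂ := h₂ g fun ξ hξ => hg ξ (Or.inr hξ)
    change ‖∫ ξ, w₁ ξ * g ξ ∂m₁‖ + ‖∫ ξ, w₂ ξ * g ξ ∂m₂‖ ≤ _
    linarith)
  exact sub_eq_zero.1 (DFunLike.congr_fun hL g)

end TightFunctional

/-! ### Autocorrelations and their spectral measures -/

section Autocorrelation

variable {G : Type*} [CommGroup G] [TopologicalSpace G] [IsTopologicalGroup G]
  [LocallyCompactSpace G] [T2Space G] [MeasurableSpace G] [BorelSpace G]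
  (μ : Measure G) [μ.IsHaarMeasure] [μ.Regular]

/-- The Fourier integral `∫ u(x) conj ξ(x) dx` with respect to a given measure. -/
noncomputable def fourierInt (u : G → ℂ) (ξ : PontryaginDual G) : ℂ :=
  ∫ x, u x * starRingEnd ℂ ((ξ x : Circle) : ℂ) ∂μ

/-- The function `x ↦ ∫ conj v(t) v(x t) dt`. -/
noncomputable def autocorr (v : G → ℂ) (x : G) : ℂ :=
  ∫ t, starRingEnd ℂ (v t) * v (x * t) ∂μ

/-- The regular representation `(T(x) f)(t) = f(x t)` on `L²(G)`. -/
noncomputable def regularRep : G →* unitary (Lp ℂ 2 μ →L[ℂ] Lp ℂ 2 μ) :=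
  (Unitary.linearIsometryEquiv (𝕜 := ℂ) (H := Lp ℂ 2 μ)).symm.toMonoidHom.comp
    { toFun := fun x =>
        { DistribMulAction.toLinearEquiv ℂ (Lp ℂ 2 μ) (DomMulAct.mk x) with
          norm_map' := fun f => DomMulAct.norm_smul_Lp (DomMulAct.mk x) f }
      map_one' := by
        ext1 f
        exact one_smul Gᵈᵐᵃ f
      map_mul' := fun x y => by
        ext1 f
        change DomMulAct.mk (x * y) • f = DomMulAct.mk x • DomMulAct.mk y • f
        rw [smul_smul, ← DomMulAct.mk_mul, mul_comm] }

theorem regularRep_apply (x : G) (f : Lp ℂ 2 μ) :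
    (regularRep μ x : Lp ℂ 2 μ →L[ℂ] Lp ℂ 2 μ) f = DomMulAct.mk x • f := rfl

theorem continuous_regularRep (f : Lp ℂ 2 μ) :
    Continuous fun x => (regularRep μ x : Lp ℂ 2 μ →L[ℂ] Lp ℂ 2 μ) f := by
  simp only [regularRep_apply]
  have : Fact ((2 : ℝ≥0∞) ≠ ∞) := ⟨by simp⟩
  have h : Continuous fun a : Gᵈᵐᵃ => a • f := continuous_id.smul continuous_const
  exact h.comp DomMulAct.continuous_mk

theorem memLp_cc {Y : Type*} [TopologicalSpace Y] [MeasurableSpace Y] [BorelSpace Y]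
    {m : Measure Y} [IsFiniteMeasureOnCompacts m] (p : ℝ≥0∞) (u : C_c(Y, ℂ)) : MemLp u p m :=
  u.continuous.memLp_of_hasCompactSupport u.hasCompactSupport

/-- The matrix coefficients of the regular representation are Fourier transforms. -/
theorem exists_measure_autocorr [MeasurableSpace (PontryaginDual G)]
    [BorelSpace (PontryaginDual G)] (v : C_c(G, ℂ)) :
    ∃ ν : Measure (PontryaginDual G), IsFiniteMeasure ν ∧ ν.Regular ∧
      ∀ x, ∫ ξ, ((ξ x : Circle) : ℂ) ∂ν = autocorr μ v x := by
  have hv : MemLp v 2 μ := memLp_cc 2 v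
  obtain ⟨ν, h1, h2, h3⟩ := exists_measure_integral_eq_inner (regularRep μ)
    (continuous_regularRep μ) (hv.toLp v)
  refine ⟨ν, h1, h2, fun x => ?_⟩
  rw [h3, L2.inner_def, autocorr]
  refine integral_congr_ae ?_
  have e1 := hv.coeFn_toLp
  have e2 : ((regularRep μ x : Lp ℂ 2 μ →L[ℂ] Lp ℂ 2 μ) (hv.toLp v) : G → ℂ) =ᵐ[μ]
      fun t => v (x * t) := by
    rw [regularRep_apply]
    refine (DomMulAct.smul_Lp_ae_eq _ _).trans ?_
    exact (measurePreserving_mul_left μ x).quasiMeasurePreserving.ae_eq e1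
  filter_upwards [e1, e2] with t h1 h2
  rw [h1, h2, RCLike.inner_apply, mul_comm]

variable {μ}

theorem continuous_autocorr (u : C_c(G, ℂ)) : Continuous (autocorr μ u) := by
  rw [← continuousOn_univ]
  refine continuousOn_integral_of_compact_support u.hasCompactSupport ?_ ?_
  · refine Continuous.continuousOn ?_
    have := u.continuous
    change Continuous fun p : G × G => starRingEnd ℂ (u p.2) * u (p.1 * p.2)
    fun_prop
  · intro x t _ ht
    simp [image_eq_zero_of_notMem_tsupport ht]

theorem hasCompactSupport_autocorr (u : C_c(G, ℂ)) : HasCompactSupport (autocorr μ u) := by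
  refine HasCompactSupport.intro (K := tsupport u * (tsupport u)⁻¹)
    (u.hasCompactSupport.isCompact.mul u.hasCompactSupport.isCompact.inv) fun x hx => ?_
  rw [autocorr]
  refine integral_eq_zero_of_ae (Eventually.of_forall fun t => ?_)
  by_cases ht : t ∈ tsupport u
  · have : u (x * t) = 0 := image_eq_zero_of_notMem_tsupport fun h =>
      hx ⟨x * t, h, t⁻¹, Set.inv_mem_inv.2 ht, by simp⟩
    simp [this]
  · simp [image_eq_zero_of_notMem_tsupport ht]

theorem integrable_autocorr (u : C_c(G, ℂ)) : Integrable (autocorr μ u) μ :=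
  (continuous_autocorr u).integrable_of_hasCompactSupport (hasCompactSupport_autocorr u)

theorem continuous_fourierInt {u : G → ℂ} (hu : Integrable u μ) :
    Continuous (fourierInt μ u) := by
  let : MeasurableSpace (PontryaginDual G) := borel _
  have : BorelSpace (PontryaginDual G) := ⟨rfl⟩
  exact continuous_integral_mul_kernel (k := fun (ξ : PontryaginDual G) (x : G) =>
    starRingEnd ℂ ((ξ x : Circle) : ℂ)) (Complex.continuous_conj.comp continuous_dual_eval)
    (fun ξ x => by rw [RCLike.norm_conj, Circle.norm_coe]) hu

theorem norm_fourierInt_le {u : G → ℂ} (hu : Integrable u μ) (ξ : PontryaginDual G) :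
    ‖fourierInt μ u ξ‖ ≤ ∫ x, ‖u x‖ ∂μ :=
  norm_integral_mul_le_of_norm_le_one hu (fun x => by rw [RCLike.norm_conj, Circle.norm_coe])

theorem coe_dual_mul (ξ : PontryaginDual G) (x y : G) :
    ((ξ (x * y) : Circle) : ℂ) = ((ξ x : Circle) : ℂ) * ((ξ y : Circle) : ℂ) := by
  rw [map_mul, Circle.coe_mul]

theorem coe_dual_inv (ξ : PontryaginDual G) (x : G) :
    ((ξ x⁻¹ : Circle) : ℂ) = starRingEnd ℂ ((ξ x : Circle) : ℂ) := by
  rw [map_inv, Circle.coe_inv_eq_conj]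

theorem coe_mul_dual (ξ η : PontryaginDual G) (x : G) :
    (((ξ * η) x : Circle) : ℂ) = ((ξ x : Circle) : ℂ) * ((η x : Circle) : ℂ) := rfl

theorem coe_inv_dual (ξ : PontryaginDual G) (x : G) :
    ((ξ⁻¹ x : Circle) : ℂ) = starRingEnd ℂ ((ξ x : Circle) : ℂ) := by
  rw [← Circle.coe_inv_eq_conj]
  rfl

theorem coe_dual_mul_conj (ξ : PontryaginDual G) (x : G) :
    ((ξ x : Circle) : ℂ) * starRingEnd ℂ ((ξ x : Circle) : ℂ) = 1 := by
  rw [Complex.mul_conj, Circle.normSq_coe, Complex.ofReal_one]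

/-- Fubini on compact supports and the shift `x ↦ x * t`; the factors of `ξ t` cancel because
characters are unimodular. -/
theorem fourierInt_autocorr (u : C_c(G, ℂ)) (ξ : PontryaginDual G) :
    fourierInt μ (autocorr μ u) ξ = fourierInt μ u ξ * starRingEnd ℂ (fourierInt μ u ξ) := by
  have hc := continuous_coe_dual ξ
  have hu := u.continuous
  have h1 : fourierInt μ (autocorr μ u) ξ = ∫ x, ∫ t, starRingEnd ℂ (u t) * u (x * t) *
      starRingEnd ℂ ((ξ x : Circle) : ℂ) ∂μ ∂μ := by
    rw [fourierInt]
    simp only [autocorr, integral_mul_const]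
  rw [h1, integral_integral_swap_of_hasCompactSupport]
  · have h2 : ∀ t, ∫ x, starRingEnd ℂ (u t) * u (x * t) * starRingEnd ℂ ((ξ x : Circle) : ℂ) ∂μ
        = starRingEnd ℂ (u t) * ((ξ t : Circle) : ℂ) * fourierInt μ u ξ := by
      intro t
      rw [fourierInt, ← integral_mul_right_eq_self
        (fun x => u x * starRingEnd ℂ ((ξ x : Circle) : ℂ)) t, ← integral_const_mul]
      congr 1
      ext x
      rw [coe_dual_mul, map_mul (starRingEnd ℂ)]
      linear_combination (-(starRingEnd ℂ (u t) * u (x * t) *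
        starRingEnd ℂ ((ξ x : Circle) : ℂ))) * coe_dual_mul_conj ξ t
    simp only [h2]
    rw [integral_mul_const, mul_comm, fourierInt, ← integral_conj]
    simp
  · change Continuous fun p : G × G => starRingEnd ℂ (u p.2) * u (p.1 * p.2) *
      starRingEnd ℂ ((ξ p.1 : Circle) : ℂ)
    fun_prop
  · refine HasCompactSupport.intro (K := (tsupport u * (tsupport u)⁻¹) ×ˢ tsupport u)
      ((u.hasCompactSupport.isCompact.mul u.hasCompactSupport.isCompact.inv).prod
        u.hasCompactSupport.isCompact) ?_
    rintro ⟨x, t⟩ hx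
    by_cases ht : t ∈ tsupport u
    · have : u (x * t) = 0 := image_eq_zero_of_notMem_tsupport fun h =>
        hx ⟨⟨x * t, h, t⁻¹, Set.inv_mem_inv.2 ht, by simp⟩, ht⟩
      simp [this]
    · simp [image_eq_zero_of_notMem_tsupport ht]

end Autocorrelation

/-! ### Proportionality of the spectral measures -/

section SpectralIdentity

variable {G : Type*} [CommGroup G] [TopologicalSpace G] [IsTopologicalGroup G]
  [LocallyCompactSpace G] [T2Space G] [MeasurableSpace G] [BorelSpace G]
  {μ : Measure G} [μ.IsHaarMeasure] [μ.Regular]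
  [MeasurableSpace (PontryaginDual G)] [BorelSpace (PontryaginDual G)]

/-- The squared absolute value of the Fourier integral, as a complex function. -/
noncomputable def fourierSq (μ : Measure G) (u : G → ℂ) (ξ : PontryaginDual G) : ℂ :=
  fourierInt μ u ξ * starRingEnd ℂ (fourierInt μ u ξ)

theorem fourierSq_eq (μ : Measure G) (u : G → ℂ) (ξ : PontryaginDual G) :
    fourierSq μ u ξ = ((‖fourierInt μ u ξ‖ ^ 2 : ℝ) : ℂ) := by
  rw [fourierSq, Complex.mul_conj, Complex.normSq_eq_norm_sq]

theorem continuous_fourierSq (u : C_c(G, ℂ)) : Continuous (fourierSq μ u) := by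
  have h := continuous_fourierInt (μ := μ) (u := u) u.integrable
  exact h.mul (Complex.continuous_conj.comp h)

theorem norm_fourierSq_le (u : C_c(G, ℂ)) (ξ : PontryaginDual G) :
    ‖fourierSq μ u ξ‖ ≤ (∫ x, ‖u x‖ ∂μ) ^ 2 := by
  rw [fourierSq_eq, Complex.norm_real, Real.norm_of_nonneg (sq_nonneg _)]
  exact pow_le_pow_left₀ (norm_nonneg _) (norm_fourierInt_le u.integrable ξ) 2

theorem integrable_fourierSq_comp {Y : Type*} [TopologicalSpace Y] [MeasurableSpace Y]
    [BorelSpace Y] (u : C_c(G, ℂ)) {ν : Measure Y} [IsFiniteMeasure ν]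
    {f : Y → PontryaginDual G} (hf : Continuous f) :
    Integrable (fun y => fourierSq μ u (f y)) ν :=
  Integrable.of_bound ((continuous_fourierSq u).comp hf).measurable.aestronglyMeasurable _
    (Eventually.of_forall fun _ => norm_fourierSq_le u _)

/-- As a function of `η`, `fourierSq μ u (ζ * η)` is the transform of `autocorr μ u` twisted by `ζ`.
By Fubini, the transform of the weighted measure is therefore the convolution of that twisted
function with `P`. -/
theorem integral_dual_mul_fourierSq_translate (u : C_c(G, ℂ)) {ν : Measure (PontryaginDual G)}
    [IsFiniteMeasure ν] [ν.Regular] {P : G → ℂ}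
    (hν : ∀ x, ∫ ξ, ((ξ x : Circle) : ℂ) ∂ν = P x) (ζ : PontryaginDual G) (x : G) :
    ∫ η, fourierSq μ u (ζ * η) * ((η x : Circle) : ℂ) ∂ν =
      ∫ y, autocorr μ u y * starRingEnd ℂ ((ζ y : Circle) : ℂ) * P (x * y⁻¹) ∂μ := by
  have ha : Integrable (fun y => autocorr μ u y * starRingEnd ℂ ((ζ y : Circle) : ℂ)) μ :=
    integrable_mul_of_norm_le_one (integrable_autocorr u)
      (Complex.continuous_conj.comp (continuous_coe_dual ζ))
      (fun z => by rw [RCLike.norm_conj, Circle.norm_coe])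
  have hb : Integrable (fun η : PontryaginDual G => ((η x : Circle) : ℂ)) ν :=
    Integrable.of_bound (continuous_dual_apply x).measurable.aestronglyMeasurable 1
      (Eventually.of_forall fun _ => (Circle.norm_coe _).le)
  have h := integral_mul_integral_kernel (μ := μ) (m := ν)
    (k := fun y η => starRingEnd ℂ ((η y : Circle) : ℂ))
    (Complex.continuous_conj.comp (continuous_dual_eval.comp continuous_swap))
    (fun _ _ => by rw [RCLike.norm_conj, Circle.norm_coe]) ha hb
  have e1 : ∀ y, ∫ η, ((η x : Circle) : ℂ) * starRingEnd ℂ ((η y : Circle) : ℂ) ∂ν =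
      P (x * y⁻¹) := by
    intro y
    rw [← hν]
    simp only [coe_dual_mul, coe_dual_inv]
  have e2 : ∀ η : PontryaginDual G, ∫ y, autocorr μ u y * starRingEnd ℂ ((ζ y : Circle) : ℂ) *
      starRingEnd ℂ ((η y : Circle) : ℂ) ∂μ = fourierSq μ u (ζ * η) := by
    intro η
    rw [fourierSq, ← fourierInt_autocorr, fourierInt]
    simp only [coe_mul_dual, map_mul, mul_assoc]
  simp only [e1, e2] at h
  rw [h]
  simp only [mul_comm]

/-- The two spectral measures attached to `u` and `v` have proportional densities, also after a
translation. -/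
theorem integral_mul_fourierSq_translate (u v : C_c(G, ℂ)) {νu νv : Measure (PontryaginDual G)}
    [IsFiniteMeasure νu] [νu.Regular] [IsFiniteMeasure νv] [νv.Regular]
    (hu : ∀ x, ∫ ξ, ((ξ x : Circle) : ℂ) ∂νu = autocorr μ u x)
    (hv : ∀ x, ∫ ξ, ((ξ x : Circle) : ℂ) ∂νv = autocorr μ v x)
    (ζ : PontryaginDual G) (g : PontryaginDual G →ᵇ ℂ) :
    ∫ η, fourierSq μ u (ζ * η) * g η ∂νv =
      ∫ η, fourierSq μ v (ζ⁻¹ * η) * g (ζ⁻¹ * η) ∂νu := by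
  have hreg : (Measure.map (fun η => ζ⁻¹ * η) νu).Regular :=
    Measure.Regular.map (Homeomorph.mulLeft ζ⁻¹)
  have hmap : ∀ f : PontryaginDual G → ℂ, Continuous f →
      ∫ η, f η ∂(Measure.map (fun η => ζ⁻¹ * η) νu) = ∫ η, f (ζ⁻¹ * η) ∂νu := fun f hf =>
    integral_map (continuous_const_mul ζ⁻¹).aemeasurable hf.measurable.aestronglyMeasurable
  -- Both weighted measures have as transform the convolution of the `ζ`-twisted autocorrelation of
  -- `u` with that of `v`, so they agree by uniqueness.
  have := integral_boundedContinuous_mul_eq_of_dualEval (m₁ := νv)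
    (m₂ := Measure.map (fun η => ζ⁻¹ * η) νu) (w₁ := fun η => fourierSq μ u (ζ * η))
    (w₂ := fourierSq μ v) (integrable_fourierSq_comp u (continuous_const_mul ζ))
    (integrable_fourierSq_comp v continuous_id) (fun x => ?_) g
  · rw [this, hmap (fun ξ => fourierSq μ v ξ * g ξ) ((continuous_fourierSq v).mul g.continuous)]
  · rw [hmap (fun ξ => fourierSq μ v ξ * ((ξ x : Circle) : ℂ)) ((continuous_fourierSq v).mul (continuous_dual_apply x)),
      integral_dual_mul_fourierSq_translate u hv]
    simp only [coe_mul_dual, coe_inv_dual]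
    have h1 : ∀ η : PontryaginDual G, fourierSq μ v (ζ⁻¹ * η) *
        (starRingEnd ℂ ((ζ x : Circle) : ℂ) * ((η x : Circle) : ℂ)) =
        starRingEnd ℂ ((ζ x : Circle) : ℂ) *
          (fourierSq μ v (ζ⁻¹ * η) * ((η x : Circle) : ℂ)) := fun η => by ring
    simp only [h1]
    rw [integral_const_mul, integral_dual_mul_fourierSq_translate v hu, ← integral_const_mul,
      ← integral_div_left_eq_self (fun y => autocorr μ u y * starRingEnd ℂ ((ζ y : Circle) : ℂ) *
        autocorr μ v (x * y⁻¹)) μ x]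
    congr 1
    ext y
    have e : starRingEnd ℂ ((ζ (x * y⁻¹) : Circle) : ℂ) =
        starRingEnd ℂ ((ζ x : Circle) : ℂ) * ((ζ y : Circle) : ℂ) := by
      rw [coe_dual_mul, coe_dual_inv, map_mul (starRingEnd ℂ), Complex.conj_conj]
    simp only [div_eq_mul_inv, e, coe_inv_dual, Complex.conj_conj, mul_inv, inv_inv,
      mul_inv_cancel_left]
    ring

/-- The averaged form of the proportionality of spectral measures. -/
theorem integral_mul_integral_fourierSq (u v : C_c(G, ℂ)) {νu νv : Measure (PontryaginDual G)}
    [IsFiniteMeasure νu] [νu.Regular] [IsFiniteMeasure νv] [νv.Regular]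
    (hu : ∀ x, ∫ ξ, ((ξ x : Circle) : ℂ) ∂νu = autocorr μ u x)
    (hv : ∀ x, ∫ ξ, ((ξ x : Circle) : ℂ) ∂νv = autocorr μ v x)
    (m : Measure (PontryaginDual G)) [m.IsHaarMeasure] [m.Regular]
    (h p : C_c(PontryaginDual G, ℂ)) :
    (∫ η, p η ∂νv) * ∫ η, h η * fourierSq μ u η ∂m =
      (∫ η, h η ∂νu) * ∫ η, p η * fourierSq μ v η ∂m := by
  have key : ∀ ζ : PontryaginDual G,
      ∫ η, p η * (h (ζ * η) * fourierSq μ u (ζ * η)) ∂νv =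
      ∫ η, h η * (p (ζ⁻¹ * η) * fourierSq μ v (ζ⁻¹ * η)) ∂νu := by
    intro ζ
    let g : PontryaginDual G →ᵇ ℂ := p.toBoundedContinuousFunction *
      h.toBoundedContinuousFunction.compContinuous ⟨fun η => ζ * η, by fun_prop⟩
    have hg : ∀ η, g η = p η * h (ζ * η) := fun _ => rfl
    have := integral_mul_fourierSq_translate u v hu hv ζ g
    simp only [hg, mul_inv_cancel_left] at this
    calc _ = ∫ η, fourierSq μ u (ζ * η) * (p η * h (ζ * η)) ∂νv := by
          congr 1; ext η; ring
      _ = _ := this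
      _ = _ := by congr 1; ext η; ring
  have hp := p.continuous
  have hh := h.continuous
  have hsu := continuous_fourierSq (μ := μ) u
  have hsv := continuous_fourierSq (μ := μ) v
  have hcs : HasCompactSupport fun η => h η * fourierSq μ u η := h.hasCompactSupport.mul_right
  have hcs' : HasCompactSupport fun η => p η * fourierSq μ v η := p.hasCompactSupport.mul_right
  -- Once the order is exchanged, invariance of `m` makes the inner integral over `ζ` independent of
  -- `η`, so the average factors. The other side of `key` factors in the same way.
  have h1 : ∫ ζ, ∫ η, p η * (h (ζ * η) * fourierSq μ u (ζ * η)) ∂νv ∂m =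
      (∫ η, p η ∂νv) * ∫ η, h η * fourierSq μ u η ∂m := by
    rw [integral_integral_swap_of_hasCompactSupport, ← integral_mul_const]
    · congr 1
      ext η
      rw [integral_const_mul, integral_mul_right_eq_self (fun ζ => h ζ * fourierSq μ u ζ) η]
    · change Continuous fun q : PontryaginDual G × PontryaginDual G =>
        p q.2 * (h (q.1 * q.2) * fourierSq μ u (q.1 * q.2))
      fun_prop
    · refine HasCompactSupport.intro (K := (tsupport h * (tsupport p)⁻¹) ×ˢ tsupport p)
        ((h.hasCompactSupport.isCompact.mul p.hasCompactSupport.isCompact.inv).prod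
          p.hasCompactSupport.isCompact) ?_
      rintro ⟨ζ, η⟩ hx
      by_cases hη : η ∈ tsupport p
      · have : h (ζ * η) = 0 := image_eq_zero_of_notMem_tsupport fun h' =>
          hx ⟨⟨ζ * η, h', η⁻¹, Set.inv_mem_inv.2 hη, by simp⟩, hη⟩
        simp [this]
      · simp [image_eq_zero_of_notMem_tsupport hη]
  have h2 : ∫ ζ, ∫ η, h η * (p (ζ⁻¹ * η) * fourierSq μ v (ζ⁻¹ * η)) ∂νu ∂m =
      (∫ η, h η ∂νu) * ∫ η, p η * fourierSq μ v η ∂m := by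
    rw [integral_integral_swap_of_hasCompactSupport, ← integral_mul_const]
    · congr 1
      ext η
      rw [integral_const_mul,
        ← integral_div_left_eq_self (fun ζ => p ζ * fourierSq μ v ζ) m η]
      simp only [div_eq_mul_inv, mul_comm]
    · change Continuous fun q : PontryaginDual G × PontryaginDual G =>
        h q.2 * (p (q.1⁻¹ * q.2) * fourierSq μ v (q.1⁻¹ * q.2))
      fun_prop
    · refine HasCompactSupport.intro (K := (tsupport h * (tsupport p)⁻¹) ×ˢ tsupport h)
        ((h.hasCompactSupport.isCompact.mul p.hasCompactSupport.isCompact.inv).prod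
          h.hasCompactSupport.isCompact) ?_
      rintro ⟨ζ, η⟩ hx
      by_cases hη : η ∈ tsupport h
      · have : p (ζ⁻¹ * η) = 0 := image_eq_zero_of_notMem_tsupport fun h' =>
          hx ⟨⟨η, hη, (ζ⁻¹ * η)⁻¹, Set.inv_mem_inv.2 h', by simp⟩, hη⟩
        simp [this]
      · simp [image_eq_zero_of_notMem_tsupport hη]
  rw [← h1, ← h2]
  simp only [key]

end SpectralIdentity

/-! ### Integrability tested on compact sets -/

section Cutoff

variable {Y : Type*} [TopologicalSpace Y] [R1Space Y] [LocallyCompactSpace Y]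

theorem exists_cutoff {K : Set Y} (hK : IsCompact K) :
    ∃ k : C_c(Y, ℝ), (∀ y, k y ∈ Set.Icc (0 : ℝ) 1) ∧ ∀ y ∈ K, k y = 1 := by
  obtain ⟨f, h1, h2, -, h4⟩ := exists_continuousMap_one_of_isCompact_subset_isOpen hK isOpen_univ
    (Set.subset_univ K)
  exact ⟨⟨f, h2⟩, h4, fun y hy => h1 hy⟩

/-- A real compactly supported function as a complex one. -/
noncomputable def complexCc (k : C_c(Y, ℝ)) : C_c(Y, ℂ) :=
  ⟨⟨fun y => (k y : ℂ), by fun_prop⟩,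
    HasCompactSupport.comp_left (g := fun t : ℝ => (t : ℂ)) k.hasCompactSupport (by simp)⟩

theorem complexCc_apply (k : C_c(Y, ℝ)) (y : Y) : complexCc k y = (k y : ℂ) := rfl

variable [MeasurableSpace Y] [BorelSpace Y] {m : Measure Y} [m.Regular]

/-- Inner regularity exhausts a set of finite measure, up to a null set, by an increasing sequence
of compact sets. -/
theorem setLIntegral_le_of_forall_isCompact {f : Y → ℝ≥0∞} {C : ℝ≥0∞} {S : Set Y}
    (hS : MeasurableSet S) (hmS : m S ≠ ∞)
    (h : ∀ K ⊆ S, IsCompact K → ∫⁻ y in K, f y ∂m ≤ C) : ∫⁻ y in S, f y ∂m ≤ C := by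
  have hex : ∀ n : ℕ, ∃ K ⊆ S, IsCompact K ∧ IsClosed K ∧ m (S \ K) < ((n : ℝ≥0∞) + 1)⁻¹ :=
    fun n => by
      obtain ⟨K, h1, h2, h3, h4⟩ := hS.exists_isCompact_isClosed_sdiff_lt hmS
        (ε := ((n : ℝ≥0∞) + 1)⁻¹) (by simp)
      exact ⟨K, h1, h2, h3, h4⟩
  choose K hKS hKc hKcl hKm using hex
  have hnull : m (S \ ⋃ n, K n) = 0 := by
    refine le_antisymm (ge_of_tendsto (x := atTop) (f := fun n : ℕ => ((n : ℝ≥0∞) + 1)⁻¹) ?_ ?_) zero_le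
    · have := ENNReal.tendsto_inv_nat_nhds_zero.comp (tendsto_add_atTop_nat 1)
      simpa [Function.comp_def] using this
    · exact Eventually.of_forall fun n => (measure_mono
        (Set.sdiff_subset_sdiff_right (Set.subset_iUnion K n))).trans (hKm n).le
  have hae : S =ᵐ[m] ⋃ n, Set.accumulate K n := by
    rw [Set.iUnion_accumulate]
    refine ae_eq_set.2 ⟨hnull, ?_⟩
    rw [Set.sdiff_eq_empty.2 (Set.iUnion_subset hKS), measure_empty]
  rw [setLIntegral_congr hae, setLIntegral_iUnion_of_directed f
    (Set.monotone_accumulate.directed_le)]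
  refine iSup_le fun n => h _ ?_ ?_
  · exact Set.iUnion₂_subset fun i _ => hKS i
  · exact (Set.finite_le_nat n).isCompact_biUnion fun i _ => hKc i

/-- The measure need not be σ-finite, but the open sets where `f` exceeds `1 / (n + 1)` have finite
measure, by Markov's inequality on their compact subsets, and they exhaust the support of `f`. -/
theorem integrable_of_forall_cutoff {f : Y → ℝ} (hf : Continuous f) (hf0 : ∀ y, 0 ≤ f y) {C : ℝ}
    (hC : ∀ k : C_c(Y, ℝ), (∀ y, k y ∈ Set.Icc (0 : ℝ) 1) → ∫ y, k y * f y ∂m ≤ C) :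
    Integrable f m ∧ ∫ y, f y ∂m ≤ C := by
  have hC0 : 0 ≤ C := by simpa using hC 0 (by simp)
  have hK : ∀ K : Set Y, IsCompact K → ∫⁻ y in K, ENNReal.ofReal (f y) ∂m ≤ ENNReal.ofReal C := by
    intro K hK
    obtain ⟨k, hk01, hk1⟩ := exists_cutoff hK
    have hi : Integrable (fun y => k y * f y) m :=
      (k.continuous.mul hf).integrable_of_hasCompactSupport k.hasCompactSupport.mul_right
    calc ∫⁻ y in K, ENNReal.ofReal (f y) ∂m
        ≤ ∫⁻ y in K, ENNReal.ofReal (k y * f y) ∂m := by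
          refine setLIntegral_mono (by fun_prop) fun y hy => ?_
          rw [hk1 y hy, one_mul]
      _ ≤ ∫⁻ y, ENNReal.ofReal (k y * f y) ∂m := setLIntegral_le_lintegral _ _
      _ = ENNReal.ofReal (∫ y, k y * f y ∂m) :=
          (ofReal_integral_eq_lintegral_ofReal hi
            (Eventually.of_forall fun y => mul_nonneg (hk01 y).1 (hf0 y))).symm
      _ ≤ ENNReal.ofReal C := ENNReal.ofReal_le_ofReal (hC k hk01)
  let O : ℕ → Set Y := fun n => {y | 1 / ((n : ℝ) + 1) < f y}
  have hO : ∀ n, IsOpen (O n) := fun n => isOpen_lt continuous_const hf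
  have hOm : ∀ n, m (O n) ≠ ∞ := by
    intro n
    have : m (O n) ≤ ENNReal.ofReal ((n + 1) * C) := by
      rw [(hO n).measure_eq_iSup_isCompact]
      refine iSup₂_le fun K hKO => iSup_le fun hKc => ?_
      have h1 : ENNReal.ofReal (1 / ((n : ℝ) + 1)) * m K ≤ ENNReal.ofReal C := by
        refine le_trans ?_ (hK K hKc)
        rw [← setLIntegral_const]
        exact setLIntegral_mono (by fun_prop) fun y hy => ENNReal.ofReal_le_ofReal (hKO hy).le
      have h2 : ENNReal.ofReal ((n : ℝ) + 1) * (ENNReal.ofReal (1 / ((n : ℝ) + 1)) * m K) = m K := by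
        rw [← mul_assoc, ← ENNReal.ofReal_mul (by positivity), mul_one_div_cancel (by positivity)]
        simp
      rw [← h2, ENNReal.ofReal_mul (by positivity)]
      gcongr
    exact (this.trans_lt ENNReal.ofReal_lt_top).ne
  have hmono : Monotone O := by
    intro a b hab y hy
    have hy' : 1 / ((a : ℝ) + 1) < f y := hy
    refine lt_of_le_of_lt (?_ : 1 / ((b : ℝ) + 1) ≤ _) hy'
    exact one_div_le_one_div_of_le (by positivity) (by gcongr)
  have hlin : ∫⁻ y, ENNReal.ofReal (f y) ∂m ≤ ENNReal.ofReal C := by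
    have hsupp : Function.support (fun y => ENNReal.ofReal (f y)) ⊆ ⋃ n, O n := by
      intro y hy
      have : 0 < f y := by
        rw [Function.mem_support] at hy
        by_contra h
        exact hy (ENNReal.ofReal_of_nonpos (not_lt.1 h))
      obtain ⟨n, hn⟩ := exists_nat_one_div_lt this
      exact Set.mem_iUnion.2 ⟨n, hn⟩
    rw [← setLIntegral_eq_of_support_subset hsupp,
      setLIntegral_iUnion_of_directed _ hmono.directed_le]
    exact iSup_le fun n => setLIntegral_le_of_forall_isCompact (hO n).measurableSet (hOm n)
      fun K _ hKc => hK K hKc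
  have hint : Integrable f m := by
    refine ⟨hf.measurable.aestronglyMeasurable, ?_⟩
    rw [hasFiniteIntegral_iff_ofReal (Eventually.of_forall hf0)]
    exact hlin.trans_lt ENNReal.ofReal_lt_top
  refine ⟨hint, ?_⟩
  rw [← ofReal_integral_eq_lintegral_ofReal hint (Eventually.of_forall hf0)] at hlin
  exact (ENNReal.ofReal_le_ofReal_iff hC0).1 hlin

end Cutoff

/-! ### Plancherel's theorem up to a constant -/

section Plancherel

variable {G : Type*} [CommGroup G] [TopologicalSpace G] [IsTopologicalGroup G]
  [LocallyCompactSpace G] [T2Space G] [MeasurableSpace G] [BorelSpace G]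
  {μ : Measure G} [μ.IsHaarMeasure] [μ.Regular]
  [MeasurableSpace (PontryaginDual G)] [BorelSpace (PontryaginDual G)]
  {m : Measure (PontryaginDual G)} [m.IsHaarMeasure] [m.Regular]

/-- A nonnegative bump supported where every character in `K` is within `1 / 2` of `1` has Fourier
integral within half its total mass of that mass. -/
theorem exists_fourierInt_ne_zero {K : Set (PontryaginDual G)} (hK : IsCompact K) :
    ∃ u : C_c(G, ℂ), ∀ ξ ∈ K, fourierInt μ u ξ ≠ 0 := by
  have hev : ∀ᶠ x in 𝓝 (1 : G), ∀ ξ ∈ K, ‖1 - starRingEnd ℂ ((ξ x : Circle) : ℂ)‖ < 1 / 2 := by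
    refine hK.eventually_forall_of_forall_eventually fun ξ _ => ?_
    have hc : Continuous fun z : G × PontryaginDual G =>
        ‖1 - starRingEnd ℂ ((z.2 z.1 : Circle) : ℂ)‖ :=
      (continuous_const.sub (Complex.continuous_conj.comp
        (continuous_dual_eval.comp continuous_swap))).norm
    refine hc.continuousAt.eventually_lt continuousAt_const ?_
    simp
  obtain ⟨V, hV, hVo, hV1⟩ := eventually_nhds_iff.1 hev
  obtain ⟨f, hf1, hfc, hfV, hf01⟩ := exists_continuousMap_one_of_isCompact_subset_isOpen
    (isCompact_singleton (x := (1 : G))) hVo (Set.singleton_subset_iff.2 hV1)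
  let k : C_c(G, ℝ) := ⟨f, hfc⟩
  have hk : ∀ x, k x = f x := fun _ => rfl
  have hpos : 0 < ∫ x, k x ∂μ :=
    f.continuous.integral_pos_of_hasCompactSupport_nonneg_nonzero hfc (fun x => (hf01 x).1)
      (x := 1) (by rw [show k 1 = 1 from hf1 rfl]; exact one_ne_zero)
  refine ⟨complexCc k, fun ξ hξ h0 => ?_⟩
  have hi : Integrable (fun x => complexCc k x * starRingEnd ℂ ((ξ x : Circle) : ℂ)) μ :=
    integrable_mul_of_norm_le_one (complexCc k).integrable
      (Complex.continuous_conj.comp (continuous_coe_dual ξ))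
      (fun x => by rw [RCLike.norm_conj, Circle.norm_coe])
  have h1 : ((∫ x, k x ∂μ : ℝ) : ℂ) =
      ∫ x, complexCc k x * (1 - starRingEnd ℂ ((ξ x : Circle) : ℂ)) ∂μ := by
    simp only [mul_sub, mul_one]
    rw [integral_sub (complexCc k).integrable hi]
    have : ∫ x, complexCc k x * starRingEnd ℂ ((ξ x : Circle) : ℂ) ∂μ = 0 := h0
    rw [this, sub_zero]
    exact integral_complex_ofReal.symm
  have h2 : ‖((∫ x, k x ∂μ : ℝ) : ℂ)‖ ≤ ∫ x, k x * (1 / 2) ∂μ := by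
    rw [h1]
    refine norm_integral_le_of_norm_le (k.integrable.mul_const _)
      (Eventually.of_forall fun x => ?_)
    rw [norm_mul, complexCc_apply, Complex.norm_real, hk, Real.norm_of_nonneg (hf01 x).1]
    by_cases hx : x ∈ tsupport f
    · exact mul_le_mul_of_nonneg_left (hV x (hfV hx) ξ hξ).le (hf01 x).1
    · simp [image_eq_zero_of_notMem_tsupport hx]
  rw [Complex.norm_real, Real.norm_of_nonneg hpos.le, integral_mul_const] at h2
  linarith

theorem autocorr_one (u : C_c(G, ℂ)) : autocorr μ u 1 = ((∫ x, ‖u x‖ ^ 2 ∂μ : ℝ) : ℂ) := by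
  rw [autocorr, ← integral_complex_ofReal]
  congr 1
  ext t
  rw [one_mul, mul_comm, Complex.mul_conj, Complex.normSq_eq_norm_sq]

theorem measureReal_univ_of_autocorr {u : C_c(G, ℂ)} {ν : Measure (PontryaginDual G)}
    (hν : ∀ x, ∫ ξ, ((ξ x : Circle) : ℂ) ∂ν = autocorr μ u x) :
    ν.real Set.univ = ∫ x, ‖u x‖ ^ 2 ∂μ := by
  have h := hν 1
  rw [autocorr_one] at h
  simp only [map_one, Circle.coe_one, integral_const] at h
  have h2 : ((ν.real Set.univ : ℝ) : ℂ) = ((∫ x, ‖u x‖ ^ 2 ∂μ : ℝ) : ℂ) := by simpa using h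
  exact_mod_cast h2

theorem integral_complexCc_mul_fourierSq (k : C_c(PontryaginDual G, ℝ)) (u : C_c(G, ℂ))
    (ν : Measure (PontryaginDual G)) :
    ∫ η, complexCc k η * fourierSq μ u η ∂ν =
      ((∫ η, k η * ‖fourierInt μ u η‖ ^ 2 ∂ν : ℝ) : ℂ) := by
  rw [← integral_complex_ofReal]
  congr 1
  ext η
  rw [complexCc_apply, fourierSq_eq, Complex.ofReal_mul]

/-- Up to a positive constant, all spectral measures have density `|û|²` with respect to the Haar
measure of the dual. -/
theorem exists_const_integral_mul_fourierSq (μ : Measure G) [μ.IsHaarMeasure] [μ.Regular]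
    (m : Measure (PontryaginDual G)) [m.IsHaarMeasure] [m.Regular] :
    ∃ c : ℝ, 0 < c ∧ ∀ u : C_c(G, ℂ), ∃ ν : Measure (PontryaginDual G), IsFiniteMeasure ν ∧
      ν.Regular ∧ ν.real Set.univ = ∫ x, ‖u x‖ ^ 2 ∂μ ∧
      ∀ k : C_c(PontryaginDual G, ℝ),
        ∫ η, k η * ‖fourierInt μ u η‖ ^ 2 ∂m = c * ∫ η, k η ∂ν := by
  obtain ⟨v, hv⟩ := exists_fourierInt_ne_zero (μ := μ) (isCompact_singleton (x := (1 : PontryaginDual G)))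
  have hv1 : fourierInt μ v 1 ≠ 0 := hv 1 rfl
  obtain ⟨νv, _, _, hνv⟩ := exists_measure_autocorr μ v
  have hpos : 0 < νv.real Set.univ := by
    rw [measureReal_univ_of_autocorr hνv]
    have hne : ∃ x, v x ≠ 0 := by
      by_contra h
      push Not at h
      exact hv1 (by simp [fourierInt, h])
    obtain ⟨x, hx⟩ := hne
    refine Continuous.integral_pos_of_hasCompactSupport_nonneg_nonzero
      (f := fun x => ‖v x‖ ^ 2) (by fun_prop) ?_ (fun x => sq_nonneg _) (x := x) ?_
    · exact HasCompactSupport.comp_left (g := fun z : ℂ => ‖z‖ ^ 2) v.hasCompactSupport (by simp)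
    · simpa using hx
  obtain ⟨K, -, hK, hKpos⟩ : ∃ K ⊆ Set.univ, IsCompact K ∧ 0 < νv K :=
    isOpen_univ.exists_lt_isCompact (ENNReal.toReal_pos_iff.1 hpos).1
  obtain ⟨p, hp01, hp1⟩ := exists_cutoff (hK.union (isCompact_singleton (x := (1 : PontryaginDual G))))
  have hA : 0 < ∫ η, p η ∂νv := by
    have : νv.real K ≤ ∫ η, p η ∂νv := by
      rw [← integral_indicator_one hK.measurableSet]
      refine integral_mono ((integrable_const 1).indicator hK.measurableSet) p.integrable fun η => ?_
      by_cases hη : η ∈ K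
      · simp [hη, hp1 η (Or.inl hη)]
      · simp [hη, (hp01 η).1]
    exact lt_of_lt_of_le (ENNReal.toReal_pos hKpos.ne' (measure_ne_top _ _)) this
  have hvc := continuous_fourierInt (μ := μ) (u := v) v.integrable
  have hB : 0 < ∫ η, p η * ‖fourierInt μ v η‖ ^ 2 ∂m := by
    refine Continuous.integral_pos_of_hasCompactSupport_nonneg_nonzero
      (f := fun η => p η * ‖fourierInt μ v η‖ ^ 2) (by fun_prop) p.hasCompactSupport.mul_right
      (fun η => mul_nonneg (hp01 η).1 (sq_nonneg _)) (x := 1) ?_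
    rw [hp1 1 (Or.inr rfl)]
    simpa using hv1
  -- The constant is the ratio of the integral of `p * |v̂|²` against `m` to that of `p` against
  -- `νv`. It depends only on the reference pair `v`, `p`, so it serves every `u`.
  refine ⟨_, div_pos hB hA, fun u => ?_⟩
  obtain ⟨νu, h1, h2, hνu⟩ := exists_measure_autocorr μ u
  refine ⟨νu, h1, h2, measureReal_univ_of_autocorr hνu, fun k => ?_⟩
  have h := integral_mul_integral_fourierSq u v hνu hνv m (complexCc k) (complexCc p)
  rw [integral_complexCc_mul_fourierSq, integral_complexCc_mul_fourierSq] at h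
  simp only [complexCc_apply, integral_complex_ofReal] at h
  have h' : (∫ η, p η ∂νv) * ∫ η, k η * ‖fourierInt μ u η‖ ^ 2 ∂m =
      (∫ η, k η ∂νu) * ∫ η, p η * ‖fourierInt μ v η‖ ^ 2 ∂m := by exact_mod_cast h
  field_simp
  linarith

/-- **Plancherel's theorem** for continuous compactly supported functions. -/
theorem exists_const_plancherel (μ : Measure G) [μ.IsHaarMeasure] [μ.Regular]
    (m : Measure (PontryaginDual G)) [m.IsHaarMeasure] [m.Regular] :
    ∃ c : ℝ, 0 < c ∧ ∀ u : C_c(G, ℂ), Integrable (fun η => ‖fourierInt μ u η‖ ^ 2) m ∧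
      ∫ η, ‖fourierInt μ u η‖ ^ 2 ∂m = c * ∫ x, ‖u x‖ ^ 2 ∂μ := by
  obtain ⟨c, hc, h⟩ := exists_const_integral_mul_fourierSq μ m
  refine ⟨c, hc, fun u => ?_⟩
  obtain ⟨ν, _, _, hν1, hν⟩ := h u
  have huc := continuous_fourierInt (μ := μ) (u := u) u.integrable
  obtain ⟨hi, hle⟩ := integrable_of_forall_cutoff (m := m) (C := c * ∫ x, ‖u x‖ ^ 2 ∂μ)
    (f := fun η => ‖fourierInt μ u η‖ ^ 2) (by fun_prop) (fun η => sq_nonneg _) (fun k hk => by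
      rw [hν, ← hν1]
      refine mul_le_mul_of_nonneg_left ?_ hc.le
      calc ∫ η, k η ∂ν ≤ ∫ _, (1 : ℝ) ∂ν :=
            integral_mono k.integrable (integrable_const 1) fun η => (hk η).2
        _ = _ := by simp)
  refine ⟨hi, le_antisymm hle ?_⟩
  -- For the reverse inequality the constant `1` is tested against `ν`: cutoffs then bound the total
  -- mass of `ν`, which is the squared `L²` norm of `u`.
  obtain ⟨-, hle'⟩ := integrable_of_forall_cutoff (m := ν)
    (C := c⁻¹ * ∫ η, ‖fourierInt μ u η‖ ^ 2 ∂m) (f := fun _ => 1) continuous_const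
    (fun η => zero_le_one) (fun k hk => by
      simp only [mul_one]
      rw [le_inv_mul_iff₀ hc, ← hν]
      refine integral_mono_of_nonneg (Eventually.of_forall fun η =>
        mul_nonneg (hk η).1 (sq_nonneg _)) hi (Eventually.of_forall fun η => ?_)
      exact mul_le_of_le_one_left (sq_nonneg _) (hk η).2)
  simp only [integral_const, smul_eq_mul, mul_one] at hle'
  rw [hν1, le_inv_mul_iff₀ hc] at hle'
  exact hle'

theorem memLp_fourierInt (u : C_c(G, ℂ)) : MemLp (fourierInt μ u) 2 m := by
  obtain ⟨c, hc, h⟩ := exists_const_plancherel μ m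
  exact (memLp_two_iff_integrable_sq_norm (continuous_fourierInt (μ := μ) (u := u)
    u.integrable).measurable.aestronglyMeasurable).2 (h u).1

/-- Continuous compactly supported functions, as elements of `L²`. -/
noncomputable def ccToL2 {Y : Type*} [TopologicalSpace Y] [MeasurableSpace Y] [BorelSpace Y]
    (ν : Measure Y) [IsFiniteMeasureOnCompacts ν] : C_c(Y, ℂ) →ₗ[ℂ] Lp ℂ 2 ν where
  toFun u := (memLp_cc 2 u).toLp u
  map_add' _ _ := rfl
  map_smul' _ _ := rfl

theorem fourierInt_add {u v : G → ℂ} (hu : Integrable u μ) (hv : Integrable v μ)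
    (ξ : PontryaginDual G) :
    fourierInt μ (u + v) ξ = fourierInt μ u ξ + fourierInt μ v ξ := by
  have hc := Complex.continuous_conj.comp (continuous_coe_dual ξ)
  have h1 : ∀ x, ‖(starRingEnd ℂ ∘ fun x => ((ξ x : Circle) : ℂ)) x‖ ≤ 1 := fun x => by
    rw [Function.comp_apply, RCLike.norm_conj, Circle.norm_coe]
  simp only [fourierInt, Pi.add_apply, add_mul]
  exact integral_add (integrable_mul_of_norm_le_one hu hc h1)
    (integrable_mul_of_norm_le_one hv hc h1)

theorem fourierInt_smul (a : ℂ) (u : G → ℂ) (ξ : PontryaginDual G) :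
    fourierInt μ (a • u) ξ = a * fourierInt μ u ξ := by
  simp only [fourierInt, Pi.smul_apply, smul_eq_mul, mul_assoc]
  exact integral_const_mul _ _

theorem norm_toLp_sq {Y : Type*} [MeasurableSpace Y] {ν : Measure Y} {f : Y → ℂ}
    (hf : MemLp f 2 ν) : ‖hf.toLp f‖ ^ 2 = ∫ y, ‖f y‖ ^ 2 ∂ν := by
  have h : ((‖hf.toLp f‖ ^ 2 : ℝ) : ℂ) = ((∫ y, ‖f y‖ ^ 2 ∂ν : ℝ) : ℂ) := by
    rw [← integral_complex_ofReal, Complex.ofReal_pow]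
    refine (inner_self_eq_norm_sq_to_K (𝕜 := ℂ) (hf.toLp f)).symm.trans ?_
    rw [L2.inner_def]
    refine integral_congr_ae ?_
    filter_upwards [hf.coeFn_toLp] with y hy
    rw [hy, inner_self_eq_norm_sq_to_K]
    simp
  exact_mod_cast h

/-- The Fourier transform of continuous compactly supported functions, with values in `L²`. -/
noncomputable def ccFourier (μ : Measure G) [μ.IsHaarMeasure] [μ.Regular]
    (m : Measure (PontryaginDual G)) [m.IsHaarMeasure] [m.Regular] :
    C_c(G, ℂ) →ₗ[ℂ] Lp ℂ 2 m where
  toFun u := (memLp_fourierInt u).toLp (fourierInt μ u)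
  map_add' u v := by
    rw [← MemLp.toLp_add]
    congr 1
    ext ξ
    exact fourierInt_add u.integrable v.integrable ξ
  map_smul' a u := by
    rw [← MemLp.toLp_const_smul]
    congr 1
    ext ξ
    exact fourierInt_smul a u ξ

/-- Polarization of the norm identity. -/
theorem exists_const_inner_ccFourier (μ : Measure G) [μ.IsHaarMeasure] [μ.Regular]
    (m : Measure (PontryaginDual G)) [m.IsHaarMeasure] [m.Regular] :
    ∃ c : ℝ, 0 < c ∧ (∀ u : C_c(G, ℂ), ‖ccFourier μ m u‖ ^ 2 = c * ‖ccToL2 μ u‖ ^ 2) ∧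
      ∀ u v : C_c(G, ℂ), inner ℂ (ccFourier μ m u) (ccFourier μ m v) =
        (c : ℂ) * inner ℂ (ccToL2 μ u) (ccToL2 μ v) := by
  obtain ⟨c, hc, h⟩ := exists_const_plancherel μ m
  have hnorm : ∀ u : C_c(G, ℂ), ‖ccFourier μ m u‖ ^ 2 = c * ‖ccToL2 μ u‖ ^ 2 := by
    intro u
    exact (norm_toLp_sq (memLp_fourierInt u)).trans ((h u).2.trans (congrArg _ (norm_toLp_sq (memLp_cc 2 u)).symm))
  refine ⟨c, hc, hnorm, fun u v => ?_⟩
  rw [inner_eq_sum_norm_sq_div_four, inner_eq_sum_norm_sq_div_four]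
  simp only [← map_add, ← map_sub, ← map_smul]
  have hn : ∀ u : C_c(G, ℂ), ((‖ccFourier μ m u‖ : ℝ) : ℂ) ^ 2 =
      (c : ℂ) * ((‖ccToL2 μ u‖ : ℝ) : ℂ) ^ 2 := fun u => by exact_mod_cast hnorm u
  simp only [RCLike.ofReal_eq_complex_ofReal, hn]
  ring

end Plancherel

/-! ### Pairings in L² and test functions -/

section L2Tools

variable {Y : Type*} [MeasurableSpace Y] {m : Measure Y}

theorem inner_toLp {f g : Y → ℂ} (hf : MemLp f 2 m) (hg : MemLp g 2 m) :
    inner ℂ (hf.toLp f) (hg.toLp g) = ∫ y, starRingEnd ℂ (f y) * g y ∂m := by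
  rw [L2.inner_def]
  refine integral_congr_ae ?_
  filter_upwards [hf.coeFn_toLp, hg.coeFn_toLp] with y h1 h2
  rw [h1, h2, RCLike.inner_apply, mul_comm]

theorem norm_integral_conj_mul_le {f g : Y → ℂ} (hf : MemLp f 2 m) (hg : MemLp g 2 m) :
    ‖∫ y, starRingEnd ℂ (f y) * g y ∂m‖ ≤ (eLpNorm f 2 m).toReal * (eLpNorm g 2 m).toReal := by
  rw [← inner_toLp hf hg, ← Lp.norm_toLp f hf, ← Lp.norm_toLp g hg]
  exact norm_inner_le_norm _ _

theorem integrable_conj_mul {f g : Y → ℂ} (hf : MemLp f 2 m) (hg : MemLp g 2 m) :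
    Integrable (fun y => starRingEnd ℂ (f y) * g y) m :=
  MemLp.integrable_mul hf.star hg

/-- The `φ n` are not assumed square integrable, but from some index on they are, being at finite
distance from `f`. -/
theorem tendsto_integral_conj_mul {φ : ℕ → Y → ℂ} {f w : Y → ℂ}
    (hφ : ∀ n, AEStronglyMeasurable (φ n) m) (hf : MemLp f 2 m) (hw : MemLp w 2 m)
    (h : Tendsto (fun n => eLpNorm (φ n - f) 2 m) atTop (𝓝 0)) :
    Tendsto (fun n => ∫ y, starRingEnd ℂ (w y) * φ n y ∂m) atTop
      (𝓝 (∫ y, starRingEnd ℂ (w y) * f y ∂m)) := by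
  have hlt : ∀ᶠ n in atTop, eLpNorm (φ n - f) 2 m < ∞ := h.eventually_lt_const ENNReal.zero_lt_top
  rw [tendsto_iff_norm_sub_tendsto_zero]
  have h0 : Tendsto (fun n => (eLpNorm w 2 m).toReal * (eLpNorm (φ n - f) 2 m).toReal) atTop
      (𝓝 0) := by
    have := ((ENNReal.tendsto_toReal ENNReal.zero_ne_top).comp h).const_mul (eLpNorm w 2 m).toReal
    simpa using this
  refine squeeze_zero' (Eventually.of_forall fun _ => norm_nonneg _) ?_ h0
  filter_upwards [hlt] with n hn
  have hd : MemLp (φ n - f) 2 m := ⟨(hφ n).sub hf.aestronglyMeasurable, hn⟩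
  have hφn : MemLp (φ n) 2 m := by
    have := hd.add hf
    rwa [sub_add_cancel] at this
  rw [← integral_sub (integrable_conj_mul hw hφn) (integrable_conj_mul hw hf)]
  simp only [← mul_sub]
  exact norm_integral_conj_mul_le hw hd

end L2Tools

section DenseCc

variable {Y : Type*} [TopologicalSpace Y] [R1Space Y] [LocallyCompactSpace Y]
  [MeasurableSpace Y] [BorelSpace Y] {m : Measure Y} [m.Regular]

theorem eq_zero_of_inner_ccToL2 {U : Lp ℂ 2 m} (h : ∀ k : C_c(Y, ℂ), inner ℂ (ccToL2 m k) U = 0) :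
    U = 0 := by
  have hd : Dense (Set.range (ccToL2 m)) := by
    refine fun f => Metric.mem_closure_iff.2 fun ε hε => ?_
    obtain ⟨g, hg⟩ := MemLp.exists_compactlySupported_eLpNorm_sub_le (p := 2) (by simp) (Lp.memLp f)
      (ε := ENNReal.ofReal (ε / 2)) (by simpa using hε)
    refine ⟨ccToL2 m g, ⟨g, rfl⟩, ?_⟩
    have hm : MemLp ((f : Y → ℂ) - (g : Y → ℂ)) 2 m := (Lp.memLp f).sub (memLp_cc 2 g)
    have e : f - ccToL2 m g = hm.toLp _ := by
      rw [MemLp.toLp_sub (Lp.memLp f) (memLp_cc 2 g), Lp.toLp_coeFn]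
      rfl
    rw [dist_eq_norm, e, Lp.norm_toLp]
    exact (ENNReal.toReal_le_of_le_ofReal (by positivity) hg).trans_lt (by linarith)
  refine hd.eq_zero_of_inner_right ℂ fun v hv => ?_
  obtain ⟨k, rfl⟩ := hv
  exact h k

/-- Testing with `u = k * D`, where `k` is a cutoff equal to one at `y`, gives the integral of `k *
‖D‖ ^ 2`, which is positive if `D y ≠ 0`. -/
theorem eq_zero_of_integral_conj_cc_mul {D : Y → ℂ} (hD : Continuous D)
    [m.IsOpenPosMeasure] (h : ∀ u : C_c(Y, ℂ), ∫ y, starRingEnd ℂ (u y) * D y ∂m = 0) (y : Y) :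
    D y = 0 := by
  obtain ⟨k, hk01, hk1⟩ := exists_cutoff (isCompact_singleton (x := y))
  let u : C_c(Y, ℂ) := ⟨⟨fun z => complexCc k z * D z, by fun_prop⟩,
    (complexCc k).hasCompactSupport.mul_right⟩
  have hu := h u
  have e : ∀ z, starRingEnd ℂ (u z) * D z = ((k z * ‖D z‖ ^ 2 : ℝ) : ℂ) := by
    intro z
    change starRingEnd ℂ ((k z : ℂ) * D z) * D z = _
    rw [map_mul, Complex.conj_ofReal, mul_assoc, Complex.conj_mul']
    push_cast
    ring
  simp only [e] at hu
  rw [integral_complex_ofReal] at hu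
  by_contra hne
  have : 0 < ∫ z, k z * ‖D z‖ ^ 2 ∂m := by
    refine Continuous.integral_pos_of_hasCompactSupport_nonneg_nonzero
      (f := fun z => k z * ‖D z‖ ^ 2) (by fun_prop) k.hasCompactSupport.mul_right
      (fun z => mul_nonneg (hk01 z).1 (sq_nonneg _)) (x := y) ?_
    rw [hk1 y rfl]
    simpa using hne
  exact this.ne' (by exact_mod_cast hu)

end DenseCc

/-! ### Density of the range of the Fourier transform -/

section FourierRange

variable {G : Type*} [CommGroup G] [TopologicalSpace G] [IsTopologicalGroup G]
  [LocallyCompactSpace G] [T2Space G] [MeasurableSpace G] [BorelSpace G]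
  {μ : Measure G} [μ.IsHaarMeasure] [μ.Regular]
  [MeasurableSpace (PontryaginDual G)] [BorelSpace (PontryaginDual G)]
  {m : Measure (PontryaginDual G)} [m.IsHaarMeasure] [m.Regular]

theorem fourierInt_translateCc (u : C_c(G, ℂ)) (x : G) (ξ : PontryaginDual G) :
    fourierInt μ (translateCc x u) ξ =
      starRingEnd ℂ ((ξ x : Circle) : ℂ) * fourierInt μ u ξ := by
  rw [fourierInt, fourierInt, ← integral_const_mul, ← integral_mul_left_eq_self _ x]
  congr 1
  ext t
  change u (x⁻¹ * (x * t)) * _ = _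
  rw [inv_mul_cancel_left, coe_dual_mul, map_mul (starRingEnd ℂ)]
  ring

/-- The Fourier transforms of continuous compactly supported functions are dense in `L²`. -/
theorem denseRange_ccFourier : DenseRange (ccFourier μ m) := by
  have hbot : (LinearMap.range (ccFourier μ m))ᗮ = ⊥ := by
    refine (Submodule.eq_bot_iff _).2 fun U hU => ?_
    rw [Submodule.mem_orthogonal] at hU
    refine eq_zero_of_inner_ccToL2 fun h => ?_
    obtain ⟨u, hu⟩ := exists_fourierInt_ne_zero (μ := μ) h.hasCompactSupport.isCompact
    have huc := continuous_fourierInt (μ := μ) (u := u) u.integrable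
    have hin : ∀ v : C_c(G, ℂ),
        inner ℂ (ccFourier μ m v) U = ∫ ξ, starRingEnd ℂ (fourierInt μ v ξ) * U ξ ∂m := fun v => by
      have := inner_toLp (memLp_fourierInt (μ := μ) (m := m) v) (Lp.memLp U)
      rwa [Lp.toLp_coeFn] at this
    have hg : Continuous fun ξ => starRingEnd ℂ (h ξ / fourierInt μ u ξ) := by
      refine Complex.continuous_conj.comp (continuous_of_tsupport fun ξ hξ => ?_)
      have hsub : Function.support (fun ξ => h ξ / fourierInt μ u ξ) ⊆ Function.support h :=
        fun η hη h0 => hη (by simp [h0])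
      have hξ' : ξ ∈ tsupport h := closure_mono hsub hξ
      exact h.continuous.continuousAt.div huc.continuousAt (hu ξ hξ')
    have hgc : HasCompactSupport fun ξ => starRingEnd ℂ (h ξ / fourierInt μ u ξ) :=
      HasCompactSupport.intro h.hasCompactSupport.isCompact fun ξ hξ => by
        simp [image_eq_zero_of_notMem_tsupport hξ]
    let g : C_c(PontryaginDual G, ℂ) := ⟨⟨_, hg⟩, hgc⟩
    -- Orthogonality of `U` to the transforms of all translates of `u` says that the integrable
    -- function `conj û * U` has zero transform. Testing it against `conj (h / û)`, legitimate as
    -- `û` has no zero on the support of `h`, recovers the pairing of `h` with `U`.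
    have key := integral_boundedContinuous_mul_eq_of_dualEval (m₁ := m) (m₂ := m)
      (w₁ := fun ξ => starRingEnd ℂ (fourierInt μ u ξ) * U ξ) (w₂ := fun _ => 0)
      (integrable_conj_mul (memLp_fourierInt u) (Lp.memLp U)) (integrable_zero _ _ _)
      (fun x => by
        have h1 := hU _ ⟨translateCc x u, rfl⟩
        rw [hin] at h1
        simp only [zero_mul, integral_zero]
        rw [← h1]
        congr 1
        ext ξ
        rw [fourierInt_translateCc, map_mul, Complex.conj_conj]
        ring) g.toBoundedContinuousFunction
    simp only [zero_mul, integral_zero] at key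
    have := inner_toLp (memLp_cc (m := m) 2 h) (Lp.memLp U)
    rw [Lp.toLp_coeFn] at this
    refine this.trans (Eq.trans ?_ key)
    congr 1
    ext ξ
    change _ = starRingEnd ℂ (fourierInt μ u ξ) * U ξ *
      starRingEnd ℂ (h ξ / fourierInt μ u ξ)
    by_cases hξ : ξ ∈ tsupport h
    · have : starRingEnd ℂ (fourierInt μ u ξ) ≠ 0 := (map_ne_zero _).2 (hu ξ hξ)
      rw [map_div₀]
      field_simp
    · simp [image_eq_zero_of_notMem_tsupport hξ]
  have htop := (Submodule.topologicalClosure_eq_top_iff).2 hbot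
  exact Submodule.dense_iff_topologicalClosure_eq_top.2 htop

end FourierRange

/-! ### Inverse Fourier integrals as L² objects -/

section Inversion

variable {G : Type*} [CommGroup G] [TopologicalSpace G] [IsTopologicalGroup G]
  [LocallyCompactSpace G] [T2Space G] [MeasurableSpace G] [BorelSpace G]
  {μ : Measure G} [μ.IsHaarMeasure] [μ.Regular]
  [MeasurableSpace (PontryaginDual G)] [BorelSpace (PontryaginDual G)]
  {m : Measure (PontryaginDual G)} [m.IsHaarMeasure] [m.Regular]

/-- The inverse Fourier integral `∫ U(ξ) ξ(x) dξ`. -/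
noncomputable def invFourierInt (m : Measure (PontryaginDual G)) (U : PontryaginDual G → ℂ)
    (x : G) : ℂ :=
  ∫ ξ, U ξ * ((ξ x : Circle) : ℂ) ∂m

theorem continuous_invFourierInt {U : PontryaginDual G → ℂ} (hU : Integrable U m) :
    Continuous (invFourierInt m U) :=
  continuous_integral_mul_kernel (k := fun (x : G) (ξ : PontryaginDual G) => ((ξ x : Circle) : ℂ))
    (continuous_dual_eval.comp continuous_swap) (fun _ _ => (Circle.norm_coe _).le) hU

theorem integral_conj_fourierInt_mul {a : G → ℂ} {U : PontryaginDual G → ℂ} (ha : Integrable a μ)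
    (hU : Integrable U m) :
    ∫ ξ, starRingEnd ℂ (fourierInt μ a ξ) * U ξ ∂m =
      ∫ x, starRingEnd ℂ (a x) * invFourierInt m U x ∂μ := by
  have h := integral_mul_integral_kernel (μ := μ) (m := m)
    (k := fun x (ξ : PontryaginDual G) => ((ξ x : Circle) : ℂ))
    (continuous_dual_eval.comp continuous_swap) (fun _ _ => (Circle.norm_coe _).le)
    (a := fun x => starRingEnd ℂ (a x))
    (memLp_one_iff_integrable.1 (MemLp.star (memLp_one_iff_integrable.2 ha))) hU
  refine Eq.trans ?_ h.symm
  congr 1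
  ext ξ
  rw [mul_comm, fourierInt, ← integral_conj]
  simp only [map_mul, Complex.conj_conj]

/-- An integrable and square integrable function on the dual is the Fourier transform of its
inverse Fourier integral. -/
theorem exists_seq_tendsto_invFourierInt {c : ℝ} (hc : 0 < c)
    (hnorm : ∀ u : C_c(G, ℂ), ‖ccFourier μ m u‖ ^ 2 = c * ‖ccToL2 μ u‖ ^ 2)
    (hinner : ∀ u v : C_c(G, ℂ), inner ℂ (ccFourier μ m u) (ccFourier μ m v) =
        (c : ℂ) * inner ℂ (ccToL2 μ u) (ccToL2 μ v))
    {U : PontryaginDual G → ℂ} (hU1 : Integrable U m) (hU2 : MemLp U 2 m) :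
    MemLp (fun x => (c : ℂ)⁻¹ * invFourierInt m U x) 2 μ ∧ ∃ u : ℕ → C_c(G, ℂ),
      Tendsto (fun n => eLpNorm ((u n : G → ℂ) - fun x => (c : ℂ)⁻¹ * invFourierInt m U x) 2 μ)
        atTop (𝓝 0) ∧
      Tendsto (fun n => eLpNorm (fourierInt μ (u n) - U) 2 m) atTop (𝓝 0) := by
  have hcont := continuous_invFourierInt hU1
  have hin : ∀ v : C_c(G, ℂ), inner ℂ (ccFourier μ m v) (hU2.toLp U) =
      ∫ x, starRingEnd ℂ (v x) * invFourierInt m U x ∂μ := fun v =>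
    (inner_toLp (memLp_fourierInt v) hU2).trans (integral_conj_fourierInt_mul v.integrable hU1)
  have hmem : MemLp (invFourierInt m U) 2 μ := by
    refine (memLp_two_iff_integrable_sq_norm hcont.measurable.aestronglyMeasurable).2 ?_
    refine (integrable_of_forall_cutoff (C := c * ‖hU2.toLp U‖ ^ 2) (by fun_prop)
      (fun _ => sq_nonneg _) fun k hk => ?_).1
    -- A duality bound: pairing `U` with the transform of `g = k * Ǔ` gives `I`, while that
    -- transform has squared norm at most `c * I`. Cauchy–Schwarz yields `I ^ 2 ≤ c * ‖U‖ ^ 2 * I`,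
    -- a bound free of `k`.
    set I := ∫ x, k x * ‖invFourierInt m U x‖ ^ 2 ∂μ
    let g : C_c(G, ℂ) := ⟨⟨fun x => complexCc k x * invFourierInt m U x, by fun_prop⟩,
      (complexCc k).hasCompactSupport.mul_right⟩
    have hgx : ∀ x, g x = (k x : ℂ) * invFourierInt m U x := fun _ => rfl
    have h1 : inner ℂ (ccFourier μ m g) (hU2.toLp U) = (I : ℂ) := by
      rw [hin, ← integral_complex_ofReal]
      congr 1
      ext x
      rw [hgx, map_mul, Complex.conj_ofReal, mul_assoc, Complex.conj_mul']
      push_cast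
      ring
    have hI0 : 0 ≤ I := integral_nonneg fun x => mul_nonneg (hk x).1 (sq_nonneg _)
    have h2 : ‖ccToL2 μ g‖ ^ 2 ≤ I := by
      refine (norm_toLp_sq (memLp_cc 2 g)).trans_le ?_
      refine integral_mono_of_nonneg (Eventually.of_forall fun x => sq_nonneg _) ?_
        (Eventually.of_forall fun x => ?_)
      · exact ((k.continuous.mul (hcont.norm.pow 2))).integrable_of_hasCompactSupport
          k.hasCompactSupport.mul_right
      · simp only [hgx, norm_mul, mul_pow, Complex.norm_real, Real.norm_of_nonneg (hk x).1]
        refine mul_le_mul_of_nonneg_right ?_ (sq_nonneg _)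
        nlinarith [(hk x).1, (hk x).2]
    have h3 : I ≤ ‖ccFourier μ m g‖ * ‖hU2.toLp U‖ := by
      have := norm_inner_le_norm (𝕜 := ℂ) (ccFourier μ m g) (hU2.toLp U)
      rwa [h1, Complex.norm_real, Real.norm_of_nonneg hI0] at this
    have h4 : I * I ≤ (c * ‖hU2.toLp U‖ ^ 2) * I := by
      calc I * I ≤ (‖ccFourier μ m g‖ * ‖hU2.toLp U‖) * (‖ccFourier μ m g‖ * ‖hU2.toLp U‖) :=
            mul_self_le_mul_self hI0 h3
        _ = ‖ccFourier μ m g‖ ^ 2 * ‖hU2.toLp U‖ ^ 2 := by ring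
        _ = (c * ‖ccToL2 μ g‖ ^ 2) * ‖hU2.toLp U‖ ^ 2 := by rw [hnorm]
        _ ≤ (c * I) * ‖hU2.toLp U‖ ^ 2 := by gcongr
        _ = _ := by ring
    rcases hI0.eq_or_lt with h0 | h0
    · rw [← h0]; positivity
    · exact le_of_mul_le_mul_right h4 h0
  have hmem' : MemLp (fun x => (c : ℂ)⁻¹ * invFourierInt m U x) 2 μ := hmem.const_mul _
  refine ⟨hmem', ?_⟩
  -- Approximate `U` by transforms of some `u n`. The transform is an isometry up to `√c`, so the `u
  -- n` converge in `L²`; pairing with every `v` identifies the limit.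
  obtain ⟨w, hw, hlim⟩ := mem_closure_iff_seq_limit.1 (denseRange_ccFourier (μ := μ) (hU2.toLp U))
  choose u hu using hw
  have hlim' : Tendsto (fun n => ccFourier μ m (u n)) atTop (𝓝 (hU2.toLp U)) := by
    simpa only [hu] using hlim
  have hdist : ∀ a b : C_c(G, ℂ), dist (ccToL2 μ a) (ccToL2 μ b) =
      (Real.sqrt c)⁻¹ * dist (ccFourier μ m a) (ccFourier μ m b) := by
    intro a b
    rw [dist_eq_norm, dist_eq_norm, ← map_sub, ← map_sub,
      ← Real.sqrt_sq (norm_nonneg (ccFourier μ m (a - b))), hnorm,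
      Real.sqrt_mul hc.le, Real.sqrt_sq (norm_nonneg _), inv_mul_cancel_left₀]
    exact (Real.sqrt_pos.2 hc).ne'
  have hcauchy : CauchySeq fun n => ccToL2 μ (u n) := by
    refine Metric.cauchySeq_iff'.2 fun ε hε => ?_
    obtain ⟨N, hN⟩ := Metric.cauchySeq_iff'.1 hlim'.cauchySeq (Real.sqrt c * ε)
      (mul_pos (Real.sqrt_pos.2 hc) hε)
    refine ⟨N, fun n hn => ?_⟩
    rw [hdist, inv_mul_lt_iff₀ (Real.sqrt_pos.2 hc)]
    exact hN n hn
  obtain ⟨h, hh⟩ := cauchySeq_tendsto_of_complete hcauchy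
  have heq : h = hmem'.toLp _ := by
    rw [← sub_eq_zero]
    refine eq_zero_of_inner_ccToL2 fun v => ?_
    have t1 : Tendsto (fun n => inner ℂ (ccFourier μ m v) (ccFourier μ m (u n))) atTop
        (𝓝 (inner ℂ (ccFourier μ m v) (hU2.toLp U))) := tendsto_const_nhds.inner hlim'
    have t2 : Tendsto (fun n => (c : ℂ) * inner ℂ (ccToL2 μ v) (ccToL2 μ (u n))) atTop
        (𝓝 ((c : ℂ) * inner ℂ (ccToL2 μ v) h)) := (tendsto_const_nhds.inner hh).const_mul _
    have e1 := tendsto_nhds_unique t2 (t1.congr fun n => hinner v (u n))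
    have e2 : inner ℂ (ccToL2 μ v) (hmem'.toLp _) =
        (c : ℂ)⁻¹ * inner ℂ (ccFourier μ m v) (hU2.toLp U) := by
      refine (inner_toLp (memLp_cc 2 v) hmem').trans ?_
      rw [hin, ← integral_const_mul]
      congr 1
      ext x
      ring
    have hc' : (c : ℂ) ≠ 0 := by exact_mod_cast hc.ne'
    rw [inner_sub_right, e2, ← e1, inv_mul_cancel_left₀ hc', sub_self]
  refine ⟨u, ?_, ?_⟩
  · rw [heq] at hh
    exact (Lp.tendsto_Lp_iff_tendsto_eLpNorm'' (fun n => (u n : G → ℂ))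
      (fun n => memLp_cc 2 (u n)) _ hmem').1 hh
  · exact (Lp.tendsto_Lp_iff_tendsto_eLpNorm'' (fun n => fourierInt μ (u n))
      (fun n => memLp_fourierInt (u n)) _ hU2).1 hlim'

end Inversion

/-! ### Convolutions as test functions -/

section Convolution

variable {G : Type*} [CommGroup G] [TopologicalSpace G] [IsTopologicalGroup G]
  [LocallyCompactSpace G] [T2Space G] [MeasurableSpace G] [BorelSpace G]
  {μ : Measure G} [μ.IsHaarMeasure] [μ.Regular]

theorem hasCompactSupport_convolution_kernel (u v : C_c(G, ℂ)) {f : G → G → ℂ} :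
    HasCompactSupport fun p : G × G => u p.1 * v (p.1⁻¹ * p.2) * f p.1 p.2 := by
  refine HasCompactSupport.intro (K := tsupport u ×ˢ (tsupport u * tsupport v))
    (u.hasCompactSupport.isCompact.prod
      (u.hasCompactSupport.isCompact.mul v.hasCompactSupport.isCompact)) ?_
  rintro ⟨y, x⟩ hx
  by_cases hy : y ∈ tsupport u
  · have : v (y⁻¹ * x) = 0 := image_eq_zero_of_notMem_tsupport fun h' =>
      hx ⟨hy, y, hy, y⁻¹ * x, h', by simp⟩
    simp [this]
  · simp [image_eq_zero_of_notMem_tsupport hy]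

/-- The convolution of two continuous compactly supported functions. -/
noncomputable def convCc (μ : Measure G) [μ.IsHaarMeasure] (u v : C_c(G, ℂ)) : C_c(G, ℂ) :=
  ⟨⟨fun x => ∫ y, u y * v (y⁻¹ * x) ∂μ, by
    rw [← continuousOn_univ]
    refine continuousOn_integral_of_compact_support u.hasCompactSupport ?_ ?_
    · refine Continuous.continuousOn ?_
      change Continuous fun p : G × G => u p.2 * v (p.2⁻¹ * p.1)
      fun_prop
    · intro x y _ hy
      rw [image_eq_zero_of_notMem_tsupport hy, zero_mul]⟩, by
    refine HasCompactSupport.intro (K := tsupport u * tsupport v)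
      (u.hasCompactSupport.isCompact.mul v.hasCompactSupport.isCompact) fun x hx => ?_
    refine integral_eq_zero_of_ae (Eventually.of_forall fun y => ?_)
    by_cases hy : y ∈ tsupport u
    · have : v (y⁻¹ * x) = 0 := image_eq_zero_of_notMem_tsupport fun h' =>
        hx ⟨y, hy, y⁻¹ * x, h', by simp⟩
      simp [this]
    · simp [image_eq_zero_of_notMem_tsupport hy]⟩

theorem convCc_apply (u v : C_c(G, ℂ)) (x : G) :
    convCc μ u v x = ∫ y, u y * v (y⁻¹ * x) ∂μ := rfl

theorem integral_convCc_mul (u v : C_c(G, ℂ)) {D : G → ℂ} (hD : Continuous D) :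
    ∫ x, convCc μ u v x * D x ∂μ = ∫ y, u y * ∫ x, v x * D (y * x) ∂μ ∂μ := by
  simp only [convCc_apply, ← integral_mul_const]
  rw [← integral_integral_swap_of_hasCompactSupport (f := fun y x => u y * v (y⁻¹ * x) * D x)]
  · congr 1
    ext y
    rw [← integral_const_mul, ← integral_mul_left_eq_self _ y]
    congr 1
    ext x
    rw [inv_mul_cancel_left, mul_assoc]
  · change Continuous fun p : G × G => u p.1 * v (p.1⁻¹ * p.2) * D p.2
    fun_prop
  · exact hasCompactSupport_convolution_kernel u v (f := fun _ x => D x)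

theorem fourierInt_convCc (u v : C_c(G, ℂ)) (ξ : PontryaginDual G) :
    fourierInt μ (convCc μ u v) ξ = fourierInt μ u ξ * fourierInt μ v ξ := by
  refine (integral_convCc_mul u v
    (Complex.continuous_conj.comp (continuous_coe_dual ξ))).trans ?_
  rw [fourierInt, ← integral_mul_const]
  congr 1
  ext y
  rw [fourierInt, mul_assoc, ← integral_const_mul (starRingEnd ℂ ((ξ y : Circle) : ℂ))]
  congr 2
  ext x
  rw [Function.comp_apply, coe_dual_mul, map_mul (starRingEnd ℂ)]
  ring

/-- A continuous function orthogonal to all convolutions is zero. -/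
theorem eq_zero_of_integral_conj_convCc_mul {D : G → ℂ} (hD : Continuous D)
    (h : ∀ u v : C_c(G, ℂ), ∫ x, starRingEnd ℂ (convCc μ u v x) * D x ∂μ = 0) (x : G) :
    D x = 0 := by
  have hconj : ∀ u v : C_c(G, ℂ), ∫ x, convCc μ u v x * starRingEnd ℂ (D x) ∂μ = 0 := by
    intro u v
    have := congrArg (starRingEnd ℂ) (h u v)
    rw [← integral_conj, map_zero] at this
    simpa only [map_mul, Complex.conj_conj] using this
  have hD' : Continuous fun x => starRingEnd ℂ (D x) := Complex.continuous_conj.comp hD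
  -- The test-function argument is used twice: in the variable of `u` with `v` fixed, then for `v`
  -- with the translation set to `1`.
  have h1 : ∀ (v : C_c(G, ℂ)) (y : G), ∫ x, v x * starRingEnd ℂ (D (y * x)) ∂μ = 0 := by
    intro v y
    have hE : Continuous fun y => ∫ x, v x * starRingEnd ℂ (D (y * x)) ∂μ := by
      rw [← continuousOn_univ]
      refine continuousOn_integral_of_compact_support v.hasCompactSupport ?_ ?_
      · refine Continuous.continuousOn ?_
        change Continuous fun p : G × G => v p.2 * starRingEnd ℂ (D (p.1 * p.2))
        fun_prop
      · intro x y _ hy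
        rw [image_eq_zero_of_notMem_tsupport hy, zero_mul]
    have := eq_zero_of_integral_conj_cc_mul (m := μ)
      (D := fun y => starRingEnd ℂ (∫ x, v x * starRingEnd ℂ (D (y * x)) ∂μ))
      (Complex.continuous_conj.comp hE) (fun u => by
        have h2 := hconj u v
        rw [integral_convCc_mul u v hD'] at h2
        have h3 := congrArg (starRingEnd ℂ) h2
        rw [← integral_conj, map_zero] at h3
        simpa only [map_mul] using h3) y
    simpa using this
  refine eq_zero_of_integral_conj_cc_mul (m := μ) hD (fun v => ?_) x
  have := congrArg (starRingEnd ℂ) (h1 v 1)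
  rw [← integral_conj, map_zero] at this
  simpa only [map_mul, Complex.conj_conj, one_mul] using this

end Convolution

/-! ### The inversion formula -/

section InversionFormula

variable {G : Type*} [CommGroup G] [TopologicalSpace G] [IsTopologicalGroup G]
  [LocallyCompactSpace G] [T2Space G] [MeasurableSpace G] [BorelSpace G]
  {μ : Measure G} [μ.IsHaarMeasure] [μ.Regular]
  [MeasurableSpace (PontryaginDual G)] [BorelSpace (PontryaginDual G)]
  {m : Measure (PontryaginDual G)} [m.IsHaarMeasure] [m.Regular]

theorem integrable_fourierInt_convCc (u v : C_c(G, ℂ)) :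
    Integrable (fourierInt μ (convCc μ u v)) m := by
  have : fourierInt μ (convCc μ u v) = fun ξ => fourierInt μ u ξ * fourierInt μ v ξ := by
    ext ξ
    exact fourierInt_convCc u v ξ
  rw [this]
  exact MemLp.integrable_mul (memLp_fourierInt u) (memLp_fourierInt v)

/-- The inversion formula for convolutions. -/
theorem invFourierInt_fourierInt_convCc {c : ℝ}
    (hinner : ∀ u v : C_c(G, ℂ), inner ℂ (ccFourier μ m u) (ccFourier μ m v) =
        (c : ℂ) * inner ℂ (ccToL2 μ u) (ccToL2 μ v)) (u v : C_c(G, ℂ)) (x : G) :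
    invFourierInt m (fourierInt μ (convCc μ u v)) x = (c : ℂ) * convCc μ u v x := by
  -- Chosen so that the inner product of `w` with `u` is the convolution at `x`, while the conjugate
  -- of `ŵ` is `ξ x` times `v̂`; polarized Plancherel for `w` and `u` is then inversion at `x`.
  let w : C_c(G, ℂ) := ⟨⟨fun y => starRingEnd ℂ (v (y⁻¹ * x)), by fun_prop⟩, by
    have h1 : HasCompactSupport fun y => v (y⁻¹ * x) :=
      v.hasCompactSupport.comp_homeomorph ((Homeomorph.inv G).trans (Homeomorph.mulRight x))
    exact HasCompactSupport.comp_left (g := starRingEnd ℂ) h1 (map_zero _)⟩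
  have hw : ∀ y, w y = starRingEnd ℂ (v (y⁻¹ * x)) := fun _ => rfl
  have hwf : ∀ ξ, starRingEnd ℂ (fourierInt μ w ξ) =
      ((ξ x : Circle) : ℂ) * fourierInt μ v ξ := by
    intro ξ
    rw [fourierInt, ← integral_conj, fourierInt, ← integral_const_mul,
      ← integral_div_left_eq_self (fun y => ((ξ x : Circle) : ℂ) *
        (v y * starRingEnd ℂ ((ξ y : Circle) : ℂ))) μ x]
    congr 1
    ext y
    have e : ((ξ x : Circle) : ℂ) * starRingEnd ℂ ((ξ (x * y⁻¹) : Circle) : ℂ) =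
        ((ξ y : Circle) : ℂ) := by
      rw [coe_dual_mul, coe_dual_inv, map_mul (starRingEnd ℂ), Complex.conj_conj, ← mul_assoc,
        coe_dual_mul_conj, one_mul]
    rw [hw, map_mul, Complex.conj_conj, Complex.conj_conj, div_eq_mul_inv, mul_left_comm, e,
      mul_comm x]
  have h := hinner w u
  rw [show inner ℂ (ccFourier μ m w) (ccFourier μ m u) = _ from
      inner_toLp (memLp_fourierInt w) (memLp_fourierInt u),
    show inner ℂ (ccToL2 μ w) (ccToL2 μ u) = _ from inner_toLp (memLp_cc 2 w) (memLp_cc 2 u)] at h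
  rw [invFourierInt, convCc_apply]
  refine Eq.trans ?_ (h.trans ?_)
  · congr 1
    ext ξ
    rw [hwf, fourierInt_convCc]
    ring
  · congr 2
    ext y
    rw [hw, Complex.conj_conj, mul_comm]

/-- A continuous function whose `L²` Fourier transform is integrable is given by the inversion
formula. -/
theorem const_mul_eq_invFourierInt {c : ℝ}
    (hinner : ∀ u v : C_c(G, ℂ), inner ℂ (ccFourier μ m u) (ccFourier μ m v) =
        (c : ℂ) * inner ℂ (ccToL2 μ u) (ccToL2 μ v))
    {f : G → ℂ} (hfc : Continuous f) (hf : MemLp f 2 μ) {F : PontryaginDual G → ℂ}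
    (hF1 : Integrable F m) (hF2 : MemLp F 2 m) {φ : ℕ → G → ℂ} (hφ : ∀ n, Integrable (φ n) μ)
    (hφf : Tendsto (fun n => eLpNorm (φ n - f) 2 μ) atTop (𝓝 0))
    (hφF : Tendsto (fun n => eLpNorm (fourierInt μ (φ n) - F) 2 m) atTop (𝓝 0)) (x : G) :
    (c : ℂ) * f x = invFourierInt m F x := by
  have hcont := continuous_invFourierInt hF1
  suffices H : ∀ x, (c : ℂ) * f x - invFourierInt m F x = 0 from sub_eq_zero.1 (H x)
  refine eq_zero_of_integral_conj_convCc_mul (μ := μ)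
    ((continuous_const.mul hfc).sub hcont) fun u v => ?_
  set g := convCc μ u v
  have hg2 : MemLp g 2 μ := memLp_cc 2 g
  -- Parseval for a merely integrable `φ n`: the convolution `g` has an integrable transform, so
  -- Fubini and inversion for `g` suffice. Both sides then pass to the `L²` limit.
  have hpars : ∀ n, (c : ℂ) * ∫ x, starRingEnd ℂ (g x) * φ n x ∂μ =
      ∫ ξ, starRingEnd ℂ (fourierInt μ g ξ) * fourierInt μ (φ n) ξ ∂m := by
    intro n
    have h1 := integral_conj_fourierInt_mul (hφ n) (integrable_fourierInt_convCc (μ := μ) (m := m) u v)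
    simp only [invFourierInt_fourierInt_convCc hinner] at h1
    have h2 := congrArg (starRingEnd ℂ) h1
    rw [← integral_conj, ← integral_conj] at h2
    simp only [map_mul, Complex.conj_conj, Complex.conj_ofReal] at h2
    rw [← integral_const_mul]
    refine Eq.trans ?_ (h2.symm.trans ?_)
    · congr 1
      ext x
      ring
    · congr 1
      ext x
      ring
  have t1 := (tendsto_integral_conj_mul (fun n => (hφ n).aestronglyMeasurable) hf hg2 hφf).const_mul
    (c : ℂ)
  have t2 := tendsto_integral_conj_mul
    (fun n => (continuous_fourierInt (hφ n)).measurable.aestronglyMeasurable) hF2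
    (memLp_fourierInt (μ := μ) g) hφF
  have e := tendsto_nhds_unique t1 (t2.congr fun n => (hpars n).symm)
  rw [integral_conj_fourierInt_mul g.integrable hF1] at e
  have i1 : Integrable (fun x => starRingEnd ℂ (g x) * f x) μ := integrable_conj_mul hg2 hf
  have i2 : Integrable (fun x => starRingEnd ℂ (g x) * invFourierInt m F x) μ := by
    refine Continuous.integrable_of_hasCompactSupport (by fun_prop) ?_
    exact (HasCompactSupport.comp_left (g := starRingEnd ℂ) g.hasCompactSupport
      (map_zero _)).mul_right
  have e2 : ∀ x, starRingEnd ℂ (g x) * ((c : ℂ) * f x - invFourierInt m F x) =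
      (c : ℂ) * (starRingEnd ℂ (g x) * f x) - starRingEnd ℂ (g x) * invFourierInt m F x :=
    fun x => by ring
  simp only [e2]
  rw [integral_sub (i1.const_mul _) i2, integral_const_mul, e, sub_self]

end InversionFormula

/-! ### Haar measure of a product on tensors -/

section ProductHaar

variable {P A B : Type*} [CommGroup P] [TopologicalSpace P] [IsTopologicalGroup P]
  [LocallyCompactSpace P] [T2Space P] [MeasurableSpace P] [BorelSpace P]
  [CommGroup A] [TopologicalSpace A] [IsTopologicalGroup A]
  [LocallyCompactSpace A] [T2Space A] [MeasurableSpace A] [BorelSpace A]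
  [CommGroup B] [TopologicalSpace B] [IsTopologicalGroup B]
  [LocallyCompactSpace B] [T2Space B] [MeasurableSpace B] [BorelSpace B]
  {mP : Measure P} [mP.IsHaarMeasure] [mP.Regular]
  {mA : Measure A} [mA.IsHaarMeasure] [mA.Regular]
  {mB : Measure B} [mB.IsHaarMeasure] [mB.Regular]

theorem continuous_fst_equiv (e : P ≃ₜ* A × B) : Continuous fun χ => (e χ).1 :=
  continuous_fst.comp e.continuous

theorem continuous_snd_equiv (e : P ≃ₜ* A × B) : Continuous fun χ => (e χ).2 :=
  continuous_snd.comp e.continuous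

theorem isCompact_preimage_prod (e : P ≃ₜ* A × B) {K : Set A} {L : Set B} (hK : IsCompact K)
    (hL : IsCompact L) : IsCompact {χ | (e χ).1 ∈ K ∧ (e χ).2 ∈ L} := by
  have h := (hK.prod hL).image e.symm.continuous
  convert! h using 1
  ext χ
  constructor
  · rintro ⟨h1, h2⟩
    exact ⟨e χ, ⟨h1, h2⟩, e.symm_apply_apply χ⟩
  · rintro ⟨z, ⟨h1, h2⟩, rfl⟩
    change (e (e.symm z)).1 ∈ K ∧ (e (e.symm z)).2 ∈ L
    rw [e.apply_symm_apply]
    exact ⟨h1, h2⟩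

/-- Uniqueness of Haar measure in the first coordinate: a double integral over `a` and `χ` factors
by translating `χ` by `(a, 1)`, and the substitution `a ↦ (e χ).1 / a` exchanges `u` and `u₀` in it.
-/
theorem integral_tensor_mul_integral (e : P ≃ₜ* A × B) (u u₀ : C_c(A, ℝ)) (v : C_c(B, ℝ)) :
    (∫ χ, u (e χ).1 * v (e χ).2 ∂mP) * ∫ a, u₀ a ∂mA =
      (∫ a, u a ∂mA) * ∫ χ, u₀ (e χ).1 * v (e χ).2 ∂mP := by
  have he1 := continuous_fst_equiv e
  have he2 := continuous_snd_equiv e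
  have hu := u.continuous
  have hu₀ := u₀.continuous
  have hv := v.continuous
  have htr : ∀ (w : C_c(A, ℝ)) (a : A), ∫ χ, w (a⁻¹ * (e χ).1) * v (e χ).2 ∂mP =
      ∫ χ, w (e χ).1 * v (e χ).2 ∂mP := by
    intro w a
    rw [← integral_mul_left_eq_self (fun χ => w (e χ).1 * v (e χ).2) (e.symm (a⁻¹, 1))]
    congr 1
    ext χ
    simp
  have hcs : ∀ w w' : C_c(A, ℝ), HasCompactSupport (Function.uncurry fun (a : A) (χ : P) =>
      w a * (w' (a⁻¹ * (e χ).1) * v (e χ).2)) := by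
    intro w w'
    refine HasCompactSupport.intro (K := tsupport w ×ˢ
      {χ | (e χ).1 ∈ tsupport w * tsupport w' ∧ (e χ).2 ∈ tsupport v})
      (w.hasCompactSupport.isCompact.prod (isCompact_preimage_prod e
        (w.hasCompactSupport.isCompact.mul w'.hasCompactSupport.isCompact)
        v.hasCompactSupport)) ?_
    rintro ⟨a, χ⟩ hx
    change w a * (w' (a⁻¹ * (e χ).1) * v (e χ).2) = 0
    by_cases ha : a ∈ tsupport w
    · by_cases hχ : (e χ).2 ∈ tsupport v
      · have : w' (a⁻¹ * (e χ).1) = 0 := image_eq_zero_of_notMem_tsupport fun h' =>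
          hx ⟨ha, ⟨a, ha, _, h', by simp⟩, hχ⟩
        simp [this]
      · simp [image_eq_zero_of_notMem_tsupport hχ]
    · simp [image_eq_zero_of_notMem_tsupport ha]
  have hct : ∀ w w' : C_c(A, ℝ), Continuous (Function.uncurry fun (a : A) (χ : P) =>
      w a * (w' (a⁻¹ * (e χ).1) * v (e χ).2)) := by
    intro w w'
    have hw := w.continuous
    have hw' := w'.continuous
    change Continuous fun q : A × P => w q.1 * (w' (q.1⁻¹ * (e q.2).1) * v (e q.2).2)
    fun_prop
  have h : ∀ w w' : C_c(A, ℝ), (∫ χ, w' (e χ).1 * v (e χ).2 ∂mP) * ∫ a, w a ∂mA =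
      ∫ χ, ∫ a, w a * (w' (a⁻¹ * (e χ).1) * v (e χ).2) ∂mA ∂mP := by
    intro w w'
    rw [← integral_integral_swap_of_hasCompactSupport (hct w w') (hcs w w'), mul_comm,
      ← integral_mul_const]
    congr 1
    ext a
    rw [integral_const_mul, htr]
  rw [h u₀ u, mul_comm (∫ a, u a ∂mA), h u u₀]
  congr 1
  ext χ
  rw [← integral_div_left_eq_self (fun a => u₀ a * (u (a⁻¹ * (e χ).1) * v (e χ).2)) mA (e χ).1]
  congr 1
  ext a
  rw [div_eq_mul_inv, mul_inv, inv_inv, mul_comm (e χ).1⁻¹ a, inv_mul_cancel_right,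
    mul_comm (e χ).1 a⁻¹]
  ring

theorem exists_cc_integral_pos (m : Measure A) [m.IsHaarMeasure] [m.Regular] :
    ∃ k : C_c(A, ℝ), (∀ z, 0 ≤ k z) ∧ 0 < ∫ z, k z ∂m := by
  obtain ⟨k, hk01, hk1⟩ := exists_cutoff (isCompact_singleton (x := (1 : A)))
  refine ⟨k, fun z => (hk01 z).1, k.continuous.integral_pos_of_hasCompactSupport_nonneg_nonzero
    k.hasCompactSupport (fun z => (hk01 z).1) (x := 1) ?_⟩
  rw [show k 1 = 1 from hk1 1 rfl]
  exact one_ne_zero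

theorem exists_const_integral_tensor (mP : Measure P) [mP.IsHaarMeasure] [mP.Regular]
    (mA : Measure A) [mA.IsHaarMeasure] [mA.Regular]
    (mB : Measure B) [mB.IsHaarMeasure] [mB.Regular] (e : P ≃ₜ* A × B) :
    ∃ C : ℝ, 0 ≤ C ∧ ∀ (u : C_c(A, ℝ)) (v : C_c(B, ℝ)),
      ∫ χ, u (e χ).1 * v (e χ).2 ∂mP = C * ((∫ a, u a ∂mA) * ∫ b, v b ∂mB) := by
  obtain ⟨u₀, hu₀, hu₀'⟩ := exists_cc_integral_pos mA
  obtain ⟨v₀, hv₀, hv₀'⟩ := exists_cc_integral_pos mB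
  refine ⟨(∫ χ, u₀ (e χ).1 * v₀ (e χ).2 ∂mP) / ((∫ a, u₀ a ∂mA) * ∫ b, v₀ b ∂mB),
    div_nonneg (integral_nonneg fun χ => mul_nonneg (hu₀ _) (hv₀ _)) (by positivity),
    fun u v => ?_⟩
  have h1 := integral_tensor_mul_integral (mP := mP) (mA := mA) e u u₀ v
  let e' : P ≃ₜ* B × A :=
    { e.toMulEquiv.trans MulEquiv.prodComm with
      continuous_toFun := continuous_swap.comp e.continuous
      continuous_invFun := e.symm.continuous.comp continuous_swap }
  have he1 : ∀ χ, (e' χ).1 = (e χ).2 := fun _ => rfl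
  have he2 : ∀ χ, (e' χ).2 = (e χ).1 := fun _ => rfl
  have h2 := integral_tensor_mul_integral (mP := mP) (mA := mB) e' v v₀ u₀
  simp only [he1, he2, mul_comm (v _) (u₀ _), mul_comm (v₀ _) (u₀ _)] at h2
  field_simp
  linear_combination (∫ b, v₀ b ∂mB) * h1 + (∫ a, u a ∂mA) * h2

end ProductHaar

/-! ### Haar measure of rectangles -/

section ProductHaarMeasure

theorem exists_cutoff_of_subset_isOpen {Y : Type*} [TopologicalSpace Y] [R1Space Y]
    [LocallyCompactSpace Y] [MeasurableSpace Y] [BorelSpace Y] (m : Measure Y)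
    [IsFiniteMeasureOnCompacts m] {K O : Set Y}
    (hK : IsCompact K) (hO : IsOpen O) (hKO : K ⊆ O) (hmO : m O ≠ ∞) :
    ∃ k : C_c(Y, ℝ), (∀ y, 0 ≤ k y) ∧ (∀ y ∈ K, k y = 1) ∧ 0 ≤ ∫ y, k y ∂m ∧
      ∫ y, k y ∂m ≤ m.real O := by
  obtain ⟨f, h1, h2, h3, h4⟩ := exists_continuousMap_one_of_isCompact_subset_isOpen hK hO hKO
  refine ⟨⟨f, h2⟩, fun y => (h4 y).1, fun y hy => h1 hy,
    integral_nonneg fun y => (h4 y).1, ?_⟩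
  change ∫ y, f y ∂m ≤ _
  rw [← integral_indicator_one hO.measurableSet]
  refine integral_mono (f.continuous.integrable_of_hasCompactSupport h2)
    ((integrable_indicator_iff hO.measurableSet).2 (by
      simpa [Pi.one_def, integrableOn_const_iff] using hmO.lt_top)) fun y => ?_
  by_cases hy : y ∈ O
  · rw [Set.indicator_of_mem hy]
    exact (h4 y).2
  · rw [Set.indicator_of_notMem hy,
      image_eq_zero_of_notMem_tsupport fun h => hy (h3 h)]

variable {P A B : Type*} [CommGroup P] [TopologicalSpace P] [IsTopologicalGroup P]
  [LocallyCompactSpace P] [T2Space P] [MeasurableSpace P] [BorelSpace P]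
  [CommGroup A] [TopologicalSpace A] [IsTopologicalGroup A]
  [LocallyCompactSpace A] [T2Space A] [MeasurableSpace A] [BorelSpace A]
  [CommGroup B] [TopologicalSpace B] [IsTopologicalGroup B]
  [LocallyCompactSpace B] [T2Space B] [MeasurableSpace B] [BorelSpace B]
  {mP : Measure P} [mP.IsHaarMeasure] [mP.Regular]
  {mA : Measure A} [mA.IsHaarMeasure] [mA.Regular]
  {mB : Measure B} [mB.IsHaarMeasure] [mB.Regular]

/-- A compact subset of the open rectangle is dominated by a tensor of cutoffs, equal to one on its
two projections and supported in `O` and `V`. -/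
theorem measure_isOpen_prod_le (e : P ≃ₜ* A × B) {C : ℝ} (hC0 : 0 ≤ C)
    (hC : ∀ (u : C_c(A, ℝ)) (v : C_c(B, ℝ)),
      ∫ χ, u (e χ).1 * v (e χ).2 ∂mP = C * ((∫ a, u a ∂mA) * ∫ b, v b ∂mB))
    {O : Set A} {V : Set B} (hO : IsOpen O) (hV : IsOpen V) (hmO : mA O ≠ ∞) (hmV : mB V ≠ ∞) :
    mP {χ | (e χ).1 ∈ O ∧ (e χ).2 ∈ V} ≤ ENNReal.ofReal C * (mA O * mB V) := by
  have hopen : IsOpen {χ | (e χ).1 ∈ O ∧ (e χ).2 ∈ V} :=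
    (hO.preimage (continuous_fst_equiv e)).inter (hV.preimage (continuous_snd_equiv e))
  rw [hopen.measure_eq_iSup_isCompact]
  refine iSup₂_le fun L hL => iSup_le fun hLc => ?_
  obtain ⟨u, hu0, hu1, hui0, hui⟩ := exists_cutoff_of_subset_isOpen mA
    (hLc.image (continuous_fst_equiv e)) hO (by rintro _ ⟨χ, hχ, rfl⟩; exact (hL hχ).1) hmO
  obtain ⟨v, hv0, hv1, hvi0, hvi⟩ := exists_cutoff_of_subset_isOpen mB
    (hLc.image (continuous_snd_equiv e)) hV (by rintro _ ⟨χ, hχ, rfl⟩; exact (hL hχ).2) hmV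
  have hcont : Continuous fun χ => u (e χ).1 * v (e χ).2 := by
    have h1 := continuous_fst_equiv e
    have h2 := continuous_snd_equiv e
    have := u.continuous
    have := v.continuous
    fun_prop
  have hcs : HasCompactSupport fun χ => u (e χ).1 * v (e χ).2 := by
    refine HasCompactSupport.intro (isCompact_preimage_prod e u.hasCompactSupport
      v.hasCompactSupport) fun χ hχ => ?_
    by_cases h : (e χ).1 ∈ tsupport u
    · rw [image_eq_zero_of_notMem_tsupport fun h' => hχ ⟨h, h'⟩, mul_zero]
    · rw [image_eq_zero_of_notMem_tsupport h, zero_mul]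
  have hint := hcont.integrable_of_hasCompactSupport (μ := mP) hcs
  have hL1 : mP.real L ≤ ∫ χ, u (e χ).1 * v (e χ).2 ∂mP := by
    rw [← integral_indicator_one hLc.measurableSet]
    refine integral_mono ((integrable_indicator_iff hLc.measurableSet).2 (by
      simpa [Pi.one_def, integrableOn_const_iff] using hLc.measure_lt_top (μ := mP))) hint fun χ => ?_
    by_cases hχ : χ ∈ L
    · simp only [Set.indicator_of_mem hχ]
      rw [hu1 _ ⟨χ, hχ, rfl⟩, hv1 _ ⟨χ, hχ, rfl⟩]
      simp
    · simp only [Set.indicator_of_notMem hχ]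
      exact mul_nonneg (hu0 _) (hv0 _)
  rw [hC] at hL1
  have hL2 : mP.real L ≤ C * (mA.real O * mB.real V) :=
    hL1.trans (by gcongr)
  rw [← ENNReal.ofReal_toReal hLc.measure_lt_top.ne, ← ENNReal.ofReal_toReal hmO,
    ← ENNReal.ofReal_toReal hmV, ← ENNReal.ofReal_mul ENNReal.toReal_nonneg,
    ← ENNReal.ofReal_mul hC0]
  exact ENNReal.ofReal_le_ofReal hL2

theorem measure_prod_le (e : P ≃ₜ* A × B) {C : ℝ} (hC0 : 0 ≤ C)
    (hC : ∀ (u : C_c(A, ℝ)) (v : C_c(B, ℝ)),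
      ∫ χ, u (e χ).1 * v (e χ).2 ∂mP = C * ((∫ a, u a ∂mA) * ∫ b, v b ∂mB))
    {S : Set A} {T : Set B} (hS : mA S ≠ ∞) (hT : mB T ≠ ∞) :
    mP {χ | (e χ).1 ∈ S ∧ (e χ).2 ∈ T} ≤ ENNReal.ofReal C * (mA S * mB T) := by
  have hn : Tendsto (fun n : ℕ => ((n : ℝ≥0∞) + 1)⁻¹) atTop (𝓝 0) := by
    have := ENNReal.tendsto_inv_nat_nhds_zero.comp (tendsto_add_atTop_nat 1)
    simpa [Function.comp_def] using this
  have hlim : Tendsto (fun n : ℕ => ENNReal.ofReal C *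
      ((mA S + ((n : ℝ≥0∞) + 1)⁻¹) * (mB T + ((n : ℝ≥0∞) + 1)⁻¹))) atTop
      (𝓝 (ENNReal.ofReal C * ((mA S + 0) * (mB T + 0)))) := by
    refine ENNReal.Tendsto.const_mul ?_ (Or.inr ENNReal.ofReal_ne_top)
    exact ENNReal.Tendsto.mul (tendsto_const_nhds.add hn) (Or.inr (by simpa using hT))
      (tendsto_const_nhds.add hn) (Or.inr (by simpa using hS))
  rw [add_zero, add_zero] at hlim
  refine ge_of_tendsto hlim (Eventually.of_forall fun n => ?_)
  have hε : ((n : ℝ≥0∞) + 1)⁻¹ ≠ 0 := by simp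
  have hε' : ((n : ℝ≥0∞) + 1)⁻¹ ≠ ∞ := by simp
  obtain ⟨O, hSO, hO, hmO⟩ := S.exists_isOpen_le_add mA hε
  obtain ⟨V, hTV, hV, hmV⟩ := T.exists_isOpen_le_add mB hε
  calc mP {χ | (e χ).1 ∈ S ∧ (e χ).2 ∈ T} ≤ mP {χ | (e χ).1 ∈ O ∧ (e χ).2 ∈ V} :=
        measure_mono fun χ hχ => ⟨hSO hχ.1, hTV hχ.2⟩
    _ ≤ ENNReal.ofReal C * (mA O * mB V) := measure_isOpen_prod_le e hC0 hC hO hV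
        (ne_top_of_le_ne_top (ENNReal.add_ne_top.2 ⟨hS, hε'⟩) hmO)
        (ne_top_of_le_ne_top (ENNReal.add_ne_top.2 ⟨hT, hε'⟩) hmV)
    _ ≤ _ := by gcongr

/-- A substitute for Fubini: it makes composition with the first coordinate bounded from `L²` of the
factor to `L²` of the strip over `T`. -/
theorem exists_const_map_fst_le (mP : Measure P) [mP.IsHaarMeasure] [mP.Regular]
    (mA : Measure A) [mA.IsHaarMeasure] [mA.Regular]
    (mB : Measure B) [mB.IsHaarMeasure] [mB.Regular] (e : P ≃ₜ* A × B) {T : Set B}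
    (hT : mB T ≠ ∞) :
    ∃ D : ℝ≥0∞, D ≠ ∞ ∧ (mP.restrict {χ | (e χ).2 ∈ T}).map (fun χ => (e χ).1) ≤ D • mA := by
  obtain ⟨C, hC0, hC⟩ := exists_const_integral_tensor mP mA mB e
  -- The `+ 1` keeps the constant nonzero, so that the bound is infinite when `mA S` is.
  refine ⟨ENNReal.ofReal C * mB T + 1, ENNReal.add_ne_top.2
    ⟨ENNReal.mul_ne_top ENNReal.ofReal_ne_top hT, ENNReal.one_ne_top⟩,
    Measure.le_iff.2 fun S hS => ?_⟩
  have hm := (continuous_fst_equiv e).measurable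
  rw [Measure.map_apply hm hS, Measure.restrict_apply (hm hS), Measure.smul_apply, smul_eq_mul]
  by_cases hmS : mA S = ∞
  · rw [hmS, ENNReal.mul_top (by simp)]
    exact le_top
  · refine (measure_prod_le e hC0 hC hmS hT).trans ?_
    rw [mul_comm (mA S), ← mul_assoc]
    gcongr
    exact le_self_add

theorem measure_prod_ne_top (mP : Measure P) [mP.IsHaarMeasure] [mP.Regular]
    (mA : Measure A) [mA.IsHaarMeasure] [mA.Regular]
    (mB : Measure B) [mB.IsHaarMeasure] [mB.Regular] (e : P ≃ₜ* A × B) {S : Set A} {T : Set B}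
    (hS : mA S ≠ ∞) (hT : mB T ≠ ∞) : mP {χ | (e χ).1 ∈ S ∧ (e χ).2 ∈ T} ≠ ∞ := by
  obtain ⟨C, hC0, hC⟩ := exists_const_integral_tensor mP mA mB e
  exact ne_top_of_le_ne_top (ENNReal.mul_ne_top ENNReal.ofReal_ne_top (ENNReal.mul_ne_top hS hT))
    (measure_prod_le e hC0 hC hS hT)

end ProductHaarMeasure

/-! ### Integration along fibres by duality -/

section Pushforward

variable {P A : Type*} [MeasurableSpace P] [MeasurableSpace A] {ρ : Measure P} {m : Measure A}
  {p : P → A} {D : ℝ≥0∞}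

theorem eLpNorm_comp_le_of_map_le (hp : Measurable p) (h : ρ.map p ≤ D • m)
    {g : A → ℂ} (hg : MemLp g 2 m) :
    eLpNorm (g ∘ p) 2 ρ ≤ D ^ (1 / 2 : ℝ) * eLpNorm g 2 m := by
  have hac : ρ.map p ≪ m := (Measure.absolutelyContinuous_of_le h).trans
    Measure.smul_absolutelyContinuous
  rw [← eLpNorm_map_measure (hg.aestronglyMeasurable.mono_ac hac) hp.aemeasurable]
  refine (eLpNorm_mono_measure g h).trans ?_
  rw [eLpNorm_smul_measure_of_ne_top (by simp)]
  simp

theorem memLp_comp_of_map_le (hp : Measurable p) (hD : D ≠ ∞) (h : ρ.map p ≤ D • m)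
    {g : A → ℂ} (hg : MemLp g 2 m) : MemLp (g ∘ p) 2 ρ := by
  have hac : ρ.map p ≪ m := (Measure.absolutelyContinuous_of_le h).trans
    Measure.smul_absolutelyContinuous
  refine ⟨(hg.aestronglyMeasurable.mono_ac hac).comp_measurable hp,
    (eLpNorm_comp_le_of_map_le hp h hg).trans_lt
      (ENNReal.mul_lt_top (ENNReal.rpow_lt_top_of_nonneg (by norm_num) hD) hg.2)⟩

/-- Integrating a square integrable function along the fibres of a map. -/
theorem exists_memLp_integral_mul_comp (hp : Measurable p) (hD : D ≠ ∞) (h : ρ.map p ≤ D • m)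
    {w : P → ℂ} (hw : MemLp w 2 ρ) {S : Set A} (hS : MeasurableSet S) (hmS : m S ≠ ∞)
    (hwS : ∀ᵐ χ ∂ρ, p χ ∉ S → w χ = 0) :
    ∃ U : A → ℂ, MemLp U 2 m ∧ (∀ a ∉ S, U a = 0) ∧
      ∀ k : A → ℂ, AEStronglyMeasurable k m → (∀ a, ‖k a‖ ≤ 1) →
        ∫ a, U a * k a ∂m = ∫ χ, w χ * k (p χ) ∂ρ := by
  have hac : ρ.map p ≪ m := (Measure.absolutelyContinuous_of_le h).trans
    Measure.smul_absolutelyContinuous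
  have hcongr : ∀ {f g : A → ℂ}, f =ᵐ[m] g → f ∘ p =ᵐ[ρ] g ∘ p := fun hfg =>
    ae_of_ae_map hp.aemeasurable (hac.ae_le hfg)
  have hint : ∀ g : Lp ℂ 2 m, Integrable (fun χ => w χ * g (p χ)) ρ := fun g =>
    MemLp.integrable_mul hw (memLp_comp_of_map_le hp hD h (Lp.memLp g))
  let ℓ₀ : Lp ℂ 2 m →ₗ[ℂ] ℂ :=
    { toFun := fun g => ∫ χ, w χ * g (p χ) ∂ρ
      map_add' := fun f g => by
        rw [← integral_add (hint f) (hint g)]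
        refine integral_congr_ae ?_
        filter_upwards [hcongr (Lp.coeFn_add f g)] with χ hχ
        simp only [Function.comp_apply, Pi.add_apply] at hχ
        rw [hχ, mul_add]
      map_smul' := fun c g => by
        rw [RingHom.id_apply, smul_eq_mul, ← integral_const_mul]
        refine integral_congr_ae ?_
        filter_upwards [hcongr (Lp.coeFn_smul c g)] with χ hχ
        simp only [Function.comp_apply, Pi.smul_apply, smul_eq_mul] at hχ
        rw [hχ]
        ring }
  let ℓ : Lp ℂ 2 m →L[ℂ] ℂ := ℓ₀.mkContinuous
    ((eLpNorm w 2 ρ).toReal * (D ^ (1 / 2 : ℝ)).toReal) fun g => by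
      have h1 := norm_integral_conj_mul_le hw.star (memLp_comp_of_map_le hp hD h (Lp.memLp g))
      have h2 : (eLpNorm (g ∘ p) 2 ρ).toReal ≤ (D ^ (1 / 2 : ℝ)).toReal * ‖g‖ := by
        rw [Lp.norm_def, ← ENNReal.toReal_mul]
        exact ENNReal.toReal_mono (ENNReal.mul_ne_top
          (ENNReal.rpow_ne_top_of_nonneg (by norm_num) hD) (Lp.eLpNorm_ne_top g))
          (eLpNorm_comp_le_of_map_le hp h (Lp.memLp g))
      have h3 : eLpNorm (star w) 2 ρ = eLpNorm w 2 ρ :=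
        eLpNorm_congr_norm_ae (Eventually.of_forall fun χ => norm_star (w χ))
      rw [h3] at h1
      simp only [Pi.star_apply, Function.comp_apply, RCLike.star_def, Complex.conj_conj] at h1
      calc ‖ℓ₀ g‖ ≤ (eLpNorm w 2 ρ).toReal * (eLpNorm (g ∘ p) 2 ρ).toReal := h1
        _ ≤ (eLpNorm w 2 ρ).toReal * ((D ^ (1 / 2 : ℝ)).toReal * ‖g‖) := by gcongr
        _ = _ := by ring
  -- The fibre integral of `w` is the conjugate of the vector representing `ℓ`.
  let y := (InnerProductSpace.toDual ℂ (Lp ℂ 2 m)).symm ℓ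
  have hy : ∀ g : Lp ℂ 2 m, ∫ a, starRingEnd ℂ (y a) * g a ∂m = ∫ χ, w χ * g (p χ) ∂ρ := by
    intro g
    have h1 : inner ℂ y g = ℓ g := InnerProductSpace.toDual_symm_apply
    rw [L2.inner_def] at h1
    refine Eq.trans ?_ h1
    congr 1
    ext a
    rw [RCLike.inner_apply, mul_comm]
  -- Cutting off to `S` loses nothing as `w` vanishes off the preimage of `S`, and it puts the
  -- bounded function `k` into `L²` because `S` has finite measure.
  refine ⟨S.indicator fun a => starRingEnd ℂ (y a), ((Lp.memLp y).star).indicator hS,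
    fun a ha => Set.indicator_of_notMem ha _, fun k hk hk1 => ?_⟩
  have hkS : MemLp (S.indicator k) 2 m := by
    have h1 : MemLp (S.indicator fun _ => (1 : ℂ)) 2 m :=
      memLp_indicator_const 2 hS 1 (Or.inr hmS)
    refine h1.mono (hk.indicator hS) (Eventually.of_forall fun a => ?_)
    by_cases ha : a ∈ S
    · simpa [ha] using hk1 a
    · simp [ha]
  have h1 := hy (hkS.toLp _)
  have h2 : ∫ χ, w χ * hkS.toLp _ (p χ) ∂ρ = ∫ χ, w χ * k (p χ) ∂ρ := by
    refine integral_congr_ae ?_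
    filter_upwards [hcongr hkS.coeFn_toLp, hwS] with χ hχ hχ'
    simp only [Function.comp_apply] at hχ
    rw [hχ]
    by_cases hS' : p χ ∈ S
    · rw [Set.indicator_of_mem hS']
    · rw [hχ' hS', zero_mul, zero_mul]
  rw [← h2, ← h1]
  refine integral_congr_ae ?_
  filter_upwards [hkS.coeFn_toLp] with a ha
  rw [ha]
  by_cases hS' : a ∈ S
  · simp [hS']
  · simp [hS']

end Pushforward

/-! ### Partial Fourier integrals on a product -/

section Slice

variable {P A B : Type*} [CommGroup P] [TopologicalSpace P] [IsTopologicalGroup P]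
  [LocallyCompactSpace P] [T2Space P] [MeasurableSpace P] [BorelSpace P]
  [CommGroup A] [TopologicalSpace A] [IsTopologicalGroup A]
  [LocallyCompactSpace A] [T2Space A] [MeasurableSpace A] [BorelSpace A]
  [CommGroup B] [TopologicalSpace B] [IsTopologicalGroup B]
  [LocallyCompactSpace B] [T2Space B] [MeasurableSpace B] [BorelSpace B]
  {mP : Measure P} [mP.IsHaarMeasure] [mP.Regular]

/-- Formally `U` integrates `F` times `b` over the second variable. Restriction to the strip over
`T` gives the bounded pushforward, and costs nothing since `F` vanishes outside it. -/
theorem exists_memLp_integral_slice (mA : Measure A) [mA.IsHaarMeasure] [mA.Regular]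
    (mB : Measure B) [mB.IsHaarMeasure] [mB.Regular] (e : P ≃ₜ* A × B)
    {S : Set A} {T : Set B} (hS : MeasurableSet S) (hT : MeasurableSet T) (hmS : mA S ≠ ∞)
    (hmT : mB T ≠ ∞) {F : P → ℂ} (hF : MemLp F 2 mP)
    (hFS : ∀ᵐ χ ∂mP, ¬((e χ).1 ∈ S ∧ (e χ).2 ∈ T) → F χ = 0)
    {b : B → ℂ} (hb : Continuous b) (hb1 : ∀ η, ‖b η‖ ≤ 1) :
    ∃ U : A → ℂ, MemLp U 2 mA ∧ (∀ a ∉ S, U a = 0) ∧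
      ∀ k : A → ℂ, Continuous k → (∀ a, ‖k a‖ ≤ 1) →
        ∫ a, U a * k a ∂mA = ∫ χ, F χ * (k (e χ).1 * b (e χ).2) ∂mP := by
  obtain ⟨D, hD, hle⟩ := exists_const_map_fst_le mP mA mB e hmT
  have hTm : MeasurableSet {χ | (e χ).2 ∈ T} := (continuous_snd_equiv e).measurable hT
  have hbe : Continuous fun χ => b (e χ).2 := hb.comp (continuous_snd_equiv e)
  have hFb : MemLp (fun χ => F χ * b (e χ).2) 2 (mP.restrict {χ | (e χ).2 ∈ T}) := by
    refine (hF.restrict _).mono (((hF.restrict _).aestronglyMeasurable).mul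
      hbe.measurable.aestronglyMeasurable) (Eventually.of_forall fun χ => ?_)
    rw [norm_mul]
    exact mul_le_of_le_one_right (norm_nonneg _) (hb1 _)
  obtain ⟨U, hU, hUS, hUk⟩ := exists_memLp_integral_mul_comp
    (continuous_fst_equiv e).measurable hD hle hFb hS hmS (by
      filter_upwards [ae_restrict_of_ae hFS] with χ hχ hS'
      rw [hχ fun h => hS' h.1, zero_mul])
  refine ⟨U, hU, hUS, fun k hk hk1 => ?_⟩
  rw [hUk k hk.measurable.aestronglyMeasurable hk1]
  rw [setIntegral_eq_integral_of_ae_compl_eq_zero]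
  · congr 1
    ext χ
    ring
  · filter_upwards [hFS] with χ hχ hT'
    rw [hχ fun h => hT' h.2, zero_mul, zero_mul]

end Slice

/-! ### The dual of a product -/

section DualOfProduct

variable {G₁ G₂ : Type*} [CommGroup G₁] [TopologicalSpace G₁] [IsTopologicalGroup G₁]
  [CommGroup G₂] [TopologicalSpace G₂] [IsTopologicalGroup G₂]

theorem apply_mk_eq_mul (χ : PontryaginDual (G₁ × G₂)) (x : G₁) (y : G₂) :
    χ (x, y) = PontryaginDual.map (ContinuousMonoidHom.inl G₁ G₂) χ x *
      PontryaginDual.map (ContinuousMonoidHom.inr G₁ G₂) χ y := by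
  rw [PontryaginDual.map_apply, PontryaginDual.map_apply, ← map_mul]
  congr 1
  exact Prod.ext (mul_one x).symm (one_mul y).symm

/-- The dual of a product is the product of the duals. -/
noncomputable def dualProdEquiv (G₁ G₂ : Type*) [CommGroup G₁] [TopologicalSpace G₁]
    [IsTopologicalGroup G₁] [CommGroup G₂] [TopologicalSpace G₂] [IsTopologicalGroup G₂] :
    PontryaginDual (G₁ × G₂) ≃ₜ* PontryaginDual G₁ × PontryaginDual G₂ where
  toFun χ := (PontryaginDual.map (ContinuousMonoidHom.inl G₁ G₂) χ,
    PontryaginDual.map (ContinuousMonoidHom.inr G₁ G₂) χ)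
  invFun ξ := PontryaginDual.map (ContinuousMonoidHom.fst G₁ G₂) ξ.1 *
    PontryaginDual.map (ContinuousMonoidHom.snd G₁ G₂) ξ.2
  left_inv χ := by
    ext1 z
    exact (apply_mk_eq_mul χ z.1 z.2).symm
  right_inv ξ := by
    refine Prod.ext (PontryaginDual.ext fun x => ?_) (PontryaginDual.ext fun y => ?_)
    · change ξ.1 x * ξ.2 1 = ξ.1 x
      rw [map_one, mul_one]
    · change ξ.1 1 * ξ.2 y = ξ.2 y
      rw [map_one, one_mul]
  map_mul' χ ψ := by
    rw [map_mul, map_mul]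
    rfl
  continuous_toFun := (map_continuous _).prodMk (map_continuous _)
  continuous_invFun := ((map_continuous _).comp continuous_fst).mul
    ((map_continuous _).comp continuous_snd)

/-- The dual of a product is the product of the duals, in the reverse order. -/
noncomputable def dualProdEquivSwap (G₁ G₂ : Type*) [CommGroup G₁] [TopologicalSpace G₁]
    [IsTopologicalGroup G₁] [CommGroup G₂] [TopologicalSpace G₂] [IsTopologicalGroup G₂] :
    PontryaginDual (G₁ × G₂) ≃ₜ* PontryaginDual G₂ × PontryaginDual G₁ :=
  { (dualProdEquiv G₁ G₂).toMulEquiv.trans MulEquiv.prodComm with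
    continuous_toFun := continuous_swap.comp (dualProdEquiv G₁ G₂).continuous
    continuous_invFun := (dualProdEquiv G₁ G₂).symm.continuous.comp continuous_swap }

end DualOfProduct

/-! ### Paley–Wiener functions as inverse Fourier integrals -/

section PaleyWiener

theorem isHaarMeasure_haarBorel (G : Type*) [Group G] [TopologicalSpace G] [IsTopologicalGroup G]
    [LocallyCompactSpace G] : letI : MeasurableSpace G := borel G
    (haarBorel G).IsHaarMeasure := by
  let _ : MeasurableSpace G := borel G
  have : BorelSpace G := ⟨rfl⟩
  exact inferInstanceAs (Measure.IsHaarMeasure (Measure.haar : Measure G))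

theorem regular_haarBorel (G : Type*) [Group G] [TopologicalSpace G] [IsTopologicalGroup G]
    [LocallyCompactSpace G] : letI : MeasurableSpace G := borel G
    (haarBorel G).Regular := by
  let _ : MeasurableSpace G := borel G
  have : BorelSpace G := ⟨rfl⟩
  exact inferInstanceAs (Measure.Regular (Measure.haar : Measure G))

theorem integrable_of_memLp_two_of_support {Y : Type*} [MeasurableSpace Y] {m : Measure Y}
    {F : Y → ℂ} (hF : MemLp F 2 m) {S : Set Y} (hS : m S ≠ ∞) (hFS : ∀ y ∉ S, F y = 0) :
    Integrable F m := by
  have : Fact (m S < ∞) := ⟨hS.lt_top⟩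
  have h1 : Integrable F (m.restrict S) := (hF.restrict S).integrable (by norm_num)
  exact IntegrableOn.integrable_of_forall_notMem_eq_zero h1 hFS

variable {G : Type*} [CommGroup G] [TopologicalSpace G] [IsTopologicalGroup G]
  [LocallyCompactSpace G] [T2Space G]

/-- Inverse Fourier integrals of functions supported on `Ω` belong to the Paley-Wiener space. -/
theorem invFourierInt_mem_paleyWienerCont {Ω : Set (PontryaginDual G)}
    (hfin : haarBorel (PontryaginDual G) Ω < ∞) :
    letI : MeasurableSpace (PontryaginDual G) := borel _
    ∀ U : PontryaginDual G → ℂ, MemLp U 2 (haarBorel (PontryaginDual G)) → (∀ ξ ∉ Ω, U ξ = 0) →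
      invFourierInt (haarBorel (PontryaginDual G)) U ∈ PaleyWienerCont Ω := by
  let _ : MeasurableSpace (PontryaginDual G) := borel _
  have : BorelSpace (PontryaginDual G) := ⟨rfl⟩
  let _ : MeasurableSpace G := borel G
  have : BorelSpace G := ⟨rfl⟩
  have := isHaarMeasure_haarBorel G
  have := regular_haarBorel G
  have := isHaarMeasure_haarBorel (PontryaginDual G)
  have := regular_haarBorel (PontryaginDual G)
  intro U hU hUΩ
  obtain ⟨c, hc, hnorm, hinner⟩ := exists_const_inner_ccFourier (haarBorel G)
    (haarBorel (PontryaginDual G))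
  -- With unnormalised Haar measures the Fourier transform of the inverse integral of `U` is `c *
  -- U`; the support condition does not see the factor.
  have hcU : MemLp (fun ξ => (c : ℂ) * U ξ) 2 (haarBorel (PontryaginDual G)) := hU.const_mul _
  have hcUΩ : ∀ ξ ∉ Ω, (c : ℂ) * U ξ = 0 := fun ξ hξ => by rw [hUΩ ξ hξ, mul_zero]
  have hcU1 := integrable_of_memLp_two_of_support hcU hfin.ne hcUΩ
  have hU1 := integrable_of_memLp_two_of_support hU hfin.ne hUΩ
  have heq : (fun x => (c : ℂ)⁻¹ * invFourierInt (haarBorel (PontryaginDual G))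
      (fun ξ => (c : ℂ) * U ξ) x) = invFourierInt (haarBorel (PontryaginDual G)) U := by
    ext x
    simp only [invFourierInt, mul_assoc]
    rw [integral_const_mul, inv_mul_cancel_left₀ (by exact_mod_cast hc.ne')]
  obtain ⟨hmem, u, hu1, hu2⟩ := exists_seq_tendsto_invFourierInt hc hnorm hinner hcU1 hcU
  rw [heq] at hmem hu1
  exact ⟨⟨_, ⟨hmem, hcU, fun n => u n, fun n => ⟨(u n).integrable, memLp_cc 2 (u n)⟩, hu1, hu2⟩,
    Eventually.of_forall hcUΩ⟩, continuous_invFourierInt hU1⟩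

/-- Elements of the Paley-Wiener space are inverse Fourier integrals. -/
theorem exists_eq_invFourierInt_of_mem_paleyWienerCont {Ω : Set (PontryaginDual G)}
    (hΩ : MeasurableSet[borel (PontryaginDual G)] Ω)
    (hfin : haarBorel (PontryaginDual G) Ω < ∞) {f : G → ℂ} (hf : f ∈ PaleyWienerCont Ω) :
    letI : MeasurableSpace (PontryaginDual G) := borel _
    ∃ F : PontryaginDual G → ℂ, MemLp F 2 (haarBorel (PontryaginDual G)) ∧
      (∀ ξ ∉ Ω, F ξ = 0) ∧ f = invFourierInt (haarBorel (PontryaginDual G)) F := by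
  let _ : MeasurableSpace (PontryaginDual G) := borel _
  have : BorelSpace (PontryaginDual G) := ⟨rfl⟩
  let _ : MeasurableSpace G := borel G
  have : BorelSpace G := ⟨rfl⟩
  have := isHaarMeasure_haarBorel G
  have := regular_haarBorel G
  have := isHaarMeasure_haarBorel (PontryaginDual G)
  have := regular_haarBorel (PontryaginDual G)
  obtain ⟨⟨F, ⟨hf2, hF2, φ, hφ, hφf, hφF⟩, hFΩ⟩, hfc⟩ := hf
  obtain ⟨c, hc, hnorm, hinner⟩ := exists_const_inner_ccFourier (haarBorel G)
    (haarBorel (PontryaginDual G))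
  have hΩ' : MeasurableSet Ω := hΩ
  change MemLp F 2 (haarBorel (PontryaginDual G)) at hF2
  change ∀ᵐ ξ ∂(haarBorel (PontryaginDual G)), ξ ∉ Ω → F ξ = 0 at hFΩ
  have hae : Ω.indicator F =ᵐ[haarBorel (PontryaginDual G)] F := by
    filter_upwards [hFΩ] with ξ hξ
    by_cases h : ξ ∈ Ω
    · rw [Set.indicator_of_mem h]
    · rw [Set.indicator_of_notMem h, hξ h]
  have hF1 : Integrable F (haarBorel (PontryaginDual G)) :=
    (integrable_of_memLp_two_of_support (hF2.indicator hΩ') hfin.ne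
      fun ξ hξ => Set.indicator_of_notMem hξ F).congr hae
  -- The factor undoes the constant of the inversion formula, and the indicator turns almost
  -- everywhere vanishing off `Ω` into vanishing at every point.
  refine ⟨fun ξ => (c : ℂ)⁻¹ * Ω.indicator F ξ, (hF2.indicator hΩ').const_mul _,
    fun ξ hξ => by simp [Set.indicator_of_notMem hξ], ?_⟩
  ext x
  have h := const_mul_eq_invFourierInt hinner hfc hf2 hF1 hF2 (fun n => (hφ n).1) hφf hφF x
  have h2 : invFourierInt (haarBorel (PontryaginDual G)) (fun ξ => (c : ℂ)⁻¹ * Ω.indicator F ξ) x =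
      (c : ℂ)⁻¹ * invFourierInt (haarBorel (PontryaginDual G)) F x := by
    simp only [invFourierInt, mul_assoc]
    rw [integral_const_mul]
    congr 1
    refine integral_congr_ae ?_
    filter_upwards [hae] with ξ hξ
    rw [hξ]
  rw [h2, ← h, inv_mul_cancel_left₀ (by exact_mod_cast hc.ne')]

end PaleyWiener

/-! ### Slices of Paley–Wiener functions -/

section Slices

variable {G₁ G₂ : Type*} [CommGroup G₁] [TopologicalSpace G₁] [IsTopologicalGroup G₁]
  [LocallyCompactSpace G₁] [T2Space G₁]
  [CommGroup G₂] [TopologicalSpace G₂] [IsTopologicalGroup G₂] [LocallyCompactSpace G₂]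
  [T2Space G₂] {Ω₁ : Set (PontryaginDual G₁)} {Ω₂ : Set (PontryaginDual G₂)}

/-- The slices of an element of `PW_{Ω₁ × Ω₂}` belong to `PW_{Ω₁}` and to `PW_{Ω₂}`. -/
theorem slices_mem_paleyWienerCont
    (hΩ₁ : MeasurableSet[borel (PontryaginDual G₁)] Ω₁)
    (hΩ₂ : MeasurableSet[borel (PontryaginDual G₂)] Ω₂)
    (hfin₁ : haarBorel (PontryaginDual G₁) Ω₁ < ∞)
    (hfin₂ : haarBorel (PontryaginDual G₂) Ω₂ < ∞)
    {f : G₁ × G₂ → ℂ} (hf : f ∈ PaleyWienerCont (dualProd Ω₁ Ω₂)) :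
    (∀ y, (fun x => f (x, y)) ∈ PaleyWienerCont Ω₁) ∧
      ∀ x, (fun y => f (x, y)) ∈ PaleyWienerCont Ω₂ := by
  let _ : MeasurableSpace (PontryaginDual (G₁ × G₂)) := borel _
  have : BorelSpace (PontryaginDual (G₁ × G₂)) := ⟨rfl⟩
  let _ : MeasurableSpace (PontryaginDual G₁) := borel _
  have : BorelSpace (PontryaginDual G₁) := ⟨rfl⟩
  let _ : MeasurableSpace (PontryaginDual G₂) := borel _
  have : BorelSpace (PontryaginDual G₂) := ⟨rfl⟩
  have := isHaarMeasure_haarBorel (PontryaginDual (G₁ × G₂))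
  have := regular_haarBorel (PontryaginDual (G₁ × G₂))
  have := isHaarMeasure_haarBorel (PontryaginDual G₁)
  have := regular_haarBorel (PontryaginDual G₁)
  have := isHaarMeasure_haarBorel (PontryaginDual G₂)
  have := regular_haarBorel (PontryaginDual G₂)
  have hΩ₁' : MeasurableSet Ω₁ := hΩ₁
  have hΩ₂' : MeasurableSet Ω₂ := hΩ₂
  have hmeas : MeasurableSet (dualProd Ω₁ Ω₂) :=
    ((continuous_fst_equiv (dualProdEquiv G₁ G₂)).measurable hΩ₁').inter
      ((continuous_snd_equiv (dualProdEquiv G₁ G₂)).measurable hΩ₂')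
  have hfin : haarBorel (PontryaginDual (G₁ × G₂)) (dualProd Ω₁ Ω₂) ≠ ∞ :=
    measure_prod_ne_top _ (haarBorel (PontryaginDual G₁)) (haarBorel (PontryaginDual G₂))
      (dualProdEquiv G₁ G₂) hfin₁.ne hfin₂.ne
  obtain ⟨F, hF, hFΩ, rfl⟩ := exists_eq_invFourierInt_of_mem_paleyWienerCont hmeas hfin.lt_top hf
  -- The exponential splits into a factor in `x` and one in `y`. The factor of the frozen variable
  -- plays the role of `b`, that of the free variable the role of `k`.
  have hmul : ∀ (χ : PontryaginDual (G₁ × G₂)) (x : G₁) (y : G₂), ((χ (x, y) : Circle) : ℂ) =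
      (((dualProdEquiv G₁ G₂ χ).1 x : Circle) : ℂ) * (((dualProdEquiv G₁ G₂ χ).2 y : Circle) : ℂ) :=
    fun χ x y => by rw [apply_mk_eq_mul, Circle.coe_mul]; rfl
  constructor
  · intro y
    obtain ⟨U, hU, hUΩ, hUk⟩ := exists_memLp_integral_slice (haarBorel (PontryaginDual G₁))
      (haarBorel (PontryaginDual G₂)) (dualProdEquiv G₁ G₂) hΩ₁' hΩ₂' hfin₁.ne hfin₂.ne hF
      (Eventually.of_forall fun χ hχ => hFΩ χ hχ)
      (b := fun η => ((η y : Circle) : ℂ)) (continuous_dual_apply y)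
      (fun η => (Circle.norm_coe _).le)
    convert! invFourierInt_mem_paleyWienerCont hfin₁ U hU hUΩ using 1
    ext x
    refine Eq.trans ?_ (hUk (fun ξ => ((ξ x : Circle) : ℂ))
      (continuous_dual_apply x) fun _ => (Circle.norm_coe _).le).symm
    simp only [invFourierInt, hmul]
  · intro x
    obtain ⟨U, hU, hUΩ, hUk⟩ := exists_memLp_integral_slice (haarBorel (PontryaginDual G₂))
      (haarBorel (PontryaginDual G₁)) (dualProdEquivSwap G₁ G₂) hΩ₂' hΩ₁' hfin₂.ne hfin₁.ne hF
      (Eventually.of_forall fun χ hχ => hFΩ χ fun h => hχ ⟨h.2, h.1⟩)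
      (b := fun η => ((η x : Circle) : ℂ)) (continuous_dual_apply x)
      (fun η => (Circle.norm_coe _).le)
    convert! invFourierInt_mem_paleyWienerCont hfin₂ U hU hUΩ using 1
    ext y
    refine Eq.trans ?_ (hUk (fun ξ => ((ξ y : Circle) : ℂ))
      (continuous_dual_apply y) fun _ => (Circle.norm_coe _).le).symm
    simp only [invFourierInt, hmul]
    congr 1
    ext χ
    rw [mul_comm ((((dualProdEquiv G₁ G₂) χ).1 x : Circle) : ℂ)]
    rfl

end Slices

/-! ### Uniqueness sets of products -/

theorem mainTheorem8
    {G₁ G₂ : Type*}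
    [CommGroup G₁] [TopologicalSpace G₁] [IsTopologicalGroup G₁] [LocallyCompactSpace G₁]
    [T2Space G₁]
    [CommGroup G₂] [TopologicalSpace G₂] [IsTopologicalGroup G₂] [LocallyCompactSpace G₂]
    [T2Space G₂]
    (Ω₁ : Set (PontryaginDual G₁)) (Ω₂ : Set (PontryaginDual G₂))
    (hΩ₁ : MeasurableSet[borel (PontryaginDual G₁)] Ω₁)
    (hΩ₂ : MeasurableSet[borel (PontryaginDual G₂)] Ω₂)
    (hfin₁ : haarBorel (PontryaginDual G₁) Ω₁ < ∞)
    (hfin₂ : haarBorel (PontryaginDual G₂) Ω₂ < ∞)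
    (Γ₁ : Set G₁) (Γ₂ : Set G₂)
    (h₁ : IsUniquenessSet (PaleyWienerCont Ω₁) Γ₁)
    (h₂ : IsUniquenessSet (PaleyWienerCont Ω₂) Γ₂) :
    IsUniquenessSet (PaleyWienerCont (dualProd Ω₁ Ω₂)) (Γ₁ ×ˢ Γ₂) := by
  intro f hf hf0
  obtain ⟨hs₁, hs₂⟩ := slices_mem_paleyWienerCont hΩ₁ hΩ₂ hfin₁ hfin₂ hf
  have hy : ∀ y ∈ Γ₂, ∀ x, f (x, y) = 0 := fun y hy x =>
    congrFun (h₁ _ (hs₁ y) fun x' hx' => hf0 (x', y) ⟨hx', hy⟩) x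
  ext z
  exact congrFun (h₂ _ (hs₂ z.1) fun y' hy' => hy y' hy' z.1) z.2
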